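/- **Baxter equation for the $BC$ Toda chain.** Let $n\ge 1$, let $\alpha,\beta\in\mathbb R$ with $\beta>0$, and put $g=\tfrac12+\tfrac{\alpha}{\beta}$. *Hamiltonians.* For $u\in\mathbb C$ let $$L_j(u)=\begin{pmatrix}u+i\partial_{x_j}&e^{-x_j}\\-e^{x_j}&0\end{pmatrix},\quad K(u)=\begin{pmatrix}-\alpha&u-\frac i2\\-\beta^2(u-\frac i2)&-\alpha\end{pmatrix},\quad \sigma_2=\begin{pmatrix}0&-i\\i&0\end{pmatrix},$$ $$\mathbb T_n(u)=L_n(u)\cdots L_1(u)\,K(u)\,\sigma_2\,L_1^t(-u)\cdots L_n^t(-u)\,\sigma_2 ,$$ where $t$ is the transposition of $2\times2$ matrices, and let the differential operator $\mathbb B_n(u)$ on $C^\infty(\mathbb R^n)$ be the $(1,2)$ entry of $\mathbb T_n(u)$. *Function space.* Let $\mathcal E_n(\mathbb R^n)$ be the space of $\phi\in C^\infty(\mathbb R^n)$ such that for every $(k_1,\dots,k_n)\in\mathbb N_0^n$ there are constants $a,b\ge0$ and a polynomial $P$ with $$\bigl|\partial_{x_1}^{k_1}\cdots\partial_{x_n}^{k_n}\phi(x_1,\dots,x_n)\bigr|\le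 a\,e^{b(|x_1|+\dots+|x_{n-1}|)}\times\begin{cases}P(x_n),&x_n\ge0,\\e^{b|x_n|},&x_n<0.\end{cases}$$ *Integral operators.* On functions of $(x_1,\dots,x_n,x_a)$ define, for $1\le j\le n$, $\mathcal R_{ja}(v)$ and $\mathcal R^*_{ja}(v)$, which act on the variables $(x_j,x_a)$, and $\mathcal K_a(v)$, which acts on $x_a$ (the remaining variables being parameters), by $$[\mathcal R_{ja}(v)\psi](x_j,x_a)=\int_{\mathbb R}e^{iv(x_j-y)-e^{x_j-y}-e^{y-x_a}}\,\psi(y,x_j)\,dy,$$ $$[\mathcal R^*_{ja}(v)\psi](x_j,x_a)=\int_{\mathbb R}e^{iv(y-x_j)-e^{y-x_j}-e^{-y-x_a}}\,\psi(y,-x_j)\,dy,$$ $$[\mathcal K_a(v)\psi](x_a)=\frac{(2\beta)^{iv}}{\Gamma(g-iv)}\int_{\ln\beta}^\infty e^{-2ivy-e^{y-x_a}}(1+\beta e^{-y})^{-iv-g}(1-\beta e^{-y})^{-iv+g-1}\,\psi(-y)\,dy .$$ Put $$\mathbb U_{na}(v)=\mathcal R_{na}(v)\cdots\mathcal R_{1a}(v)\,\mathcal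 K_a(v)\,\mathcal R^*_{1a}(v)\cdots\mathcal R^*_{na}(v).$$ The Baxter operator acts on functions $\phi$ of $(x_1,\dots,x_n)$, regarded as functions of $(x_1,\dots,x_n,x_a)$ that do not depend on $x_a$, by the pointwise limit $$[\mathbb Q_n(v)\phi](x_1,\dots,x_n)=\lim_{x_a\to+\infty}[\mathbb U_{na}(v)\phi](x_1,\dots,x_n,x_a).$$ *Claim.* Let $u\in\mathbb C$ with $1-g<\operatorname{Im}u<0$ (so that necessarily $g>1$), and let $\phi\in\mathcal E_n(\mathbb R^n)$. Then $\mathbb B_n(u)\phi\in\mathcal E_n(\mathbb R^n)$; both $\mathbb Q_n(u)\mathbb B_n(u)\phi$ and $\mathbb Q_n(u-i)\phi$ are well defined (each of the successive integrals converges absolutely at every point, and the limits exist at every point of $\mathbb R^n$); and $$\mathbb Q_n(u)\,\mathbb B_n(u)\,\phi=-\frac{\beta\,(g+iu)}{2u}\;\mathbb Q_n(u-i)\,\phi .$$ -/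

import Mathlib

namespace BCToda

open scoped Matrix ContDiff Topology

noncomputable section

/-! ### Differential operators and the monodromy matrix -/

/-- The space `C^∞(ℝⁿ)` of smooth complex-valued functions of `x = (x₁, …, xₙ)`
(the coordinates are indexed by `0, …, n - 1`). -/
def Smooth (n : ℕ) : Submodule ℂ ((Fin n → ℝ) → ℂ) where
  carrier := {f | ContDiff ℝ ∞ f}
  add_mem' := fun {_ _} (hf : ContDiff ℝ ∞ _) (hg : ContDiff ℝ ∞ _) => hf.add hg
  zero_mem' := (contDiff_const : ContDiff ℝ ∞ fun _ : Fin n → ℝ => (0 : ℂ))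
  smul_mem' := fun c _ (hf : ContDiff ℝ ∞ _) => hf.const_smul c

variable {n : ℕ}

theorem Smooth.contDiff (φ : Smooth n) : ContDiff ℝ ∞ (φ : (Fin n → ℝ) → ℂ) := φ.2

theorem Smooth.differentiable (φ : Smooth n) : Differentiable ℝ (φ : (Fin n → ℝ) → ℂ) :=
  (Smooth.contDiff φ).differentiable (by simp)

/-- The partial derivative `∂ / ∂x_j` as a linear operator on `C^∞(ℝⁿ)`. -/
def pd (j : Fin n) : Module.End ℂ (Smooth n) where
  toFun φ := ⟨fun x => fderiv ℝ (φ : (Fin n → ℝ) → ℂ) x (Pi.single j 1),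
    ((Smooth.contDiff φ).fderiv_right (m := ∞) (by simp)).clm_apply contDiff_const⟩
  map_add' φ ψ := by
    apply Subtype.ext
    funext x
    change fderiv ℝ ((φ : (Fin n → ℝ) → ℂ) + (ψ : (Fin n → ℝ) → ℂ)) x (Pi.single j 1) = _
    rw [fderiv_add (Smooth.differentiable φ x) (Smooth.differentiable ψ x)]
    rfl
  map_smul' c φ := by
    apply Subtype.ext
    funext x
    change fderiv ℝ (c • (φ : (Fin n → ℝ) → ℂ)) x (Pi.single j 1) = _
    rw [fderiv_const_smul (Smooth.differentiable φ x)]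
    rfl

/-- Multiplication by `e^{c x_j}` as a linear operator on `C^∞(ℝⁿ)`. -/
def mulExp (c : ℝ) (j : Fin n) : Module.End ℂ (Smooth n) where
  toFun φ := ⟨fun x => (Real.exp (c * x j) : ℂ) * (φ : (Fin n → ℝ) → ℂ) x,
    ContDiff.mul
      (Complex.ofRealCLM.contDiff.comp
        (Real.contDiff_exp.comp (contDiff_const.mul (contDiff_apply ℝ ℝ j))))
      (Smooth.contDiff φ)⟩
  map_add' φ ψ := by
    ext x
    exact mul_add _ _ _
  map_smul' c φ := by
    ext x
    exact mul_left_comm _ _ _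

/-- `2 × 2` matrices whose entries are linear operators on `C^∞(ℝⁿ)`; the entries are multiplied
by composition. -/
abbrev OpMatrix (n : ℕ) := Matrix (Fin 2) (Fin 2) (Module.End ℂ (Smooth n))

/-- A matrix of complex numbers as a matrix of scalar operators. -/
def scalarMatrix (A : Matrix (Fin 2) (Fin 2) ℂ) : OpMatrix n :=
  A.map (algebraMap ℂ (Module.End ℂ (Smooth n)))

/-- The Toda Lax matrix `L_j(u)`. -/
def lax (u : ℂ) (j : Fin n) : OpMatrix n :=
  !![u • (1 : Module.End ℂ (Smooth n)) + Complex.I • pd j, mulExp (-1) j;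
     -mulExp 1 j, 0]

/-- The boundary matrix `K(u)`. -/
def boundaryK (α β : ℝ) (u : ℂ) : Matrix (Fin 2) (Fin 2) ℂ :=
  !![-(α : ℂ), u - Complex.I / 2;
     -(β : ℂ) ^ 2 * (u - Complex.I / 2), -(α : ℂ)]

/-- The Pauli matrix `σ₂`. -/
def sigma2 : Matrix (Fin 2) (Fin 2) ℂ :=
  !![0, -Complex.I;
     Complex.I, 0]

/-- The monodromy matrix of the `BC` Toda chain,
`𝕋_n(u) = L_n(u) ⋯ L_1(u) K(u) σ₂ L_1ᵗ(-u) ⋯ L_nᵗ(-u) σ₂`. -/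
def monodromyMatrix (α β : ℝ) (n : ℕ) (u : ℂ) : OpMatrix n :=
  ((List.finRange n).reverse.map fun j => lax u j).prod * scalarMatrix (boundaryK α β u) *
    scalarMatrix sigma2 * ((List.finRange n).map fun j => (lax (-u) j)ᵀ).prod *
      scalarMatrix sigma2

/-- The generating function `𝔹_n(u)` of the `BC` Toda Hamiltonians: the upper right entry of the
monodromy matrix. -/
def opB (α β : ℝ) (n : ℕ) (u : ℂ) : Module.End ℂ (Smooth n) :=
  monodromyMatrix α β n u 0 1

/-! ### Function spaces -/

/-- The mixed partial derivative `∂_{x_1}^{k_1} ⋯ ∂_{x_n}^{k_n}`. -/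
def multiPd (k : Fin n → ℕ) : Module.End ℂ (Smooth n) :=
  ((List.finRange n).map fun j => pd j ^ k j).prod

/-- The space `𝓔_j(ℝⁿ)`: smooth functions which, with all their derivatives, are exponentially
bounded and grow at most polynomially as `x_j → +∞`. -/
def temperedSpace (j : Fin n) : Set (Smooth n) :=
  {φ | ∀ k : Fin n → ℕ, ∃ a b : ℝ, 0 ≤ a ∧ 0 ≤ b ∧ ∃ P : Polynomial ℝ, ∀ x : Fin n → ℝ,
    ‖(multiPd k φ : (Fin n → ℝ) → ℂ) x‖ ≤
      a * Real.exp (b * ∑ i ∈ Finset.univ.erase j, |x i|) *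
        if 0 ≤ x j then P.eval (x j) else Real.exp (b * |x j|)}

/-! ### Integral operators

They act on functions of `(x, t)`, where `x ∈ ℝⁿ` are the coordinates of the particles and `t = x_a`
is the auxiliary coordinate. -/

/-- An integral operator in one variable, given by its integrand: it sends `ψ` to
`(x, t) ↦ ∫ T ψ x t y dy`. -/
abbrev IntOp (n : ℕ) := ((Fin n → ℝ) → ℝ → ℂ) → (Fin n → ℝ) → ℝ → ℝ → ℂ

/-- The action of an integral operator. -/
def IntOp.act (T : IntOp n) (ψ : (Fin n → ℝ) → ℝ → ℂ) : (Fin n → ℝ) → ℝ → ℂ :=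
  fun x t => ∫ y : ℝ, T ψ x t y

/-- The action of a product `T_1 T_2 ⋯ T_m` (the last factor acts first). -/
def actProd (l : List (IntOp n)) (ψ : (Fin n → ℝ) → ℝ → ℂ) : (Fin n → ℝ) → ℝ → ℂ :=
  l.foldr IntOp.act ψ

/-- All the integrals that occur when the product `T_1 T_2 ⋯ T_m` is applied to `ψ` converge
absolutely. -/
def ConvergesOn : List (IntOp n) → ((Fin n → ℝ) → ℝ → ℂ) → Prop
  | [], _ => True
  | T :: l, ψ => ConvergesOn l ψ ∧
      ∀ x t, MeasureTheory.Integrable (T (actProd l ψ) x t) MeasureTheory.volume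

/-- The operator `𝓡_{ja}(v)`. -/
def opR (v : ℂ) (j : Fin n) : IntOp n := fun ψ x t y =>
  Complex.exp (Complex.I * v * ((x j : ℂ) - y) - Real.exp (x j - y) - Real.exp (y - t)) *
    ψ (Function.update x j y) (x j)

/-- The reflected operator `𝓡*_{ja}(v) = r_j 𝓡_{ja}(v) r_j`, where `r_j` changes the sign of `x_j`
(the variable of integration is changed to `-y`). -/
def opRstar (v : ℂ) (j : Fin n) : IntOp n := fun ψ x t y =>
  Complex.exp (Complex.I * v * ((y : ℂ) - x j) - Real.exp (y - x j) - Real.exp (-y - t)) *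
    ψ (Function.update x j y) (-x j)

/-- The parameter `g = 1/2 + α/β`. -/
def g (α β : ℝ) : ℝ := 1 / 2 + α / β

/-- The reflection operator `𝓚_a(v)`; the integration is over `y > ln β`. -/
def opK (α β : ℝ) (v : ℂ) : IntOp n := fun ψ x t =>
  (Set.Ioi (Real.log β)).indicator fun y =>
    ((2 * β : ℝ) : ℂ) ^ (Complex.I * v) / Complex.Gamma (g α β - Complex.I * v) *
      (Complex.exp (-2 * Complex.I * v * y - Real.exp (y - t)) *
        ((1 + β * Real.exp (-y) : ℝ) : ℂ) ^ (-Complex.I * v - g α β) *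
        ((1 - β * Real.exp (-y) : ℝ) : ℂ) ^ (-Complex.I * v + g α β - 1) *
        ψ x (-y))

/-- The factors of the monodromy operator
`𝕌_{na}(v) = 𝓡_{na}(v) ⋯ 𝓡_{1a}(v) 𝓚_a(v) 𝓡*_{1a}(v) ⋯ 𝓡*_{na}(v)`. -/
def monodromyFactors (α β : ℝ) (n : ℕ) (v : ℂ) : List (IntOp n) :=
  ((List.finRange n).reverse.map fun j => opR v j) ++
    opK α β v :: (List.finRange n).map fun j => opRstar v j

/-- The function `𝕌_{na}(v) φ` of `(x, x_a)`, for `φ` a function of `x` only. -/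
def opU (α β : ℝ) (n : ℕ) (v : ℂ) (φ : (Fin n → ℝ) → ℂ) : (Fin n → ℝ) → ℝ → ℂ :=
  actProd (monodromyFactors α β n v) fun x _ => φ x

/-- The Baxter operator `ℚ_n(v)`: the limit of `𝕌_{na}(v) φ` as `x_a → +∞`. -/
def baxterQ (α β : ℝ) (n : ℕ) (v : ℂ) (φ : (Fin n → ℝ) → ℂ) : (Fin n → ℝ) → ℂ :=
  fun x => Filter.limUnder Filter.atTop (opU α β n v φ x)

/-- `ℚ_n(v) φ` is well defined: the integrals in `𝕌_{na}(v) φ` converge absolutely, and the limit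
as `x_a → +∞` exists at every point. -/
def BaxterDefined (α β : ℝ) (n : ℕ) (v : ℂ) (φ : (Fin n → ℝ) → ℂ) : Prop :=
  ConvergesOn (monodromyFactors α β n v) (fun x _ => φ x) ∧
    ∀ x, ∃ q : ℂ, Filter.Tendsto (opU α β n v φ x) Filter.atTop (𝓝 q)

end

end BCToda

namespace BCToda
open scoped Matrix ContDiff Topology
open MeasureTheory Filter

variable {n : ℕ} {P : Type*} [MeasurableSpace P]

/-! ### Exponentially bounded families and admissible integral operators -/

/-! The Baxter equation is the limit of an exact relation at finite `t = x_a`. The monodromy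
operator of a list of sites is applied not to `f(x)` alone but to `e^{-S e^{-t} - m t} f(x)`; call
the result `U_m(v) f` (`siteU`). Put `σ = e^{-t} + S`, and let `M` be the monodromy matrix of the
same sites. Then `intertwining` says that the row `(iσ U_1(u) - 2u U_0(u), -σ U_0(u))` times `M(u)`
equals `-β(g + iu)` times the row `(i U_1(u - i), -U_0(u - i))`. In the second column at `S = 0`,
the two terms carrying `σ = e^{-t}` vanish as `t → +∞`, and what remains is `-2u ℚ(u) 𝔹(u) = β(g +
iu) ℚ(u - i)`.

The relation is proved by induction on the sites. Without sites, `U_m` is a moment of the reflection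
weight. Two integrations by parts express the result through moments at `u - i`, and `det K(u) =
β²(g + iu)(g - 1 - iu)`, together with the functional equation of `Γ`, gives the factor
(`intertwining_nil`). Adding a site wraps `M` as `L_j M L̃_j` with `L̃_j = σ₂ L_jᵗ(-u) σ₂`, and
wraps the operator in a double integral over `w` and `y` (`siteU_cons`). Its inner function is the
old operator with `S = e^{-y}`, taken at `x_j = y` and `t = x_j` (`layer_eq_siteU`). This is why `S`
must be free in the induction, and `m = 1` appears because `∂_y` acts on `e^{-e^{-y-t}}`.
Integration by parts in `w` and `y` moves `L_j` inside as exactly the row of the induction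
hypothesis (`siteIntegral_intertwining`); the columns of `L̃_j` then reproduce the shift `u → u -
i`.

The analysis rests on two facts. All operators are dominated on exponentially bounded functions
(`Admissible`), which justifies Fubini and differentiation under the integrals. For `Im v < 0` and
tempered `f`, the outer double integral converges even without the `x_a` cutoff
(`integrable_phase_mul_integral`), so dominated convergence gives the limits. The bound `Im u > 1 -
g` makes the reflection integral converge at `u - i` and kills its boundary term at `u`. -/

/-- The weight `|x_1| + ⋯ + |x_n| + |t|`. -/
def weight (x : Fin n → ℝ) (t : ℝ) : ℝ := ∑ i, |x i| + |t|

theorem weight_nonneg (x : Fin n → ℝ) (t : ℝ) : 0 ≤ weight x t := by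
  unfold weight; positivity

theorem abs_apply_le_weight (x : Fin n → ℝ) (t : ℝ) (i : Fin n) : |x i| ≤ weight x t := by
  have := Finset.single_le_sum (f := fun i => |x i|) (fun i _ => abs_nonneg _) (Finset.mem_univ i)
  have h := abs_nonneg t
  simp only [weight]
  linarith

theorem abs_le_weight (x : Fin n → ℝ) (t : ℝ) : |t| ≤ weight x t := by
  have : 0 ≤ ∑ i, |x i| := by positivity
  simp only [weight]
  linarith

theorem sum_abs_update_le (x : Fin n → ℝ) (j : Fin n) (y : ℝ) :
    ∑ i, |Function.update x j y i| ≤ ∑ i, |x i| + |y| := by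
  rw [← Finset.add_sum_erase _ _ (Finset.mem_univ j),
    ← Finset.add_sum_erase _ (fun i => |x i|) (Finset.mem_univ j)]
  have : ∑ i ∈ Finset.univ.erase j, |Function.update x j y i|
      = ∑ i ∈ Finset.univ.erase j, |x i| :=
    Finset.sum_congr rfl fun i hi => by rw [Function.update_of_ne (Finset.ne_of_mem_erase hi)]
  have h := abs_nonneg (x j)
  simp only [Function.update_self, this]
  linarith

/-- A jointly measurable family of functions of `(x, t)`, exponentially bounded with a constant
proportional to `M`. -/
structure ExpFamily (M : P → ℝ) (F : P → (Fin n → ℝ) → ℝ → ℂ) : Prop where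
  meas : Measurable fun q : P × (Fin n → ℝ) × ℝ => F q.1 q.2.1 q.2.2
  nonneg : ∀ p, 0 ≤ M p
  bdd : ∃ C b : ℝ, 0 ≤ C ∧ 0 ≤ b ∧ ∀ p x t, ‖F p x t‖ ≤ C * M p * Real.exp (b * weight x t)

/-- A measurable and exponentially bounded function of `(x, t)`. -/
def ExpBounded (ψ : (Fin n → ℝ) → ℝ → ℂ) : Prop :=
  ExpFamily (P := Unit) (fun _ => 1) fun _ => ψ

theorem ExpFamily.comp {Q : Type*} [MeasurableSpace Q] {M : P → ℝ}
    {F : P → (Fin n → ℝ) → ℝ → ℂ} (h : ExpFamily M F) {f : Q → P} (hf : Measurable f) :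
    ExpFamily (fun q => M (f q)) fun q => F (f q) where
  meas := h.meas.comp ((hf.comp measurable_fst).prodMk measurable_snd)
  nonneg q := h.nonneg _
  bdd := by
    obtain ⟨C, b, hC, hb, h⟩ := h.bdd
    exact ⟨C, b, hC, hb, fun q => h _⟩

theorem ExpFamily.expBounded {M : P → ℝ} {F : P → (Fin n → ℝ) → ℝ → ℂ} (h : ExpFamily M F)
    (p : P) : ExpBounded (F p) := by
  have := h.comp (f := fun _ : Unit => p) measurable_const
  obtain ⟨C, b, hC, hb, hF⟩ := this.bdd
  exact ⟨this.meas, fun _ => zero_le_one, C * M p, b, mul_nonneg hC (h.nonneg p), hb,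
    fun q x t => by simpa using hF q x t⟩

theorem expBounded_iff {ψ : (Fin n → ℝ) → ℝ → ℂ} : ExpBounded ψ ↔
    Measurable (fun q : (Fin n → ℝ) × ℝ => ψ q.1 q.2) ∧
      ∃ C b : ℝ, 0 ≤ C ∧ 0 ≤ b ∧ ∀ x t, ‖ψ x t‖ ≤ C * Real.exp (b * weight x t) := by
  constructor
  · intro h
    refine ⟨h.meas.comp (measurable_const (a := ()) |>.prodMk measurable_id), ?_⟩
    obtain ⟨C, b, hC, hb, h⟩ := h.bdd
    exact ⟨C, b, hC, hb, fun x t => by simpa using h () x t⟩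
  · rintro ⟨h, C, b, hC, hb, hψ⟩
    exact ⟨h.comp measurable_snd, fun _ => zero_le_one, C, b, hC, hb,
      fun _ x t => by simpa using hψ x t⟩

theorem ExpFamily.add {M : P → ℝ} {F G : P → (Fin n → ℝ) → ℝ → ℂ} (hF : ExpFamily M F)
    (hG : ExpFamily M G) : ExpFamily M fun p x t => F p x t + G p x t where
  meas := hF.meas.add hG.meas
  nonneg := hF.nonneg
  bdd := by
    obtain ⟨C, b, hC, hb, h⟩ := hF.bdd
    obtain ⟨C', b', hC', hb', h'⟩ := hG.bdd
    refine ⟨C + C', max b b', by positivity, le_max_of_le_left hb, fun p x t => ?_⟩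
    have hw := weight_nonneg x t
    have hM := hF.nonneg p
    calc _ ≤ C * M p * Real.exp (b * weight x t) + C' * M p * Real.exp (b' * weight x t) :=
          (norm_add_le _ _).trans (add_le_add (h p x t) (h' p x t))
      _ ≤ C * M p * Real.exp (max b b' * weight x t)
          + C' * M p * Real.exp (max b b' * weight x t) := by
        gcongr
        · exact le_max_left _ _
        · exact le_max_right _ _
      _ = _ := by ring

theorem expBounded_exp (c : ℝ) :
    ExpBounded fun (_ : Fin n → ℝ) (t : ℝ) => ((Real.exp (c * t) : ℝ) : ℂ) := by
  refine expBounded_iff.2 ⟨by fun_prop, 1, |c|, zero_le_one, abs_nonneg _, fun x t => ?_⟩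
  rw [Complex.norm_real, Real.norm_eq_abs, Real.abs_exp, one_mul, Real.exp_le_exp]
  calc c * t ≤ |c * t| := le_abs_self _
    _ = |c| * |t| := abs_mul _ _
    _ ≤ _ := by gcongr; exact abs_le_weight x t

/-- An integral operator with a measurable kernel acting by substitution, dominated on
exponentially bounded functions by a fixed integrable function. -/
def Admissible (T : IntOp n) : Prop :=
  ∃ (k : (Fin n → ℝ) × ℝ × ℝ → ℂ) (X : (Fin n → ℝ) × ℝ × ℝ → (Fin n → ℝ) × ℝ) (ρ : ℝ → ℝ),
    Measurable k ∧ Measurable X ∧ Integrable ρ ∧ (∀ y, 0 ≤ ρ y) ∧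
    (∀ ψ x t y, T ψ x t y = k (x, t, y) * ψ (X (x, t, y)).1 (X (x, t, y)).2) ∧
    ∀ b, 0 ≤ b → ∃ C b' : ℝ, 0 ≤ C ∧ 0 ≤ b' ∧ ∀ x t y,
      ‖k (x, t, y)‖ * Real.exp (b * weight (X (x, t, y)).1 (X (x, t, y)).2) ≤
        C * Real.exp (b' * weight x t) * ρ y

/-! ### Calculus with a single admissible operator -/

section Admissible

variable {T : IntOp n} {M : P → ℝ} {F : P → (Fin n → ℝ) → ℝ → ℂ}

theorem Admissible.measurable_family (hT : Admissible T) (hF : ExpFamily M F) :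
    Measurable fun q : (P × (Fin n → ℝ) × ℝ) × ℝ => T (F q.1.1) q.1.2.1 q.1.2.2 q.2 := by
  obtain ⟨k, X, ρ, hk, hX, -, -, hT, -⟩ := hT
  have e : Measurable fun q : (P × (Fin n → ℝ) × ℝ) × ℝ => (q.1.2.1, q.1.2.2, q.2) := by fun_prop
  have h : Measurable fun q : (P × (Fin n → ℝ) × ℝ) × ℝ => (q.1.1, X (q.1.2.1, q.1.2.2, q.2)) :=
    Measurable.prodMk (by fun_prop) (hX.comp e)
  simp only [hT]
  exact (hk.comp e).mul (hF.meas.comp h)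

theorem Admissible.dominated (hT : Admissible T) (hF : ExpFamily M F) :
    ∃ (C b : ℝ) (ρ : ℝ → ℝ), 0 ≤ C ∧ 0 ≤ b ∧ Integrable ρ ∧ (∀ y, 0 ≤ ρ y) ∧
      ∀ p x t y, ‖T (F p) x t y‖ ≤ C * M p * Real.exp (b * weight x t) * ρ y := by
  obtain ⟨k, X, ρ, hk, hX, hρ, hρ0, hT, hb⟩ := hT
  obtain ⟨C, b, hC, hb0, hFb⟩ := hF.bdd
  obtain ⟨C', b', hC', hb', h⟩ := hb b hb0
  refine ⟨C * C', b', ρ, by positivity, hb', hρ, hρ0, fun p x t y => ?_⟩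
  have hM := hF.nonneg p
  rw [hT, norm_mul]
  calc _ ≤ ‖k (x, t, y)‖ * (C * M p *
        Real.exp (b * weight (X (x, t, y)).1 (X (x, t, y)).2)) := by gcongr; exact hFb _ _ _
    _ = C * M p * (‖k (x, t, y)‖ * Real.exp (b * weight (X (x, t, y)).1 (X (x, t, y)).2)) := by
      ring
    _ ≤ C * M p * (C' * Real.exp (b' * weight x t) * ρ y) :=
      mul_le_mul_of_nonneg_left (h x t y) (by positivity)
    _ = _ := by ring

theorem Admissible.integrable (hT : Admissible T) (hF : ExpFamily M F) (p : P) (x : Fin n → ℝ)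
    (t : ℝ) : Integrable (T (F p) x t) := by
  obtain ⟨C, b, ρ, -, -, hρ, -, h⟩ := hT.dominated hF
  refine (hρ.const_mul (C * M p * Real.exp (b * weight x t))).mono' ?_
    (Eventually.of_forall fun y => h p x t y)
  exact ((hT.measurable_family hF).comp (f := fun y => ((p, x, t), y)) (by fun_prop)
    ).aestronglyMeasurable

/-- The parameter weight `M` survives unchanged; only the constant and the exponent in `(x, t)` get
worse. Hence one `M` serves a whole product of operators, and growth or decay in the parameter
passes through it. -/
theorem Admissible.act (hT : Admissible T) (hF : ExpFamily M F) :
    ExpFamily M fun p => T.act (F p) where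
  meas := ((hT.measurable_family hF).stronglyMeasurable.integral_prod_right
    (ν := volume)).measurable
  nonneg := hF.nonneg
  bdd := by
    obtain ⟨C, b, ρ, hC, hb, hρ, hρ0, h⟩ := hT.dominated hF
    refine ⟨C * ∫ y, ρ y, b, mul_nonneg hC (integral_nonneg hρ0), hb, fun p x t => ?_⟩
    refine (norm_integral_le_of_norm_le
      (hρ.const_mul (C * M p * Real.exp (b * weight x t)))
      (Eventually.of_forall fun y => h p x t y)).trans_eq ?_
    rw [integral_const_mul]
    ring

theorem Admissible.act_add (hT : Admissible T) {ψ χ : (Fin n → ℝ) → ℝ → ℂ} (hψ : ExpBounded ψ)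
    (hχ : ExpBounded χ) :
    T.act (fun x t => ψ x t + χ x t) = fun x t => T.act ψ x t + T.act χ x t := by
  funext x t
  unfold IntOp.act
  rw [← integral_add (hT.integrable hψ () x t) (hT.integrable hχ () x t)]
  obtain ⟨k, X, ρ, -, -, -, -, hT, -⟩ := hT
  simp only [hT, mul_add]

theorem Admissible.act_const_mul (hT : Admissible T) (ψ : (Fin n → ℝ) → ℝ → ℂ) (c : ℂ) :
    T.act (fun x t => c * ψ x t) = fun x t => c * T.act ψ x t := by
  funext x t
  unfold IntOp.act
  rw [← integral_const_mul]
  obtain ⟨k, X, ρ, -, -, -, -, hT, -⟩ := hT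
  simp only [hT, mul_left_comm]

/-- Domination is needed only for parameters near `y`, so a locally bounded `M` is enough; `ρ` takes
care of the integration variable. -/
theorem Admissible.hasDerivAt_act (hT : Admissible T) {M : ℝ → ℝ}
    {F F' : ℝ → (Fin n → ℝ) → ℝ → ℂ} (hM : Continuous M) (hF : ExpFamily M F)
    (hF' : ExpFamily M F') (h : ∀ x t y, HasDerivAt (fun y => F y x t) (F' y x t) y)
    (x : Fin n → ℝ) (t y : ℝ) :
    HasDerivAt (fun y => T.act (F y) x t) (T.act (F' y) x t) y := by
  obtain ⟨C, b, ρ, hC, hb, hρ, hρ0, hd⟩ := hT.dominated hF'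
  obtain ⟨K, hK⟩ := (isCompact_closedBall y 1).bddAbove_image hM.continuousOn
  have hK : ∀ z ∈ Metric.closedBall y 1, M z ≤ K := fun z hz => hK ⟨z, hz, rfl⟩
  refine (hasDerivAt_integral_of_dominated_loc_of_deriv_le (F := fun y => T (F y) x t)
    (F' := fun y => T (F' y) x t)
    (bound := fun z => C * K * Real.exp (b * weight x t) * ρ z)
    (Metric.closedBall_mem_nhds y one_pos)
    (Eventually.of_forall fun y => (hT.integrable hF y x t).aestronglyMeasurable)
    (hT.integrable hF y x t) (hT.integrable hF' y x t).aestronglyMeasurable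
    (Eventually.of_forall fun z w hw => (hd w x t z).trans ?_)
    (hρ.const_mul _) (Eventually.of_forall fun z w _ => ?_)).2
  · have := hρ0 z
    gcongr
    exact hK w hw
  · obtain ⟨k, X, ρ, -, -, -, -, hT, -⟩ := hT
    simp only [hT]
    exact (h _ _ w).const_mul _

/-- Fubini, with majorant a constant times `M(y) ρ(z)`. -/
theorem Admissible.act_integral (hT : Admissible T) {M : ℝ → ℝ}
    {F : ℝ → (Fin n → ℝ) → ℝ → ℂ} (hM : Integrable M) (hF : ExpFamily M F) :
    T.act (fun x t => ∫ y, F y x t) = fun x t => ∫ y, T.act (F y) x t := by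
  funext x t
  have hm : Measurable fun q : ℝ × ℝ => T (F q.1) x t q.2 :=
    (hT.measurable_family hF).comp (f := fun q : ℝ × ℝ => ((q.1, x, t), q.2)) (by fun_prop)
  obtain ⟨C, b, ρ, hC, hb, hρ, hρ0, hd⟩ := hT.dominated hF
  have hi : Integrable (Function.uncurry fun y z => T (F y) x t z) (volume.prod volume) := by
    refine ((hM.mul_prod hρ).const_mul (C * Real.exp (b * weight x t))).mono'
      hm.aestronglyMeasurable (Eventually.of_forall fun q => (hd q.1 x t q.2).trans_eq ?_)
    ring
  unfold IntOp.act
  rw [integral_integral_swap hi]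
  obtain ⟨k, X, ρ, -, -, -, -, hT, -⟩ := hT
  simp only [hT, integral_const_mul]

end Admissible

/-! ### Products of admissible operators -/

section actProd

variable {l : List (IntOp n)} {M : P → ℝ} {F : P → (Fin n → ℝ) → ℝ → ℂ}

theorem actProd_cons (T : IntOp n) (l : List (IntOp n)) (ψ : (Fin n → ℝ) → ℝ → ℂ) :
    actProd (T :: l) ψ = T.act (actProd l ψ) := rfl

theorem actProd_append (l l' : List (IntOp n)) (ψ : (Fin n → ℝ) → ℝ → ℂ) :
    actProd (l ++ l') ψ = actProd l (actProd l' ψ) :=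
  List.foldr_append

theorem ExpFamily.actProd (hl : ∀ T ∈ l, Admissible T) (hF : ExpFamily M F) :
    ExpFamily M fun p => actProd l (F p) := by
  induction l with
  | nil => exact hF
  | cons T l ih =>
    rw [List.forall_mem_cons] at hl
    exact hl.1.act (ih hl.2)

theorem convergesOn_of_admissible (hl : ∀ T ∈ l, Admissible T) {ψ : (Fin n → ℝ) → ℝ → ℂ}
    (hψ : ExpBounded ψ) : ConvergesOn l ψ := by
  induction l with
  | nil => trivial
  | cons T l ih =>
    rw [List.forall_mem_cons] at hl
    exact ⟨ih hl.2, fun x t => hl.1.integrable (hψ.actProd hl.2) () x t⟩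

theorem actProd_add (hl : ∀ T ∈ l, Admissible T) {ψ χ : (Fin n → ℝ) → ℝ → ℂ}
    (hψ : ExpBounded ψ) (hχ : ExpBounded χ) :
    actProd l (fun x t => ψ x t + χ x t) = fun x t => actProd l ψ x t + actProd l χ x t := by
  induction l with
  | nil => rfl
  | cons T l ih =>
    rw [List.forall_mem_cons] at hl
    rw [actProd_cons, ih hl.2, hl.1.act_add (hψ.actProd hl.2) (hχ.actProd hl.2)]
    rfl

theorem actProd_const_mul (hl : ∀ T ∈ l, Admissible T) (ψ : (Fin n → ℝ) → ℝ → ℂ) (c : ℂ) :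
    actProd l (fun x t => c * ψ x t) = fun x t => c * actProd l ψ x t := by
  induction l with
  | nil => rfl
  | cons T l ih =>
    rw [List.forall_mem_cons] at hl
    rw [actProd_cons, ih hl.2, hl.1.act_const_mul]
    rfl

theorem hasDerivAt_actProd (hl : ∀ T ∈ l, Admissible T) {M : ℝ → ℝ}
    {F F' : ℝ → (Fin n → ℝ) → ℝ → ℂ} (hM : Continuous M) (hF : ExpFamily M F)
    (hF' : ExpFamily M F') (h : ∀ x t y, HasDerivAt (fun y => F y x t) (F' y x t) y)
    (x : Fin n → ℝ) (t y : ℝ) :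
    HasDerivAt (fun y => actProd l (F y) x t) (actProd l (F' y) x t) y := by
  induction l generalizing x t y with
  | nil => exact h x t y
  | cons T l ih =>
    rw [List.forall_mem_cons] at hl
    exact hl.1.hasDerivAt_act hM (hF.actProd hl.2) (hF'.actProd hl.2) (ih hl.2) x t y

theorem actProd_integral (hl : ∀ T ∈ l, Admissible T) {M : ℝ → ℝ}
    {F : ℝ → (Fin n → ℝ) → ℝ → ℂ} (hM : Integrable M) (hF : ExpFamily M F) :
    actProd l (fun x t => ∫ y, F y x t) = fun x t => ∫ y, actProd l (F y) x t := by
  induction l with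
  | nil => rfl
  | cons T l ih =>
    rw [List.forall_mem_cons] at hl
    rw [actProd_cons, ih hl.2, hl.1.act_integral hM (hF.actProd hl.2)]
    rfl

end actProd

/-! ### Locality -/

/-- The operator does not involve the coordinate `x_j`. -/
def LocalAway (j : Fin n) (T : IntOp n) : Prop :=
  ∀ ψ x t y w, T ψ (Function.update x j w) t y =
    T (fun x' t' => ψ (Function.update x' j w) t') x t y

/-- Freezing `x_j` commutes with operators that do not see `x_j`. For the inner sites the outer
coordinate thus becomes a mere parameter. -/
theorem actProd_update {j : Fin n} {l : List (IntOp n)} (hl : ∀ T ∈ l, LocalAway j T)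
    (ψ : (Fin n → ℝ) → ℝ → ℂ) (x : Fin n → ℝ) (t w : ℝ) :
    actProd l ψ (Function.update x j w) t =
      actProd l (fun x' t' => ψ (Function.update x' j w) t') x t := by
  induction l generalizing x t with
  | nil => rfl
  | cons T l ih =>
    rw [List.forall_mem_cons] at hl
    have : (fun x' t' => actProd l ψ (Function.update x' j w) t') =
        actProd l (fun x' t' => ψ (Function.update x' j w) t') := by
      funext x' t'
      exact ih hl.2 x' t'
    rw [actProd_cons, actProd_cons, ← this]
    unfold IntOp.act
    simp only [hl.1 _ x t _ w]

theorem localAway_opR (v : ℂ) {i j : Fin n} (h : i ≠ j) : LocalAway j (opR v i) := by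
  intro ψ x t y w
  simp only [opR, Function.update_of_ne h, Function.update_comm h]

theorem localAway_opRstar (v : ℂ) {i j : Fin n} (h : i ≠ j) : LocalAway j (opRstar v i) := by
  intro ψ x t y w
  simp only [opRstar, Function.update_of_ne h, Function.update_comm h]

theorem localAway_opK (α β : ℝ) (v : ℂ) (j : Fin n) : LocalAway j (opK α β v) := by
  intro ψ x t y w
  rfl

end BCToda

namespace BCToda
open scoped Matrix ContDiff Topology
open MeasureTheory Filter

variable {n : ℕ}

/-! ### Admissibility of the elementary operators -/

/-- For `s ≥ 0` this is `(e^s)^m / m! ≤ e^{e^s}` with `m ≥ c`; for `s < 0` the left side is at most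
`1` and the exponential on the right at least `1`. -/
theorem exists_exp_neg_exp_le (c : ℝ) :
    ∃ C : ℝ, 1 ≤ C ∧ ∀ c', 0 ≤ c' → c' ≤ c → ∀ s : ℝ,
      Real.exp (-Real.exp s) ≤ C * Real.exp (-(c' * s)) := by
  obtain ⟨m, hm⟩ := exists_nat_ge c
  have hf : (1 : ℝ) ≤ m.factorial := by exact_mod_cast m.factorial_pos
  refine ⟨m.factorial, hf, fun c' hc' hc s => ?_⟩
  rcases le_or_gt 0 s with hs | hs
  · have h := Real.pow_div_factorial_le_exp (Real.exp s) (Real.exp_pos s).le m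
    rw [div_le_iff₀ (by positivity), ← Real.exp_nat_mul] at h
    rw [Real.exp_neg, inv_le_iff_one_le_mul₀ (Real.exp_pos _)]
    calc (1 : ℝ) = Real.exp (m * s) * Real.exp (-(m * s)) := by rw [← Real.exp_add]; simp
      _ ≤ Real.exp (Real.exp s) * m.factorial * Real.exp (-(c' * s)) := by
        gcongr
        linarith
      _ = _ := by ring
  · calc Real.exp (-Real.exp s) ≤ 1 := Real.exp_le_one_iff.2 (neg_nonpos.2 (Real.exp_pos _).le)
      _ ≤ Real.exp (-(c' * s)) := Real.one_le_exp (by nlinarith)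
      _ ≤ _ := le_mul_of_one_le_left (Real.exp_pos _).le hf

/-- A two-sided double exponential cutoff decays faster than any exponential. -/
theorem exists_cutoff_le {c : ℝ} (hc : 0 ≤ c) : ∃ C : ℝ, 1 ≤ C ∧ ∀ s t y : ℝ,
    Real.exp (-Real.exp (s - y) - Real.exp (y - t)) ≤
      C * Real.exp (c * (|s| + |t|)) * Real.exp (-(c * |y|)) := by
  obtain ⟨C, hC, h⟩ := exists_exp_neg_exp_le c
  refine ⟨C, hC, fun s t y => ?_⟩
  have hs : Real.exp (-Real.exp (s - y)) ≤ 1 :=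
    Real.exp_le_one_iff.2 (neg_nonpos.2 (Real.exp_pos _).le)
  have ht : Real.exp (-Real.exp (y - t)) ≤ 1 :=
    Real.exp_le_one_iff.2 (neg_nonpos.2 (Real.exp_pos _).le)
  rw [sub_eq_add_neg, Real.exp_add]
  -- The factor `e^{-e^{y-t}}` supplies the decay for `y ≥ 0`, and `e^{-e^{s-y}}` for `y < 0`; the
  -- other one is bounded by `1`.
  rcases le_or_gt 0 y with hy | hy
  · calc _ ≤ 1 * (C * Real.exp (-(c * (y - t)))) :=
          mul_le_mul hs (h c hc le_rfl _) (Real.exp_pos _).le zero_le_one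
      _ ≤ C * Real.exp (c * (|s| + |t|) + -(c * |y|)) := by
        rw [one_mul, abs_of_nonneg hy]
        gcongr
        nlinarith [le_abs_self t, abs_nonneg s]
      _ = _ := by rw [Real.exp_add, mul_assoc]
  · calc _ ≤ (C * Real.exp (-(c * (s - y)))) * 1 :=
          mul_le_mul (h c hc le_rfl _) ht (Real.exp_pos _).le (by positivity)
      _ ≤ C * Real.exp (c * (|s| + |t|) + -(c * |y|)) := by
        rw [mul_one, abs_of_neg hy]
        gcongr
        nlinarith [neg_abs_le s, abs_nonneg t]
      _ = _ := by rw [Real.exp_add, mul_assoc]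

theorem integrable_exp_neg_mul_abs {c : ℝ} (hc : 0 < c) :
    Integrable fun y : ℝ => Real.exp (-(c * |y|)) := by
  rw [← integrableOn_univ, ← Set.Iic_union_Ioi (a := (0 : ℝ)), integrableOn_union]
  constructor
  · refine (integrableOn_exp_mul_Iic hc 0).congr_fun (fun y hy => ?_) measurableSet_Iic
    simp [abs_of_nonpos (Set.mem_Iic.1 hy)]
  · refine (exp_neg_integrableOn_Ioi 0 hc).congr_fun (fun y hy => ?_) measurableSet_Ioi
    simp [abs_of_pos (Set.mem_Ioi.1 hy)]

theorem norm_exp_phase (v : ℂ) (s a : ℝ) :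
    ‖Complex.exp (Complex.I * v * s - a)‖ = Real.exp (-v.im * s - a) := by
  rw [Complex.norm_exp]
  congr 1
  simp

theorem exists_kernel_le (v : ℂ) {b : ℝ} (hb : 0 ≤ b) : ∃ C b' : ℝ, 0 ≤ C ∧ 0 ≤ b' ∧
    ∀ s t y r : ℝ, |r| = |s - y| →
    Real.exp (-v.im * r - (Real.exp (s - y) + Real.exp (y - t))) * Real.exp (b * |y|) ≤
      C * Real.exp (b' * (|s| + |t|)) * Real.exp (-(1 * |y|)) := by
  -- The rate pays `|Im v|` for the phase and `b` for the growth of the argument, and keeps `1` for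
  -- integrability.
  obtain ⟨C, hC, h⟩ := exists_cutoff_le (c := |v.im| + b + 1) (by positivity)
  refine ⟨C, |v.im| + b + 1 + |v.im|, by positivity, by positivity, fun s t y r hr => ?_⟩
  have h1 : -v.im * r ≤ |v.im| * (|s| + |t|) + |v.im| * |y| := by
    calc -v.im * r ≤ |-v.im * r| := le_abs_self _
      _ = |v.im| * |s - y| := by rw [abs_mul, abs_neg, hr]
      _ ≤ |v.im| * (|s| + |y|) := by gcongr; exact abs_sub _ _
      _ ≤ _ := by nlinarith [abs_nonneg t, abs_nonneg v.im]
  calc _ = Real.exp (-v.im * r) * Real.exp (-Real.exp (s - y) - Real.exp (y - t))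
        * Real.exp (b * |y|) := by rw [← Real.exp_add (-v.im * r)]; ring_nf
    _ ≤ Real.exp (|v.im| * (|s| + |t|) + |v.im| * |y|) *
        (C * Real.exp ((|v.im| + b + 1) * (|s| + |t|)) * Real.exp (-((|v.im| + b + 1) * |y|)))
        * Real.exp (b * |y|) := by
      gcongr
      exact h s t y
    _ = C * (Real.exp (|v.im| * (|s| + |t|) + |v.im| * |y|) *
        Real.exp ((|v.im| + b + 1) * (|s| + |t|)) * Real.exp (-((|v.im| + b + 1) * |y|))
        * Real.exp (b * |y|)) := by ring
    _ = _ := by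
      rw [mul_assoc C]
      simp only [← Real.exp_add]
      ring_nf

theorem admissible_opR (v : ℂ) (j : Fin n) : Admissible (opR v j) := by
  refine ⟨fun p => Complex.exp (Complex.I * v * ((p.1 j : ℂ) - p.2.2) - Real.exp (p.1 j - p.2.2)
      - Real.exp (p.2.2 - p.2.1)), fun p => (Function.update p.1 j p.2.2, p.1 j),
    fun y => Real.exp (-(1 * |y|)), by fun_prop, ?_, integrable_exp_neg_mul_abs one_pos,
    fun y => (Real.exp_pos _).le, fun ψ x t y => rfl, fun b hb => ?_⟩
  · exact (measurable_update'.comp (f := fun p : (Fin n → ℝ) × ℝ × ℝ => (p.1, p.2.2))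
      (by fun_prop)).prodMk (by fun_prop)
  · obtain ⟨C, b', hC, hb', h⟩ := exists_kernel_le v hb
    -- The substituted point has weight at most `2 * weight x t + |y|`: the part `|y|` goes into the
    -- kernel bound, the rest adds `2 * b` to the exponent.
    refine ⟨C, b' + 2 * b, hC, by positivity, fun x t y => ?_⟩
    have e := norm_exp_phase v (x j - y) (Real.exp (x j - y) + Real.exp (y - t))
    push_cast at e ⊢
    rw [← sub_sub] at e
    rw [e]
    have hw : weight (Function.update x j y) (x j) ≤ 2 * weight x t + |y| := by
      have h1 := sum_abs_update_le x j y
      have h2 := abs_apply_le_weight x t j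
      have h3 := abs_nonneg t
      simp only [weight] at *
      linarith
    have h2 : |x j| + |t| ≤ weight x t := by
      have := Finset.single_le_sum (f := fun i => |x i|) (fun i _ => abs_nonneg _)
        (Finset.mem_univ j)
      simp only [weight]
      linarith
    calc _ ≤ Real.exp (-v.im * (x j - y) - (Real.exp (x j - y) + Real.exp (y - t))) *
          Real.exp (b * (2 * weight x t + |y|)) := by gcongr
      _ = Real.exp (-v.im * (x j - y) - (Real.exp (x j - y) + Real.exp (y - t))) *
          Real.exp (b * |y|) * Real.exp (2 * b * weight x t) := by
        rw [mul_assoc, ← Real.exp_add (b * |y|)]; ring_nf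
      _ ≤ C * Real.exp (b' * (|x j| + |t|)) * Real.exp (-(1 * |y|)) *
          Real.exp (2 * b * weight x t) := by
        gcongr ?_ * _
        exact h _ _ _ _ rfl
      _ ≤ C * Real.exp (b' * weight x t) * Real.exp (-(1 * |y|)) *
          Real.exp (2 * b * weight x t) := by gcongr
      _ = _ := by rw [add_mul, Real.exp_add]; ring

theorem admissible_opRstar (v : ℂ) (j : Fin n) : Admissible (opRstar v j) := by
  refine ⟨fun p => Complex.exp (Complex.I * v * ((p.2.2 : ℂ) - p.1 j) - Real.exp (p.2.2 - p.1 j)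
      - Real.exp (-p.2.2 - p.2.1)), fun p => (Function.update p.1 j p.2.2, -p.1 j),
    fun y => Real.exp (-(1 * |y|)), by fun_prop, ?_, integrable_exp_neg_mul_abs one_pos,
    fun y => (Real.exp_pos _).le, fun ψ x t y => rfl, fun b hb => ?_⟩
  · exact (measurable_update'.comp (f := fun p : (Fin n → ℝ) × ℝ × ℝ => (p.1, p.2.2))
      (by fun_prop)).prodMk (by fun_prop)
  · obtain ⟨C, b', hC, hb', h⟩ := exists_kernel_le v hb
    refine ⟨C, b' + 2 * b, hC, by positivity, fun x t y => ?_⟩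
    have e := norm_exp_phase v (y - x j) (Real.exp (y - x j) + Real.exp (-y - t))
    push_cast at e ⊢
    rw [← sub_sub] at e
    rw [e]
    have hw : weight (Function.update x j y) (-x j) ≤ 2 * weight x t + |y| := by
      have h1 := sum_abs_update_le x j y
      have h2 := abs_apply_le_weight x t j
      have h3 := abs_nonneg t
      simp only [weight, abs_neg] at *
      linarith
    have h2 : |x j| + |t| ≤ weight x t := by
      have := Finset.single_le_sum (f := fun i => |x i|) (fun i _ => abs_nonneg _)
        (Finset.mem_univ j)
      simp only [weight]
      linarith
    -- The reflection `(x_j, y) → (-x_j, -y)` reduces this kernel to the previous one.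
    have h3 := h (-x j) t (-y) (y - x j) (by ring_nf)
    rw [abs_neg, abs_neg, show -x j - -y = y - x j by ring] at h3
    calc _ ≤ Real.exp (-v.im * (y - x j) - (Real.exp (y - x j) + Real.exp (-y - t))) *
          Real.exp (b * (2 * weight x t + |y|)) := by gcongr
      _ = Real.exp (-v.im * (y - x j) - (Real.exp (y - x j) + Real.exp (-y - t))) *
          Real.exp (b * |y|) * Real.exp (2 * b * weight x t) := by
        rw [mul_assoc, ← Real.exp_add (b * |y|)]; ring_nf
      _ ≤ C * Real.exp (b' * (|x j| + |t|)) * Real.exp (-(1 * |y|)) *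
          Real.exp (2 * b * weight x t) := by gcongr ?_ * _
      _ ≤ C * Real.exp (b' * weight x t) * Real.exp (-(1 * |y|)) *
          Real.exp (2 * b * weight x t) := by gcongr
      _ = _ := by rw [add_mul, Real.exp_add]; ring

/-! ### The reflection operator -/

theorem one_sub_pos_of_log_lt {β : ℝ} (hβ : 0 < β) {y : ℝ} (hy : Real.log β < y) :
    0 < 1 - β * Real.exp (-y) := by
  have : β < Real.exp y := (Real.log_lt_iff_lt_exp hβ).1 hy
  rw [Real.exp_neg, sub_pos, ← div_eq_mul_inv, div_lt_one (Real.exp_pos _)]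
  exact this

theorem hasDerivAt_one_sub (β y : ℝ) :
    HasDerivAt (fun y => 1 - β * Real.exp (-y)) (β * Real.exp (-y)) y := by
  have := ((hasDerivAt_neg y).exp.const_mul β).const_sub 1
  exact this.congr_deriv (by ring)

/-- Up to the factor `β(a + 1)`, the integrand is the derivative of `(1 - β e^{-y})^{a+1}`, which
increases to a finite limit. -/
theorem integrable_reflection_dominant {β a : ℝ} (hβ : 0 < β) (ha : -1 < a) :
    Integrable ((Set.Ioi (Real.log β)).indicator fun y =>
      (1 - β * Real.exp (-y)) ^ a * Real.exp (-y)) := by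
  have ha' : 0 < a + 1 := by linarith
  rw [integrable_indicator_iff measurableSet_Ioi]
  have h : IntegrableOn (fun y => β * Real.exp (-y) * (a + 1) *
      (1 - β * Real.exp (-y)) ^ (a + 1 - 1)) (Set.Ioi (Real.log β)) := by
    refine integrableOn_Ioi_deriv_of_nonneg (g := fun y => (1 - β * Real.exp (-y)) ^ (a + 1))
      (l := (1 - β * 0) ^ (a + 1)) ?_ (fun y hy => ?_) (fun y hy => ?_) ?_
    · refine (ContinuousAt.rpow_const ?_ (Or.inr ha'.le)).continuousWithinAt
      fun_prop
    · exact (hasDerivAt_one_sub β y).rpow_const (Or.inl (one_sub_pos_of_log_lt hβ hy).ne')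
    · have := one_sub_pos_of_log_lt hβ hy
      positivity
    · refine Tendsto.rpow_const ?_ (Or.inr ha'.le)
      exact ((Real.tendsto_exp_neg_atTop_nhds_zero).const_mul β).const_sub 1
  refine IntegrableOn.congr_fun (h.const_mul (β * (a + 1))⁻¹) (fun y _ => ?_) measurableSet_Ioi
  simp only [add_sub_cancel_right]
  field_simp

/-- The weight `e^{-2ivy} (1 + β e^{-y})^{-iv-g} (1 - β e^{-y})^{-iv+g-1}` of the reflection
operator. -/
noncomputable def reflWeight (α β : ℝ) (v : ℂ) (y : ℝ) : ℂ :=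
  Complex.exp (-2 * Complex.I * v * y) *
    ((1 + β * Real.exp (-y) : ℝ) : ℂ) ^ (-Complex.I * v - g α β) *
    ((1 - β * Real.exp (-y) : ℝ) : ℂ) ^ (-Complex.I * v + g α β - 1)

/-- The normalization of the reflection operator. -/
noncomputable def reflConst (α β : ℝ) (v : ℂ) : ℂ :=
  ((2 * β : ℝ) : ℂ) ^ (Complex.I * v) / Complex.Gamma (g α β - Complex.I * v)

theorem opK_apply (α β : ℝ) (v : ℂ) (ψ : (Fin n → ℝ) → ℝ → ℂ) (x : Fin n → ℝ) (t y : ℝ) :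
    opK α β v ψ x t y = (Set.Ioi (Real.log β)).indicator (fun y => reflConst α β v *
      (reflWeight α β v y * (Real.exp (-Real.exp (y - t)) : ℝ))) y * ψ x (-y) := by
  unfold opK reflConst reflWeight
  by_cases hy : y ∈ Set.Ioi (Real.log β)
  · simp only [Set.indicator_of_mem hy, sub_eq_add_neg (-2 * Complex.I * v * (y : ℂ)),
      Complex.exp_add]
    push_cast
    ring
  · simp only [Set.indicator_of_notMem hy, zero_mul]

/-- Since `1 + β e^{-y}` stays between `1` and `2`, the only possible singularity is that of the
power of `1 - β e^{-y}` at the endpoint `ln β`. -/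
theorem norm_reflWeight_le (α : ℝ) {β : ℝ} (hβ : 0 < β) (v : ℂ) {y : ℝ} (hy : Real.log β < y) :
    ‖reflWeight α β v y‖ ≤ Real.exp (2 * |v.im| * |y|) * 2 ^ |v.im - g α β| *
      (1 - β * Real.exp (-y)) ^ (v.im + g α β - 1) := by
  have h1 := one_sub_pos_of_log_lt hβ hy
  have h2 : 1 ≤ 1 + β * Real.exp (-y) := by
    have := Real.exp_pos (-y)
    nlinarith
  unfold reflWeight
  rw [norm_mul, norm_mul, Complex.norm_cpow_eq_rpow_re_of_pos h1,
    Complex.norm_cpow_eq_rpow_re_of_pos (by linarith), Complex.norm_exp]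
  have e1 : (-Complex.I * v - (g α β : ℂ)).re = v.im - g α β := by simp
  have e2 : (-Complex.I * v + (g α β : ℂ) - 1).re = v.im + g α β - 1 := by simp
  have e3 : (-2 * Complex.I * v * (y : ℂ)).re = 2 * (v.im * y) := by
    simp [Complex.mul_re, Complex.mul_im]
    ring
  rw [e1, e2, e3]
  have h3 : 2 * (v.im * y) ≤ 2 * |v.im| * |y| := by
    rw [mul_assoc, ← abs_mul]
    linarith [le_abs_self (v.im * y)]
  have h4 := Real.exp_le_exp.2 h3
  refine mul_le_mul_of_nonneg_right (mul_le_mul h4 ?_ (by positivity) (by positivity))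
    (by positivity)
  · calc (1 + β * Real.exp (-y)) ^ (v.im - g α β)
        ≤ (1 + β * Real.exp (-y)) ^ |v.im - g α β| :=
          Real.rpow_le_rpow_of_exponent_le h2 (le_abs_self _)
      _ ≤ 2 ^ |v.im - g α β| :=
          Real.rpow_le_rpow (by linarith) (by linarith) (abs_nonneg _)

theorem measurable_reflWeight (α β : ℝ) (v : ℂ) : Measurable (reflWeight α β v) := by
  unfold reflWeight
  fun_prop

theorem admissible_opK (α : ℝ) {β : ℝ} (hβ : 0 < β) {v : ℂ} (hv : -g α β < v.im) :
    Admissible (opK α β v : IntOp n) := by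
  refine ⟨fun p => (Set.Ioi (Real.log β)).indicator (fun y => reflConst α β v *
      (reflWeight α β v y * (Real.exp (-Real.exp (y - p.2.1)) : ℝ))) p.2.2,
    fun p => (p.1, -p.2.2), _, ?_, by fun_prop,
    integrable_reflection_dominant (a := v.im + g α β - 1) hβ (by linarith), fun y => ?_,
    fun ψ x t y => opK_apply α β v ψ x t y, fun b hb => ?_⟩
  · have h := measurable_reflWeight α β v
    have : Measurable fun p : (Fin n → ℝ) × ℝ × ℝ => reflConst α β v *
      (reflWeight α β v p.2.2 * (Real.exp (-Real.exp (p.2.2 - p.2.1)) : ℝ)) := by fun_prop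
    have hs : MeasurableSet {p : (Fin n → ℝ) × ℝ × ℝ | Real.log β < p.2.2} :=
      measurableSet_lt (by fun_prop) (by fun_prop)
    exact this.indicator hs
  · refine Set.indicator_nonneg (fun y hy => ?_) y
    have := one_sub_pos_of_log_lt hβ hy
    positivity
  -- Decay rate to extract from `e^{-e^{y-t}}`: `2|Im v|` against the phase, `b` against the
  -- argument, and `1` for the factor `e^{-y}` of the majorant.
  · set c := 2 * |v.im| + b + 1 with hc
    have hc0 : 0 ≤ c := by positivity
    obtain ⟨C, hC, h⟩ := exists_exp_neg_exp_le c
    refine ⟨‖reflConst α β v‖ * 2 ^ |v.im - g α β| * (C * Real.exp (c * (2 * |Real.log β|))), c + b,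
      by positivity, by positivity, fun x t y => ?_⟩
    by_cases hy : y ∈ Set.Ioi (Real.log β)
    · simp only [Set.indicator_of_mem hy, norm_mul, Complex.norm_real, Real.norm_eq_abs,
        Real.abs_exp]
      have hp := one_sub_pos_of_log_lt hβ hy
      have hyy : |y| ≤ y + 2 * |Real.log β| := by
        have h1 := neg_abs_le (Real.log β)
        have h2 := abs_nonneg (Real.log β)
        have h3 : Real.log β < y := hy
        rcases abs_cases y with ⟨h, _⟩ | ⟨h, _⟩ <;> linarith
      have hw : weight x (-y) ≤ weight x t + |y| := by
        simp only [weight, abs_neg]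
        linarith [abs_nonneg t]
      have ht : t ≤ weight x t := (le_abs_self t).trans (abs_le_weight x t)
      calc _ ≤ ‖reflConst α β v‖ * (Real.exp (2 * |v.im| * |y|) * 2 ^ |v.im - g α β| *
            (1 - β * Real.exp (-y)) ^ (v.im + g α β - 1) * (C * Real.exp (-(c * (y - t))))) *
            Real.exp (b * (weight x t + |y|)) := by
            gcongr
            · exact norm_reflWeight_le α hβ v hy
            · exact h c hc0 le_rfl _
        _ = ‖reflConst α β v‖ * 2 ^ |v.im - g α β| * C *
            (1 - β * Real.exp (-y)) ^ (v.im + g α β - 1) *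
            Real.exp (2 * |v.im| * |y| + -(c * (y - t)) + b * (weight x t + |y|)) := by
          rw [Real.exp_add, Real.exp_add]
          ring
        _ ≤ ‖reflConst α β v‖ * 2 ^ |v.im - g α β| * C *
            (1 - β * Real.exp (-y)) ^ (v.im + g α β - 1) *
            Real.exp (c * (2 * |Real.log β|) + (c + b) * weight x t + -y) := by
          refine mul_le_mul_of_nonneg_left (Real.exp_le_exp.2 ?_) (by positivity)
          have h1 : c * |y| ≤ c * (y + 2 * |Real.log β|) := by gcongr
          have h2 : c * t ≤ c * weight x t := by gcongr
          have h3 := neg_le_abs y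
          have h4 := le_abs_self y
          have h5 : c * |y| = 2 * |v.im| * |y| + b * |y| + |y| := by rw [hc]; ring
          linarith
        _ = _ := by
          rw [Real.exp_add, Real.exp_add]
          ring
    · simp only [Set.indicator_of_notMem hy, norm_zero, zero_mul, mul_zero, le_refl]

end BCToda

namespace BCToda
open scoped Matrix ContDiff Topology
open MeasureTheory Filter

variable {n : ℕ}

/-! ### Integration by parts for the reflection operator -/

theorem reflConst_ne_zero {α β : ℝ} (hβ : 0 < β) {v : ℂ} (hv : -g α β < v.im) :
    reflConst α β v ≠ 0 := by
  unfold reflConst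
  refine div_ne_zero ?_ (Complex.Gamma_ne_zero_of_re_pos ?_)
  · rw [Complex.cpow_ne_zero_iff]
    left
    exact_mod_cast (mul_pos two_pos hβ).ne'
  · simp
    linarith

theorem beta_mul_g (α : ℝ) {β : ℝ} (hβ : 0 < β) : (β : ℂ) * g α β = β / 2 + α := by
  have : (β : ℂ) ≠ 0 := by exact_mod_cast hβ.ne'
  unfold g
  push_cast
  field_simp

/-- This is `Γ(z + 1) = z Γ(z)` at `z = g - 1 - iu`, whose real part is positive by hypothesis. The
factor `z` is one of the two linear factors of `det K(u)`. -/
theorem reflConst_sub_I {α β : ℝ} (hβ : 0 < β) {u : ℂ} (hu : 1 - g α β < u.im) :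
    reflConst α β (u - Complex.I) = 2 * β * (g α β - 1 - Complex.I * u) * reflConst α β u := by
  have hne : (g α β : ℂ) - 1 - Complex.I * u ≠ 0 := by
    intro h
    have := congrArg Complex.re h
    simp at this
    linarith
  have hβ' : ((2 * β : ℝ) : ℂ) ≠ 0 := by exact_mod_cast (mul_pos two_pos hβ).ne'
  have hG : Complex.Gamma (g α β - Complex.I * u) =
      (g α β - 1 - Complex.I * u) * Complex.Gamma (g α β - 1 - Complex.I * u) := by
    rw [← Complex.Gamma_add_one _ hne]
    congr 1
    ring
  have hG0 : Complex.Gamma (g α β - 1 - Complex.I * u) ≠ 0 := by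
    refine Complex.Gamma_ne_zero_of_re_pos ?_
    simp
    linarith
  unfold reflConst
  rw [hG, show Complex.I * (u - Complex.I) = Complex.I * u + 1 by
      linear_combination -Complex.I_mul_I, Complex.cpow_add _ _ hβ', Complex.cpow_one,
    show (g α β : ℂ) - (Complex.I * u + 1) = g α β - 1 - Complex.I * u by ring]
  push_cast
  field_simp

theorem reflWeight_sub_I (α β : ℝ) (u : ℂ) (y : ℝ) :
    reflWeight α β (u - Complex.I) y = Complex.exp (-2 * Complex.I * u * y) * Real.exp (-y) ^ 2 *
      ((1 + β * Real.exp (-y) : ℝ) : ℂ) ^ (-Complex.I * u - g α β - 1) *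
      ((1 - β * Real.exp (-y) : ℝ) : ℂ) ^ (-Complex.I * u + g α β - 1 - 1) := by
  have hI : -Complex.I * (u - Complex.I) = -Complex.I * u - 1 := by
    linear_combination Complex.I_mul_I
  have e1 : Complex.exp (-2 * Complex.I * (u - Complex.I) * y) =
      Complex.exp (-2 * Complex.I * u * y) * Real.exp (-y) ^ 2 := by
    rw [Complex.ofReal_exp, ← Complex.exp_nat_mul, ← Complex.exp_add]
    congr 1
    push_cast
    linear_combination 2 * (y : ℂ) * Complex.I_mul_I
  unfold reflWeight
  rw [e1, hI, show -Complex.I * u - 1 - (g α β : ℂ) = -Complex.I * u - g α β - 1 by ring,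
    show -Complex.I * u - 1 + (g α β : ℂ) - 1 = -Complex.I * u + g α β - 1 - 1 by ring]

theorem reflWeight_eq (α : ℝ) {β : ℝ} (hβ : 0 < β) (u : ℂ) {y : ℝ} (hy : Real.log β < y) :
    reflWeight α β u y = Complex.exp (-2 * Complex.I * u * y) *
      (((1 + β * Real.exp (-y) : ℝ) : ℂ) ^ (-Complex.I * u - g α β - 1) *
        (1 + β * Real.exp (-y) : ℝ)) *
      (((1 - β * Real.exp (-y) : ℝ) : ℂ) ^ (-Complex.I * u + g α β - 1 - 1) *
        (1 - β * Real.exp (-y) : ℝ)) := by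
  have hB := one_sub_pos_of_log_lt hβ hy
  have hA : 0 < 1 + β * Real.exp (-y) := by positivity
  have hB' : ((1 - β * Real.exp (-y) : ℝ) : ℂ) ≠ 0 := by exact_mod_cast hB.ne'
  have hA' : ((1 + β * Real.exp (-y) : ℝ) : ℂ) ≠ 0 := by exact_mod_cast hA.ne'
  rw [Complex.cpow_sub _ 1 hA', Complex.cpow_sub _ 1 hB', Complex.cpow_one, Complex.cpow_one,
    div_mul_cancel₀ _ hA', div_mul_cancel₀ _ hB']
  rfl

theorem exp_mul_exp_neg_ofReal (y : ℝ) : (Real.exp y : ℂ) * Real.exp (-y) = 1 := by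
  rw [← Complex.ofReal_mul, ← Real.exp_add]
  simp

/-- Passing from `u` to `u - i` multiplies the weight by `e^{-2y} / ((1 + β e^{-y})(1 - β e^{-y})) =
1 / (e^{2y} - β²)`. -/
theorem reflWeight_sub_I_mul (α : ℝ) {β : ℝ} (hβ : 0 < β) (u : ℂ) {y : ℝ} (hy : Real.log β < y) :
    reflWeight α β (u - Complex.I) y * ((Real.exp y : ℂ) ^ 2 - (β : ℂ) ^ 2) =
      reflWeight α β u y := by
  rw [reflWeight_sub_I, reflWeight_eq α hβ u hy]
  have h := exp_mul_exp_neg_ofReal y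
  generalize ((1 + β * Real.exp (-y) : ℝ) : ℂ) ^ (-Complex.I * u - g α β - 1) = a
  generalize ((1 - β * Real.exp (-y) : ℝ) : ℂ) ^ (-Complex.I * u + g α β - 1 - 1) = b
  rw [Complex.ofReal_add, Complex.ofReal_sub, Complex.ofReal_mul, Complex.ofReal_one]
  linear_combination Complex.exp (-2 * Complex.I * u * y) * a * b *
    ((Real.exp y : ℂ) * Real.exp (-y) + 1) * h

theorem hasDerivAt_ofReal_cpow {f : ℝ → ℝ} {f' y : ℝ} (c : ℂ) (hf : HasDerivAt f f' y)
    (h : 0 < f y) :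
    HasDerivAt (fun y => (f y : ℂ) ^ c) (c * (f y : ℂ) ^ (c - 1) * f') y := by
  have h1 : HasDerivAt (fun z : ℂ => z ^ c) (c * (f y : ℂ) ^ (c - 1)) (f y : ℂ) :=
    (Complex.hasStrictDerivAt_cpow_const (Complex.ofReal_mem_slitPlane.2 h)).hasDerivAt
  refine ((h1.comp_ofReal (z := f y)).scomp y hf).congr_deriv ?_
  rw [Complex.real_smul, mul_comm]

/-- The logarithmic derivative is `-2iu` plus two fractions with common denominator `e^{2y} - β²`,
which the weight at `u - i` absorbs; `βg = β/2 + α` simplifies the numerator. -/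
theorem hasDerivAt_reflWeight (α : ℝ) {β : ℝ} (hβ : 0 < β) (u : ℂ) {y : ℝ}
    (hy : Real.log β < y) :
    HasDerivAt (reflWeight α β u) (-2 * Complex.I * u * reflWeight α β u y +
      (2 * α * Real.exp y - (1 + 2 * Complex.I * u) * β ^ 2) *
        reflWeight α β (u - Complex.I) y) y := by
  have hB := one_sub_pos_of_log_lt hβ hy
  have hA : 0 < 1 + β * Real.exp (-y) := by positivity
  have hB' : ((1 - β * Real.exp (-y) : ℝ) : ℂ) ≠ 0 := by exact_mod_cast hB.ne'
  have hA' : ((1 + β * Real.exp (-y) : ℝ) : ℂ) ≠ 0 := by exact_mod_cast hA.ne'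
  have dB := hasDerivAt_ofReal_cpow (-Complex.I * u + g α β - 1) (hasDerivAt_one_sub β y) hB
  have dA := hasDerivAt_ofReal_cpow (-Complex.I * u - g α β)
    (((hasDerivAt_neg y).exp.const_mul β).const_add 1) hA
  have dE : HasDerivAt (fun y : ℝ => Complex.exp (-2 * Complex.I * u * y))
      (Complex.exp (-2 * Complex.I * u * y) * (-2 * Complex.I * u * 1)) y :=
    ((Complex.ofRealCLM.hasDerivAt (x := y)).const_mul (-2 * Complex.I * u)).cexp
  refine ((dE.mul dA).mul dB).congr_deriv ?_
  have h := exp_mul_exp_neg_ofReal y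
  have hg := beta_mul_g α hβ
  have eA : ((1 + β * Real.exp (-y) : ℝ) : ℂ) ^ (-Complex.I * u - g α β) =
      ((1 + β * Real.exp (-y) : ℝ) : ℂ) ^ (-Complex.I * u - g α β - 1) *
        (1 + β * Real.exp (-y) : ℝ) := by
    rw [Complex.cpow_sub _ 1 hA', Complex.cpow_one, div_mul_cancel₀ _ hA']
  have eB : ((1 - β * Real.exp (-y) : ℝ) : ℂ) ^ (-Complex.I * u + g α β - 1) =
      ((1 - β * Real.exp (-y) : ℝ) : ℂ) ^ (-Complex.I * u + g α β - 1 - 1) *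
        (1 - β * Real.exp (-y) : ℝ) := by
    rw [Complex.cpow_sub (-Complex.I * u + g α β - 1) 1 hB', Complex.cpow_one,
      div_mul_cancel₀ _ hB']
  simp only [Pi.mul_apply]
  rw [reflWeight_sub_I, reflWeight_eq α hβ u hy, eA, eB]
  generalize ((1 + β * Real.exp (-y) : ℝ) : ℂ) ^ (-Complex.I * u - g α β - 1) = a
  generalize ((1 - β * Real.exp (-y) : ℝ) : ℂ) ^ (-Complex.I * u + g α β - 1 - 1) = b
  generalize Complex.exp (-2 * Complex.I * u * y) = E
  push_cast at h ⊢
  set e := Complex.exp (-(y : ℂ))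
  set Y := Complex.exp (y : ℂ)
  linear_combination 2 * E * a * b * e * hg - 2 * α * E * a * b * e * h

/-! ### Moment relations for the reflection weight -/

/-- The integral of `e^{my - σ e^y}` against the weight of the reflection operator. -/
noncomputable def reflMoment (α β : ℝ) (v : ℂ) (σ m : ℝ) : ℂ :=
  ∫ y in Set.Ioi (Real.log β), reflWeight α β v y * Real.exp (m * y) * Real.exp (-(σ * Real.exp y))

theorem integrableOn_reflMoment {α β : ℝ} (hβ : 0 < β) {v : ℂ} (hv : -g α β < v.im) {σ : ℝ}
    (hσ : 0 < σ) (m : ℝ) :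
    IntegrableOn (fun y => reflWeight α β v y * Real.exp (m * y) *
      Real.exp (-(σ * Real.exp y))) (Set.Ioi (Real.log β)) := by
  -- With `t = -ln σ` the cutoff `e^{-e^{y-t}}` of the reflection operator becomes `e^{-σ e^y}`, so
  -- admissibility already contains the claim.
  have h := (admissible_opK (n := 0) α hβ hv).integrable (expBounded_exp (-m)) () 0 (-Real.log σ)
  have h2 := h.const_mul (reflConst α β v)⁻¹
  rw [← integrable_indicator_iff measurableSet_Ioi]
  refine h2.congr (Eventually.of_forall fun y => ?_)
  simp only [opK_apply]
  by_cases hy : y ∈ Set.Ioi (Real.log β)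
  · simp only [Set.indicator_of_mem hy]
    have hc := reflConst_ne_zero hβ hv
    rw [sub_neg_eq_add, Real.exp_add, Real.exp_log hσ, neg_mul_neg, mul_comm (Real.exp y)]
    field_simp
  · simp only [Set.indicator_of_notMem hy, zero_mul, mul_zero]

/-- The integral of the derivative of `e^{cy - σ e^y}` times the weight at `u` vanishes. There is no
boundary term at `ln β` because the exponent of `1 - β e^{-y}` has real part `Im u + g - 1 > 0`. -/
theorem reflMoment_integral_by_parts {α β : ℝ} (hβ : 0 < β) {u : ℂ} (hu : 1 - g α β < u.im)
    {σ : ℝ} (hσ : 0 < σ) (c : ℝ) :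
    (c - 2 * Complex.I * u) * reflMoment α β u σ c +
      2 * α * reflMoment α β (u - Complex.I) σ (1 + c) -
      (1 + 2 * Complex.I * u) * β ^ 2 * reflMoment α β (u - Complex.I) σ c -
      σ * reflMoment α β u σ (1 + c) = 0 := by
  have hv : -g α β < u.im := by linarith
  have hv' : -g α β < (u - Complex.I).im := by simp; linarith
  have i1 := (integrableOn_reflMoment hβ hv hσ c).const_mul (c - 2 * Complex.I * u)
  have i2 := (integrableOn_reflMoment hβ hv' hσ (1 + c)).const_mul (2 * α)
  have i3 := (integrableOn_reflMoment hβ hv' hσ c).const_mul ((1 + 2 * Complex.I * u) * β ^ 2)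
  have i4 := (integrableOn_reflMoment hβ hv hσ (1 + c)).const_mul σ
  have hd : ∀ y ∈ Set.Ioi (Real.log β), HasDerivAt
      (fun y => reflWeight α β u y * Real.exp (c * y) * Real.exp (-(σ * Real.exp y)))
      ((c - 2 * Complex.I * u) * (reflWeight α β u y * Real.exp (c * y) *
          Real.exp (-(σ * Real.exp y))) +
        2 * α * (reflWeight α β (u - Complex.I) y * Real.exp ((1 + c) * y) *
          Real.exp (-(σ * Real.exp y))) -
        (1 + 2 * Complex.I * u) * β ^ 2 * (reflWeight α β (u - Complex.I) y * Real.exp (c * y) *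
          Real.exp (-(σ * Real.exp y))) -
        σ * (reflWeight α β u y * Real.exp ((1 + c) * y) *
          Real.exp (-(σ * Real.exp y)))) y := by
    intro y hy
    have d1 := hasDerivAt_reflWeight α hβ u hy
    have d2 := (((hasDerivAt_id y).const_mul c).exp).ofReal_comp
    have d3 : HasDerivAt (fun y => ((Real.exp (-(σ * Real.exp y)) : ℝ) : ℂ))
        ((Real.exp (-(σ * Real.exp y)) * -(σ * Real.exp y) : ℝ) : ℂ) y :=
      (((Real.hasDerivAt_exp y).const_mul σ).neg.exp).ofReal_comp
    refine ((d1.mul d2).mul d3).congr_deriv ?_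
    simp only [Pi.mul_apply, id, add_mul, one_mul, Real.exp_add]
    push_cast
    ring
  have hint := ((i1.add i2).sub i3).sub i4
  -- The limit at infinity needs no estimate: an integrable function with integrable derivative
  -- tends to `0`.
  have h0 : Tendsto (fun y => reflWeight α β u y * Real.exp (c * y) *
      Real.exp (-(σ * Real.exp y))) atTop (𝓝 0) :=
    tendsto_zero_of_hasDerivAt_of_integrableOn_Ioi hd hint (integrableOn_reflMoment hβ hv hσ c)
  have hq : (-Complex.I * u + g α β - 1).re = u.im + g α β - 1 := by simp
  have hc : ContinuousWithinAt (fun y => reflWeight α β u y * Real.exp (c * y) *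
      Real.exp (-(σ * Real.exp y))) (Set.Ici (Real.log β)) (Real.log β) := by
    refine ContinuousAt.continuousWithinAt ?_
    refine ContinuousAt.mul (ContinuousAt.mul ?_ (by fun_prop)) (by fun_prop)
    refine ContinuousAt.mul (ContinuousAt.mul (by fun_prop) ?_) ?_
    · refine (Complex.continuousAt_ofReal_cpow_const _ _ (Or.inr ?_)).comp
        (f := fun y => 1 + β * Real.exp (-y)) (by fun_prop)
      positivity
    · refine (Complex.continuousAt_ofReal_cpow_const _ _ (Or.inl ?_)).comp
        (f := fun y => 1 - β * Real.exp (-y)) (by fun_prop)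
      rw [hq]
      linarith
  have hf : reflWeight α β u (Real.log β) = 0 := by
    unfold reflWeight
    have : 1 - β * Real.exp (-Real.log β) = 0 := by
      rw [Real.exp_neg, Real.exp_log hβ, mul_inv_cancel₀ hβ.ne', sub_self]
    rw [this, Complex.ofReal_zero, Complex.zero_cpow, mul_zero]
    intro h
    rw [h] at hq
    simp at hq
    linarith
  have := integral_Ioi_of_hasDerivAt_of_tendsto hc hd hint h0
  rw [integral_sub (by exact (i1.add i2).sub i3) i4, integral_sub (by exact i1.add i2) i3,
    integral_add i1 i2] at this
  simp only [integral_const_mul, hf, zero_mul, sub_zero] at this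
  exact this

theorem reflMoment_shift {α β : ℝ} (hβ : 0 < β) {u : ℂ} (hu : 1 - g α β < u.im)
    {σ : ℝ} (hσ : 0 < σ) (c : ℝ) :
    reflMoment α β u σ c = reflMoment α β (u - Complex.I) σ (2 + c) -
      β ^ 2 * reflMoment α β (u - Complex.I) σ c := by
  have hv' : -g α β < (u - Complex.I).im := by simp; linarith
  unfold reflMoment
  rw [← integral_const_mul, ← integral_sub (integrableOn_reflMoment hβ hv' hσ _)
    ((integrableOn_reflMoment hβ hv' hσ _).const_mul _)]
  refine setIntegral_congr_fun measurableSet_Ioi fun y hy => ?_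
  simp only [← reflWeight_sub_I_mul α hβ u hy, add_mul, Real.exp_add, two_mul]
  push_cast
  ring

theorem reflMoment_relation_zero {α β : ℝ} (hβ : 0 < β) {u : ℂ} (hu : 1 - g α β < u.im)
    {σ : ℝ} (hσ : 0 < σ) :
    σ * reflMoment α β u σ 1 = -2 * Complex.I * u * reflMoment α β u σ 0 +
      2 * α * reflMoment α β (u - Complex.I) σ 1 -
      (1 + 2 * Complex.I * u) * β ^ 2 * reflMoment α β (u - Complex.I) σ 0 := by
  have h := reflMoment_integral_by_parts hβ hu hσ 0
  rw [add_zero] at h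
  push_cast at h
  linear_combination -h

/-- The case `c = -1`. Rewriting the moment of order `-1` at `u` by `reflMoment_shift` cancels the
moment of order `-1` at `u - i`, so only orders `0` and `1` remain. -/
theorem reflMoment_relation_neg_one {α β : ℝ} (hβ : 0 < β) {u : ℂ} (hu : 1 - g α β < u.im)
    {σ : ℝ} (hσ : 0 < σ) :
    σ * reflMoment α β u σ 0 = 2 * α * reflMoment α β (u - Complex.I) σ 0 -
      (1 + 2 * Complex.I * u) * reflMoment α β (u - Complex.I) σ 1 := by
  have h := reflMoment_integral_by_parts hβ hu hσ (-1)
  rw [reflMoment_shift hβ hu hσ (-1), show (1 : ℝ) + -1 = 0 by norm_num,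
    show (2 : ℝ) + -1 = 1 by norm_num] at h
  push_cast at h
  linear_combination -h

/-- The reflection `t' = -y` turns `e^{-S e^{-t'}}` into `e^{-S e^y}`, which merges with the cutoff
`e^{-e^{y-t}}` into the single parameter `σ = e^{-t} + S`. -/
theorem opK_act_eq_reflMoment (α β : ℝ) (v : ℂ) (x : Fin n → ℝ) (S t m : ℝ) :
    (opK α β v).act (fun _ t' => (Real.exp (-(S * Real.exp (-t'))) : ℂ) * Real.exp (-m * t')) x t =
      reflConst α β v * reflMoment α β v (Real.exp (-t) + S) m := by
  unfold IntOp.act reflMoment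
  rw [← integral_indicator measurableSet_Ioi, ← integral_const_mul]
  congr 1
  funext y
  rw [opK_apply]
  by_cases hy : y ∈ Set.Ioi (Real.log β)
  · simp only [Set.indicator_of_mem hy]
    rw [neg_neg, neg_mul_neg, sub_eq_add_neg, Real.exp_add, add_mul, neg_add, Real.exp_add,
      mul_comm (Real.exp y)]
    push_cast
    ring
  · simp only [Set.indicator_of_notMem hy, zero_mul, mul_zero]

end BCToda

namespace BCToda
open scoped Matrix ContDiff Topology
open MeasureTheory Filter

/-! ### The two-dimensional integrals of one site -/

/-- The function `e^{ivs - e^s}`. -/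
noncomputable def phase (v : ℂ) (s : ℝ) : ℂ :=
  Complex.exp (Complex.I * v * s - Real.exp s)

theorem norm_phase (v : ℂ) (s : ℝ) : ‖phase v s‖ = Real.exp (-v.im * s - Real.exp s) :=
  norm_exp_phase v s _

theorem continuous_phase (v : ℂ) : Continuous (phase v) := by
  unfold phase
  fun_prop

theorem hasDerivAt_phase (v : ℂ) (s : ℝ) :
    HasDerivAt (phase v) ((Complex.I * v - Real.exp s) * phase v s) s := by
  have h1 : HasDerivAt (fun s : ℝ => Complex.I * v * s) (Complex.I * v * 1) s :=
    (Complex.ofRealCLM.hasDerivAt (x := s)).const_mul _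
  have h2 : HasDerivAt (fun s : ℝ => (Real.exp s : ℂ)) (Real.exp s) s :=
    (Real.hasDerivAt_exp s).ofReal_comp
  refine (h1.sub h2).cexp.congr_deriv ?_
  rw [mul_one, mul_comm]
  rfl

theorem phase_sub_I (v : ℂ) (s : ℝ) : phase (v - Complex.I) s = phase v s * Real.exp s := by
  unfold phase
  rw [Complex.ofReal_exp s, ← Complex.exp_add]
  congr 1
  linear_combination -(s : ℂ) * Complex.I_mul_I

theorem exists_norm_phase_le (v : ℂ) {c : ℝ} (hc : 0 ≤ c) : ∃ C : ℝ, 0 ≤ C ∧ ∀ s,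
    ‖phase v s‖ ≤ C * Real.exp (|v.im| * |s|) ∧
      ‖phase v s‖ ≤ C * Real.exp (|v.im| * |s|) * Real.exp (-(c * s)) := by
  obtain ⟨C, hC, h⟩ := exists_exp_neg_exp_le c
  refine ⟨C, by linarith, fun s => ?_⟩
  rw [norm_phase, sub_eq_add_neg, Real.exp_add]
  have h1 : Real.exp (-v.im * s) ≤ Real.exp (|v.im| * |s|) := by
    rw [Real.exp_le_exp, ← abs_mul, neg_mul]
    exact neg_le_abs _
  have h2 : Real.exp (-Real.exp s) ≤ 1 :=
    Real.exp_le_one_iff.2 (neg_nonpos.2 (Real.exp_pos _).le)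
  constructor
  · calc _ ≤ Real.exp (|v.im| * |s|) * C :=
          mul_le_mul h1 (h2.trans hC) (Real.exp_pos _).le (Real.exp_pos _).le
      _ = _ := mul_comm _ _
  · calc _ ≤ Real.exp (|v.im| * |s|) * (C * Real.exp (-(c * s))) :=
          mul_le_mul h1 (h c hc le_rfl s) (Real.exp_pos _).le (Real.exp_pos _).le
      _ = _ := by ring

/-- Measurable functions of at most exponential growth at `+∞`, and decaying faster than any
exponential at `-∞`. -/
structure RapidlyDecaying (h : ℝ → ℂ) : Prop where
  meas : Measurable h
  bdd : ∃ b : ℝ, 0 ≤ b ∧ ∀ c, 0 ≤ c → ∃ C : ℝ, 0 ≤ C ∧ ∀ y,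
    ‖h y‖ ≤ C * Real.exp (b * |y| + c * y)

theorem RapidlyDecaying.add {h k : ℝ → ℂ} (hh : RapidlyDecaying h) (hk : RapidlyDecaying k) :
    RapidlyDecaying fun y => h y + k y where
  meas := hh.meas.add hk.meas
  bdd := by
    obtain ⟨b, hb, h1⟩ := hh.bdd
    obtain ⟨b', hb', h2⟩ := hk.bdd
    refine ⟨max b b', le_max_of_le_left hb, fun c hc => ?_⟩
    obtain ⟨C, hC, h1⟩ := h1 c hc
    obtain ⟨C', hC', h2⟩ := h2 c hc
    refine ⟨C + C', by positivity, fun y => ?_⟩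
    calc _ ≤ C * Real.exp (b * |y| + c * y) + C' * Real.exp (b' * |y| + c * y) :=
          (norm_add_le _ _).trans (add_le_add (h1 y) (h2 y))
      _ ≤ C * Real.exp (max b b' * |y| + c * y) + C' * Real.exp (max b b' * |y| + c * y) := by
        gcongr
        · exact le_max_left _ _
        · exact le_max_right _ _
      _ = _ := by ring

theorem RapidlyDecaying.const_mul {h : ℝ → ℂ} (hh : RapidlyDecaying h) (a : ℂ) :
    RapidlyDecaying fun y => a * h y where
  meas := hh.meas.const_mul a
  bdd := by
    obtain ⟨b, hb, h1⟩ := hh.bdd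
    refine ⟨b, hb, fun c hc => ?_⟩
    obtain ⟨C, hC, h1⟩ := h1 c hc
    refine ⟨‖a‖ * C, by positivity, fun y => ?_⟩
    rw [norm_mul, mul_assoc]
    gcongr
    exact h1 y

theorem RapidlyDecaying.exp_mul {h : ℝ → ℂ} (hh : RapidlyDecaying h) (d : ℝ) :
    RapidlyDecaying fun y => (Real.exp (d * y) : ℂ) * h y where
  meas := Measurable.mul (by fun_prop) hh.meas
  bdd := by
    obtain ⟨b, hb, h1⟩ := hh.bdd
    refine ⟨b + |d|, by positivity, fun c hc => ?_⟩
    obtain ⟨C, hC, h1⟩ := h1 c hc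
    refine ⟨C, hC, fun y => ?_⟩
    rw [norm_mul, Complex.norm_real, Real.norm_eq_abs, Real.abs_exp]
    calc _ ≤ Real.exp (|d| * |y|) * (C * Real.exp (b * |y| + c * y)) := by
          gcongr ?_ * ?_
          · rw [Real.exp_le_exp, ← abs_mul]
            exact le_abs_self _
          · exact h1 y
      _ = _ := by rw [mul_left_comm, ← Real.exp_add]; ring_nf

/-- For `y ≥ 0` the double exponential in `phase` beats the growth of `h`; for `y < 0` the rapid
decay of `h` beats the growth of `phase`. -/
theorem RapidlyDecaying.norm_phase_mul_le {h : ℝ → ℂ} (hh : RapidlyDecaying h) (v : ℂ) :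
    ∃ C b : ℝ, 0 ≤ C ∧ 0 ≤ b ∧ ∀ w y,
      ‖phase v (y - w) * h y‖ ≤ C * Real.exp (b * |w|) * Real.exp (-(1 * |y|)) := by
  obtain ⟨b, hb, hd⟩ := hh.bdd
  set c := b + |v.im| + 1 with hc
  have hc0 : 0 ≤ c := by positivity
  obtain ⟨C₁, hC₁, h1⟩ := hd 0 le_rfl
  obtain ⟨C₂, hC₂, h2⟩ := hd c hc0
  obtain ⟨C₃, hC₃, h3⟩ := exists_norm_phase_le v hc0
  refine ⟨C₃ * (C₁ + C₂), |v.im| + c, by positivity, by positivity, fun w y => ?_⟩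
  have hyw : |v.im| * |y - w| ≤ |v.im| * (|y| + |w|) := by gcongr; exact abs_sub _ _
  rw [norm_mul]
  rcases le_or_gt 0 y with hy | hy
  · calc _ ≤ (C₃ * Real.exp (|v.im| * |y - w|) * Real.exp (-(c * (y - w)))) *
          (C₁ * Real.exp (b * |y| + 0 * y)) := by
          gcongr
          · exact (h3 _).2
          · exact h1 y
      _ = C₃ * C₁ * Real.exp (|v.im| * |y - w| + -(c * (y - w)) + (b * |y| + 0 * y)) := by
        simp only [Real.exp_add]; ring
      _ ≤ C₃ * (C₁ + C₂) * Real.exp ((|v.im| + c) * |w| + -(1 * |y|)) := by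
        refine mul_le_mul (by gcongr; linarith) (Real.exp_le_exp.2 ?_) (by positivity)
          (by positivity)
        rw [abs_of_nonneg hy] at *
        have : c * w ≤ c * |w| := by gcongr; exact le_abs_self w
        have e : c * y = b * y + |v.im| * y + y := by rw [hc]; ring
        linarith
      _ = _ := by rw [Real.exp_add]; ring
  · calc _ ≤ (C₃ * Real.exp (|v.im| * |y - w|)) * (C₂ * Real.exp (b * |y| + c * y)) := by
          gcongr
          · exact (h3 _).1
          · exact h2 y
      _ = C₃ * C₂ * Real.exp (|v.im| * |y - w| + (b * |y| + c * y)) := by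
        simp only [Real.exp_add]; ring
      _ ≤ C₃ * (C₁ + C₂) * Real.exp ((|v.im| + c) * |w| + -(1 * |y|)) := by
        refine mul_le_mul (by gcongr; linarith) (Real.exp_le_exp.2 ?_) (by positivity)
          (by positivity)
        rw [abs_of_neg hy] at *
        have : 0 ≤ c * |w| := by positivity
        have e : c * y = b * y + |v.im| * y + y := by rw [hc]; ring
        linarith
      _ = _ := by rw [Real.exp_add]; ring

/-- The weight of the outer integration. -/
noncomputable def outerWeight (v : ℂ) (x σ m w : ℝ) : ℂ :=
  phase v (x - w) * Real.exp (-(σ * Real.exp w)) * Real.exp (m * w)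

theorem continuous_outerWeight (v : ℂ) (x σ m : ℝ) : Continuous (outerWeight v x σ m) := by
  unfold outerWeight
  have := continuous_phase v
  fun_prop

theorem exists_norm_outerWeight_le (v : ℂ) (x : ℝ) {σ : ℝ} (hσ : 0 < σ) (m : ℝ) {b : ℝ}
    (hb : 0 ≤ b) : ∃ C : ℝ, 0 ≤ C ∧ ∀ w,
      ‖outerWeight v x σ m w‖ * Real.exp (b * |w|) ≤ C * Real.exp (-(1 * |w|)) := by
  -- The extra `|m|` pays for `e^{mw}`; the kernel bound is then used at `t = -ln σ`, where `e^{w-t}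
  -- = σ e^w`.
  obtain ⟨C, b', hC, hb', h⟩ := exists_kernel_le v (b := b + |m|) (by positivity)
  refine ⟨_, by positivity, fun w => le_trans ?_ (h x (-Real.log σ) w (x - w) rfl)⟩
  have e : Real.exp (w - -Real.log σ) = σ * Real.exp w := by
    rw [sub_neg_eq_add, Real.exp_add, Real.exp_log hσ, mul_comm]
  unfold outerWeight
  rw [norm_mul, norm_mul, norm_phase, Complex.norm_real, Complex.norm_real, Real.norm_eq_abs,
    Real.norm_eq_abs, Real.abs_exp, Real.abs_exp, e]
  simp only [← Real.exp_add]
  rw [Real.exp_le_exp]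
  have : m * w ≤ |m| * |w| := by rw [← abs_mul]; exact le_abs_self _
  linarith

/-- The integral of `e^{mw} h(y)` against
`e^{iv(x-w) - e^{x-w}} e^{iv(y-w) - e^{y-w}} e^{-σ e^w}`. -/
noncomputable def siteIntegral (v : ℂ) (x σ m : ℝ) (h : ℝ → ℂ) : ℂ :=
  ∫ w : ℝ, outerWeight v x σ m w * ∫ y : ℝ, phase v (y - w) * h y

section siteIntegral

variable (v : ℂ) (x : ℝ) {σ : ℝ} {h k : ℝ → ℂ}

theorem RapidlyDecaying.integrable_inner (hh : RapidlyDecaying h) (w : ℝ) :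
    Integrable fun y => phase v (y - w) * h y := by
  obtain ⟨C, b, -, -, hb⟩ := hh.norm_phase_mul_le v
  refine ((integrable_exp_neg_mul_abs one_pos).const_mul _).mono' ?_
    (Eventually.of_forall fun y => hb w y)
  exact (((continuous_phase v).measurable.comp (by fun_prop)).mul hh.meas).aestronglyMeasurable

theorem RapidlyDecaying.exists_bound (hh : RapidlyDecaying h) (hσ : 0 < σ) (m : ℝ) :
    ∃ C : ℝ, ∀ w y, ‖outerWeight v x σ m w * (phase v (y - w) * h y)‖ ≤
      C * (Real.exp (-(1 * |w|)) * Real.exp (-(1 * |y|))) := by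
  obtain ⟨C, b, hC, hb, h1⟩ := hh.norm_phase_mul_le v
  obtain ⟨C', hC', h2⟩ := exists_norm_outerWeight_le v x hσ m hb
  refine ⟨C' * C, fun w y => ?_⟩
  rw [norm_mul]
  calc _ ≤ ‖outerWeight v x σ m w‖ * (C * Real.exp (b * |w|) * Real.exp (-(1 * |y|))) := by
        gcongr
        exact h1 w y
    _ = (‖outerWeight v x σ m w‖ * Real.exp (b * |w|)) * (C * Real.exp (-(1 * |y|))) := by ring
    _ ≤ (C' * Real.exp (-(1 * |w|))) * (C * Real.exp (-(1 * |y|))) := by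
      gcongr ?_ * _
      exact h2 w
    _ = _ := by ring

theorem RapidlyDecaying.measurable_integrand (hh : RapidlyDecaying h) (m : ℝ) :
    Measurable (Function.uncurry fun w y => outerWeight v x σ m w * (phase v (y - w) * h y)) :=
  ((continuous_outerWeight v x σ m).measurable.comp measurable_fst).mul
    (((continuous_phase v).measurable.comp (by fun_prop)).mul (hh.meas.comp measurable_snd))

theorem RapidlyDecaying.integrable_prod (hh : RapidlyDecaying h) (hσ : 0 < σ) (m : ℝ) :
    Integrable (Function.uncurry fun w y => outerWeight v x σ m w * (phase v (y - w) * h y))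
      (volume.prod volume) := by
  obtain ⟨C, hC⟩ := hh.exists_bound v x hσ m
  have hi := integrable_exp_neg_mul_abs one_pos
  exact ((hi.mul_prod hi).const_mul C).mono'
    (hh.measurable_integrand v x m).aestronglyMeasurable
    (Eventually.of_forall fun p => hC p.1 p.2)

theorem RapidlyDecaying.integrable_left (hh : RapidlyDecaying h) (hσ : 0 < σ) (m y : ℝ) :
    Integrable fun w => outerWeight v x σ m w * (phase v (y - w) * h y) := by
  obtain ⟨C, hC⟩ := hh.exists_bound v x hσ m
  have hi := integrable_exp_neg_mul_abs one_pos
  exact ((hi.mul_const (Real.exp (-(1 * |y|)))).const_mul C).mono'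
    ((hh.measurable_integrand v x m).comp (f := fun w => (w, y))
      (by fun_prop)).aestronglyMeasurable
    (Eventually.of_forall fun w => hC w y)

theorem RapidlyDecaying.integrable_outer (hh : RapidlyDecaying h) (hσ : 0 < σ) (m : ℝ) :
    Integrable fun w => outerWeight v x σ m w * ∫ y : ℝ, phase v (y - w) * h y := by
  have := (hh.integrable_prod v x hσ m).integral_prod_left
  simpa only [Function.uncurry_apply_pair, integral_const_mul] using this

theorem siteIntegral_swap (hh : RapidlyDecaying h) (hσ : 0 < σ) (m : ℝ) :
    siteIntegral v x σ m h =
      ∫ y, ∫ w, outerWeight v x σ m w * (phase v (y - w) * h y) := by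
  rw [← integral_integral_swap (hh.integrable_prod v x hσ m)]
  simp only [siteIntegral, integral_const_mul]

theorem siteIntegral_add (hh : RapidlyDecaying h) (hk : RapidlyDecaying k) (hσ : 0 < σ) (m : ℝ) :
    siteIntegral v x σ m (fun y => h y + k y) =
      siteIntegral v x σ m h + siteIntegral v x σ m k := by
  unfold siteIntegral
  rw [← integral_add (hh.integrable_outer v x hσ m) (hk.integrable_outer v x hσ m)]
  congr 1
  funext w
  rw [← mul_add, ← integral_add (hh.integrable_inner v w) (hk.integrable_inner v w)]
  simp only [mul_add]

theorem siteIntegral_const_mul (σ m : ℝ) (h : ℝ → ℂ) (c : ℂ) :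
    siteIntegral v x σ m (fun y => c * h y) = c * siteIntegral v x σ m h := by
  unfold siteIntegral
  rw [← integral_const_mul]
  congr 1
  funext w
  simp only [mul_left_comm _ c, integral_const_mul]

/-- Integration by parts in the inner variable. -/
theorem siteIntegral_deriv {h' : ℝ → ℂ} (hh : RapidlyDecaying h) (hh' : RapidlyDecaying h')
    (hd : ∀ y, HasDerivAt h (h' y) y) (σ m : ℝ) :
    siteIntegral v x σ m (fun y => Complex.I * v * h y + h' y) =
      siteIntegral v x σ (m - 1) (fun y => Real.exp y * h y) := by
  unfold siteIntegral
  congr 1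
  funext w
  have he : RapidlyDecaying fun y => (Real.exp y : ℂ) * h y := by simpa using hh.exp_mul 1
  have i1 := ((hh.const_mul (Complex.I * v)).add hh').integrable_inner v w
  have i2 := (he.integrable_inner v w).const_mul (Real.exp (-w) : ℂ)
  -- Differentiating `phase v (y - w)` produces `e^{y-w} = e^{-w} e^y`; the factor `e^{-w}` is what
  -- lowers `m` by one.
  have hz := integral_eq_zero_of_hasDerivAt_of_integrable
    (f := fun y => phase v (y - w) * h y)
    (f' := fun y => phase v (y - w) * (Complex.I * v * h y + h' y) -
      Real.exp (-w) * (phase v (y - w) * (Real.exp y * h y))) (fun y => ?_) (i1.sub i2)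
    (hh.integrable_inner v w)
  · rw [integral_sub i1 i2, sub_eq_zero, integral_const_mul] at hz
    rw [hz]
    unfold outerWeight
    rw [sub_mul, one_mul, sub_eq_add_neg (m * w), Real.exp_add]
    push_cast
    ring
  · have d1 : HasDerivAt (fun y => phase v (y - w))
        ((Complex.I * v - Real.exp (y - w)) * phase v (y - w)) y :=
      ((hasDerivAt_phase v (y - w)).scomp (h := fun y => y - w) y
        ((hasDerivAt_id y).sub_const w)).congr_deriv (by rw [one_smul])
    refine (d1.mul (hd y)).congr_deriv ?_
    rw [sub_eq_add_neg y w, Real.exp_add]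
    push_cast
    ring

/-- Integration by parts in the outer variable. -/
theorem siteIntegral_outer (hh : RapidlyDecaying h) (hσ : 0 < σ) :
    σ * siteIntegral v x σ 1 h = -2 * Complex.I * v * siteIntegral v x σ 0 h +
      siteIntegral v x σ (-1) (fun y => (Real.exp x + Real.exp y) * h y) := by
  have he : RapidlyDecaying fun y => ((Real.exp x : ℂ) + Real.exp y) * h y := by
    have := (hh.const_mul (Real.exp x)).add (hh.exp_mul 1)
    simpa [add_mul] using this
  have i1 := fun y => (hh.integrable_left v x hσ 1 y).const_mul (σ : ℂ)
  have i2 := fun y => (hh.integrable_left v x hσ 0 y).const_mul (-2 * Complex.I * v)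
  have i3 := fun y => he.integrable_left v x hσ (-1) y
  -- For fixed `y`, the `w`-derivative of the integrand at `m = 0` yields `-iv` from each phase,
  -- `e^{x-w} + e^{y-w}` from their exponentials and `-σ e^w` from the cutoff. Interchanging the
  -- integrals makes `w` the inner variable.
  have hz : ∀ y, σ * ∫ w, outerWeight v x σ 1 w * (phase v (y - w) * h y) =
      -2 * Complex.I * v * (∫ w, outerWeight v x σ 0 w * (phase v (y - w) * h y)) +
      ∫ w, outerWeight v x σ (-1) w * (phase v (y - w) *
        ((Real.exp x + Real.exp y) * h y)) := by
    intro y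
    have hz := integral_eq_zero_of_hasDerivAt_of_integrable
      (f := fun w => outerWeight v x σ 0 w * (phase v (y - w) * h y))
      (f' := fun w => (-2 * Complex.I * v * (outerWeight v x σ 0 w * (phase v (y - w) * h y)) +
        outerWeight v x σ (-1) w * (phase v (y - w) * ((Real.exp x + Real.exp y) * h y))) -
        σ * (outerWeight v x σ 1 w * (phase v (y - w) * h y))) (fun w => ?_)
      (((i2 y).add (i3 y)).sub (i1 y)) (hh.integrable_left v x hσ 0 y)
    · rw [integral_sub (by exact (i2 y).add (i3 y)) (i1 y), integral_add (i2 y) (i3 y),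
        integral_const_mul, integral_const_mul, sub_eq_zero] at hz
      exact hz.symm
    · have d : ∀ z : ℝ, HasDerivAt (fun w => phase v (z - w))
          (-((Complex.I * v - Real.exp (z - w)) * phase v (z - w))) w := fun z =>
        ((hasDerivAt_phase v (z - w)).scomp w ((hasDerivAt_id w).const_sub z)).congr_deriv
          (by rw [neg_smul, one_smul])
      have d3 : HasDerivAt (fun w => ((Real.exp (-(σ * Real.exp w)) : ℝ) : ℂ))
          ((Real.exp (-(σ * Real.exp w)) * -(σ * Real.exp w) : ℝ) : ℂ) w :=
        (((Real.hasDerivAt_exp w).const_mul σ).neg.exp).ofReal_comp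
      unfold outerWeight
      simp only [zero_mul, Real.exp_zero, Complex.ofReal_one, mul_one]
      refine (((d x).mul d3).mul ((d y).mul_const (h y))).congr_deriv ?_
      simp only [Pi.mul_apply]
      rw [sub_eq_add_neg y w, sub_eq_add_neg x w, Real.exp_add, Real.exp_add, one_mul, neg_one_mul]
      push_cast
      ring
  rw [siteIntegral_swap v x hh hσ, siteIntegral_swap v x hh hσ, siteIntegral_swap v x he hσ,
    ← integral_const_mul, ← integral_const_mul, ← integral_add]
  · simp only [hz]
  · exact ((hh.integrable_prod v x hσ 0).integral_prod_right).const_mul _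
  · exact (he.integrable_prod v x hσ (-1)).integral_prod_right

/-- The shift multiplies the two phases by `e^{x-w}` and `e^{y-w}`, altogether by `e^x e^{-2w} e^y`.
-/
theorem siteIntegral_sub_I (σ m : ℝ) (h : ℝ → ℂ) :
    siteIntegral (v - Complex.I) x σ m h =
      Real.exp x * siteIntegral v x σ (m - 2) (fun y => Real.exp y * h y) := by
  unfold siteIntegral
  rw [← integral_const_mul]
  congr 1
  funext w
  have e1 : outerWeight (v - Complex.I) x σ m w =
      Real.exp x * outerWeight v x σ (m - 2) w * Real.exp w := by
    unfold outerWeight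
    rw [phase_sub_I, sub_eq_add_neg x w, Real.exp_add,
      show m * w = (m - 2) * w + w + w by ring, Real.exp_add, Real.exp_add]
    have := exp_mul_exp_neg_ofReal w
    push_cast at this ⊢
    linear_combination phase v (x + -w) * Complex.exp x * Complex.exp (-(σ * Complex.exp w)) *
      Complex.exp ((m - 2) * w) * Complex.exp w * this
  have e2 : ∀ y, phase (v - Complex.I) (y - w) * h y =
      Real.exp (-w) * (phase v (y - w) * (Real.exp y * h y)) := by
    intro y
    rw [phase_sub_I, sub_eq_add_neg y w, Real.exp_add]
    push_cast
    ring
  simp only [e1, e2, integral_const_mul]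
  have := exp_mul_exp_neg_ofReal w
  linear_combination Real.exp x * outerWeight v x σ (m - 2) w *
    (∫ y, phase v (y - w) * (Real.exp y * h y)) * this

/-- The local intertwining relation. -/
theorem siteIntegral_intertwining {h₀ h₀' h₁ h₂ : ℝ → ℂ} (hσ : 0 < σ) (H₀ : RapidlyDecaying h₀)
    (H₀' : RapidlyDecaying h₀') (H₁ : RapidlyDecaying h₁) (H₂ : RapidlyDecaying h₂)
    (hd : ∀ y, HasDerivAt h₀ (h₀' y) y) :
    Complex.I * σ * siteIntegral v x σ 1 (fun y => v * h₀ y + Complex.I * (h₀' y -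
        Real.exp (-y) * h₂ y) + Real.exp (-y) * h₁ y) -
      2 * v * siteIntegral v x σ 0 (fun y => v * h₀ y + Complex.I * (h₀' y -
        Real.exp (-y) * h₂ y) + Real.exp (-y) * h₁ y) -
      σ * siteIntegral v x σ 0 (fun y => -(Real.exp y * h₀ y)) =
    -Complex.I * Real.exp x * siteIntegral v x σ (-1) (fun y =>
      Complex.I * (Real.exp (-x) + Real.exp (-y) : ℝ) * h₂ y - 2 * v * h₀ y -
        (Real.exp (-x) + Real.exp (-y) : ℝ) * h₁ y) := by
  have E₀ : RapidlyDecaying fun y => (Real.exp y : ℂ) * h₀ y := by simpa using H₀.exp_mul 1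
  have HM : RapidlyDecaying fun y => (Real.exp (-y) : ℂ) * (h₁ y + -Complex.I * h₂ y) := by
    simpa using (H₁.add (H₂.const_mul (-Complex.I))).exp_mul (-1)
  have HD : RapidlyDecaying fun y => Complex.I * v * h₀ y + h₀' y :=
    (H₀.const_mul _).add H₀'
  -- Writing `v = i(iv) + 2v` isolates `iv h₀ + h₀'`, the combination that the inner integration by
  -- parts simplifies. Here `h₀' - e^{-y} h₂` will be the layer of `∂_j` of the function whose layer
  -- is `h₀`.
  have hM : (fun y => v * h₀ y + Complex.I * (h₀' y - Real.exp (-y) * h₂ y) +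
      Real.exp (-y) * h₁ y) = fun y => (Complex.I * (Complex.I * v * h₀ y + h₀' y) +
        2 * v * h₀ y) + Real.exp (-y) * (h₁ y + -Complex.I * h₂ y) := by
    funext y
    linear_combination -v * h₀ y * Complex.I_mul_I
  have hM' : ∀ m, siteIntegral v x σ m (fun y => v * h₀ y + Complex.I * (h₀' y -
      Real.exp (-y) * h₂ y) + Real.exp (-y) * h₁ y) =
      Complex.I * siteIntegral v x σ (m - 1) (fun y => Real.exp y * h₀ y) +
        2 * v * siteIntegral v x σ m h₀ +
        siteIntegral v x σ m (fun y => Real.exp (-y) * (h₁ y + -Complex.I * h₂ y)) := by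
    intro m
    rw [hM, siteIntegral_add v x ((HD.const_mul _).add (H₀.const_mul _)) HM hσ,
      siteIntegral_add v x (HD.const_mul _) (H₀.const_mul _) hσ, siteIntegral_const_mul,
      siteIntegral_const_mul, siteIntegral_deriv v x H₀ H₀' hd]
  have hN : siteIntegral v x σ 0 (fun y => -(Real.exp y * h₀ y)) =
      -siteIntegral v x σ 0 (fun y => Real.exp y * h₀ y) := by
    simpa using siteIntegral_const_mul v x σ 0 (fun y => Real.exp y * h₀ y) (-1)
  have w1 := siteIntegral_outer v x H₀ hσ
  have w2 := siteIntegral_outer v x HM hσ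
  have s1 : siteIntegral v x σ (-1) (fun y => ((Real.exp x : ℂ) + Real.exp y) * h₀ y) =
      Real.exp x * siteIntegral v x σ (-1) h₀ +
        siteIntegral v x σ (-1) (fun y => Real.exp y * h₀ y) := by
    rw [← siteIntegral_const_mul, ← siteIntegral_add v x (H₀.const_mul _) E₀ hσ]
    simp only [add_mul]
  have HS : RapidlyDecaying fun y => ((Real.exp (-x) + Real.exp (-y) : ℝ) : ℂ) *
      (h₁ y + -Complex.I * h₂ y) := by
    have := ((H₁.add (H₂.const_mul (-Complex.I))).const_mul (Real.exp (-x))).add HM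
    simpa [add_mul] using this
  -- From `(e^x + e^y) e^{-y} = e^x (e^{-x} + e^{-y})` there emerges `e^{-x} + e^{-y}`, the value of
  -- `σ` for the inner sites.
  have s2 : siteIntegral v x σ (-1) (fun y => ((Real.exp x : ℂ) + Real.exp y) *
      (Real.exp (-y) * (h₁ y + -Complex.I * h₂ y))) =
      Real.exp x * siteIntegral v x σ (-1) (fun y => ((Real.exp (-x) + Real.exp (-y) : ℝ) : ℂ) *
        (h₁ y + -Complex.I * h₂ y)) := by
    rw [← siteIntegral_const_mul]
    congr 1
    funext y
    have h1 := exp_mul_exp_neg_ofReal x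
    have h2 := exp_mul_exp_neg_ofReal y
    push_cast at h1 h2 ⊢
    linear_combination (h₁ y + -Complex.I * h₂ y) * (h2 - h1)
  have s3 : siteIntegral v x σ (-1) (fun y =>
      Complex.I * (Real.exp (-x) + Real.exp (-y) : ℝ) * h₂ y - 2 * v * h₀ y -
        (Real.exp (-x) + Real.exp (-y) : ℝ) * h₁ y) = -1 * siteIntegral v x σ (-1) (fun y =>
        ((Real.exp (-x) + Real.exp (-y) : ℝ) : ℂ) * (h₁ y + -Complex.I * h₂ y)) +
        -2 * v * siteIntegral v x σ (-1) h₀ := by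
    rw [← siteIntegral_const_mul, ← siteIntegral_const_mul,
      ← siteIntegral_add v x (HS.const_mul _) (H₀.const_mul _) hσ]
    congr 1
    funext y
    ring
  rw [hM', hM', hN, s3, show (1 : ℝ) - 1 = 0 by norm_num, show (0 : ℝ) - 1 = -1 by norm_num]
  rw [s1] at w1
  rw [s2] at w2
  linear_combination (2 * v * Complex.I) * w1 + Complex.I * w2 + (σ * siteIntegral v x σ 0
    (fun y => Real.exp y * h₀ y) - 4 * v ^ 2 * siteIntegral v x σ 0 h₀ - 2 * v *
    siteIntegral v x σ 0 (fun y => Real.exp (-y) * (h₁ y + -Complex.I * h₂ y))) * Complex.I_mul_I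

end siteIntegral

end BCToda

namespace BCToda
open scoped Matrix ContDiff Topology
open MeasureTheory Filter

variable {n : ℕ}

/-! ### The recursion in the number of sites -/

theorem ExpFamily.mono {P : Type*} [MeasurableSpace P] {M M' : P → ℝ}
    {F : P → (Fin n → ℝ) → ℝ → ℂ} (h : ExpFamily M F) (hM : ∀ p, M p ≤ M' p) :
    ExpFamily M' F where
  meas := h.meas
  nonneg p := (h.nonneg p).trans (hM p)
  bdd := by
    obtain ⟨C, b, hC, hb, h⟩ := h.bdd
    refine ⟨C, b, hC, hb, fun p x t => (h p x t).trans ?_⟩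
    gcongr
    exact hM p

theorem ExpFamily.param_mul {P : Type*} [MeasurableSpace P] {M : P → ℝ}
    {F : P → (Fin n → ℝ) → ℝ → ℂ} (h : ExpFamily M F) {k : P → ℂ} (hk : Measurable k) :
    ExpFamily (fun p => ‖k p‖ * M p) fun p x t => k p * F p x t where
  meas := (hk.comp measurable_fst).mul h.meas
  nonneg p := mul_nonneg (norm_nonneg _) (h.nonneg p)
  bdd := by
    obtain ⟨C, b, hC, hb, h⟩ := h.bdd
    refine ⟨C, b, hC, hb, fun p x t => ?_⟩
    rw [norm_mul]
    calc _ ≤ ‖k p‖ * (C * M p * Real.exp (b * weight x t)) := by gcongr; exact h p x t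
      _ = _ := by ring

/-- The integral operators of the monodromy operator for the sites in the list `l` (the last site
comes first). -/
noncomputable def siteFactors (α β : ℝ) (v : ℂ) (l : List (Fin n)) : List (IntOp n) :=
  (l.map fun j => opR v j) ++ opK α β v :: l.reverse.map fun j => opRstar v j

theorem monodromyFactors_eq (α β : ℝ) (v : ℂ) :
    monodromyFactors α β n v = siteFactors α β v (List.finRange n).reverse := by
  simp [monodromyFactors, siteFactors]

theorem siteFactors_cons (α β : ℝ) (v : ℂ) (j : Fin n) (l : List (Fin n)) :
    siteFactors α β v (j :: l) = opR v j :: (siteFactors α β v l ++ [opRstar v j]) := by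
  simp [siteFactors]

theorem admissible_of_mem_siteFactors (α : ℝ) {β : ℝ} (hβ : 0 < β) {v : ℂ} (hv : -g α β < v.im)
    (l : List (Fin n)) : ∀ T ∈ siteFactors α β v l, Admissible T := by
  intro T hT
  simp only [siteFactors, List.mem_append, List.mem_map, List.mem_cons] at hT
  rcases hT with ⟨j, -, rfl⟩ | rfl | ⟨j, -, rfl⟩
  · exact admissible_opR v j
  · exact admissible_opK α hβ hv
  · exact admissible_opRstar v j

theorem localAway_of_mem_siteFactors (α β : ℝ) (v : ℂ) {l : List (Fin n)} {j : Fin n}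
    (hj : j ∉ l) : ∀ T ∈ siteFactors α β v l, LocalAway j T := by
  intro T hT
  simp only [siteFactors, List.mem_append, List.mem_map, List.mem_cons, List.mem_reverse] at hT
  rcases hT with ⟨i, hi, rfl⟩ | rfl | ⟨i, hi, rfl⟩
  · exact localAway_opR v fun h => hj (h ▸ hi)
  · exact localAway_opK α β v j
  · exact localAway_opRstar v fun h => hj (h ▸ hi)

/-- A measurable function of `x` of at most exponential growth. -/
def ExpGrowth (f : (Fin n → ℝ) → ℂ) : Prop :=
  Measurable f ∧ ∃ C b : ℝ, 0 ≤ C ∧ 0 ≤ b ∧ ∀ x, ‖f x‖ ≤ C * Real.exp (b * ∑ i, |x i|)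

theorem ExpGrowth.expBounded {f : (Fin n → ℝ) → ℂ} (hf : ExpGrowth f) :
    ExpBounded fun x _ => f x := by
  obtain ⟨hm, C, b, hC, hb, h⟩ := hf
  refine expBounded_iff.2 ⟨hm.comp measurable_fst, C, b, hC, hb, fun x t => (h x).trans ?_⟩
  have : ∑ i, |x i| ≤ weight x t := le_add_of_nonneg_right (abs_nonneg t)
  gcongr

/-- The function to which the inner sites are applied, when the variable `x_j` is `y`. -/
noncomputable def layerFun (j : Fin n) (m : ℝ) (f : (Fin n → ℝ) → ℂ) (y : ℝ) (x : Fin n → ℝ)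
    (t : ℝ) : ℂ :=
  (Real.exp (-Real.exp (-y - t)) : ℂ) * Real.exp (-m * t) * f (Function.update x j y)

/-- The result of applying the inner sites. -/
noncomputable def layer (α β : ℝ) (v : ℂ) (l : List (Fin n)) (j : Fin n) (x : Fin n → ℝ) (m : ℝ)
    (f : (Fin n → ℝ) → ℂ) (y : ℝ) : ℂ :=
  actProd (siteFactors α β v l) (layerFun j m f y) x (x j)

/-- As `y → -∞` the cutoff `e^{-e^{-y-t}}` is at most a constant times `e^{c(y+t)}` for any `c ≥ 0`,
and `e^{ct}` is absorbed by the weight in `(x, t)`. The rate `b` does not depend on `c`. -/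
theorem ExpGrowth.expFamily_layerFun {f : (Fin n → ℝ) → ℂ} (hf : ExpGrowth f) (j : Fin n)
    (m : ℝ) : ∃ b, 0 ≤ b ∧ ∀ c, 0 ≤ c →
      ExpFamily (fun y => Real.exp (b * |y| + c * y)) (layerFun j m f) := by
  obtain ⟨hm, C, b, hC, hb, h⟩ := hf
  refine ⟨b, hb, fun c hc => ⟨?_, fun _ => (Real.exp_pos _).le, ?_⟩⟩
  · have h1 : Measurable fun q : ℝ × (Fin n → ℝ) × ℝ => f (Function.update q.2.1 j q.1) :=
      hm.comp (measurable_update'.comp (f := fun q : ℝ × (Fin n → ℝ) × ℝ => (q.2.1, q.1))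
        (by fun_prop))
    exact Measurable.mul (by fun_prop) h1
  · obtain ⟨C', hC', h'⟩ := exists_exp_neg_exp_le c
    refine ⟨C' * C, c + |m| + b, by positivity, by positivity, fun y x t => ?_⟩
    unfold layerFun
    rw [norm_mul, norm_mul, Complex.norm_real, Complex.norm_real, Real.norm_eq_abs,
      Real.norm_eq_abs, Real.abs_exp, Real.abs_exp]
    have ht := abs_le_weight x t
    have hx : ∑ i, |Function.update x j y i| ≤ weight x t + |y| := by
      have := sum_abs_update_le x j y
      have := abs_nonneg t
      simp only [weight]
      linarith
    calc _ ≤ (C' * Real.exp (-(c * (-y - t)))) * Real.exp (-m * t) *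
          (C * Real.exp (b * ∑ i, |Function.update x j y i|)) := by
          gcongr
          · exact h' c hc le_rfl _
          · exact h _
      _ = C' * C * Real.exp (-(c * (-y - t)) + -m * t +
          b * ∑ i, |Function.update x j y i|) := by
        rw [Real.exp_add, Real.exp_add]; ring
      _ ≤ C' * C * Real.exp (b * |y| + c * y + (c + |m| + b) * weight x t) := by
        refine mul_le_mul_of_nonneg_left (Real.exp_le_exp.2 ?_) (by positivity)
        have h1 : b * ∑ i, |Function.update x j y i| ≤ b * (weight x t + |y|) := by gcongr
        have h2 : c * t ≤ c * weight x t := by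
          gcongr
          exact (le_abs_self t).trans ht
        have h3 : -m * t ≤ |m| * weight x t := by
          calc -m * t ≤ |-m * t| := le_abs_self _
            _ = |m| * |t| := by rw [abs_mul, abs_neg]
            _ ≤ _ := by gcongr
        linarith
      _ = _ := by rw [Real.exp_add]; ring

/-- The inner operators keep the parameter weight `e^{b|y| + cy}`, so the layer inherits the rapid
decay of the function it is built from. -/
theorem ExpGrowth.rapidlyDecaying_layer {α β : ℝ} (hβ : 0 < β) {v : ℂ} (hv : -g α β < v.im)
    (l : List (Fin n)) (j : Fin n) (x : Fin n → ℝ) (m : ℝ) {f : (Fin n → ℝ) → ℂ}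
    (hf : ExpGrowth f) : RapidlyDecaying (layer α β v l j x m f) := by
  obtain ⟨b, hb, h⟩ := hf.expFamily_layerFun j m
  have hl := admissible_of_mem_siteFactors α hβ hv l
  refine ⟨?_, b, hb, fun c hc => ?_⟩
  · exact ((h 0 le_rfl).actProd hl).meas.comp (f := fun y => (y, x, x j)) (by fun_prop)
  · obtain ⟨C, b', hC, hb', h⟩ := ((h c hc).actProd hl).bdd
    refine ⟨C * Real.exp (b' * weight x (x j)), by positivity, fun y => (h y x (x j)).trans_eq ?_⟩
    ring

theorem layer_add {α β : ℝ} (hβ : 0 < β) {v : ℂ} (hv : -g α β < v.im)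
    (l : List (Fin n)) (j : Fin n) (x : Fin n → ℝ) (m : ℝ) {f f' : (Fin n → ℝ) → ℂ}
    (hf : ExpGrowth f) (hf' : ExpGrowth f') (y : ℝ) :
    layer α β v l j x m (fun x => f x + f' x) y =
      layer α β v l j x m f y + layer α β v l j x m f' y := by
  obtain ⟨b, hb, h⟩ := hf.expFamily_layerFun j m
  obtain ⟨b', hb', h'⟩ := hf'.expFamily_layerFun j m
  have := actProd_add (admissible_of_mem_siteFactors α hβ hv l) ((h 0 le_rfl).expBounded y)
    ((h' 0 le_rfl).expBounded y)
  unfold layer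
  rw [← congrFun (congrFun this x) (x j)]
  congr 1
  funext x' t'
  exact mul_add _ _ _

theorem layer_mul {α β : ℝ} (hβ : 0 < β) {v : ℂ} (hv : -g α β < v.im)
    (l : List (Fin n)) (j : Fin n) (x : Fin n → ℝ) (m : ℝ) (f : (Fin n → ℝ) → ℂ) (c : ℝ → ℂ)
    (y : ℝ) :
    layer α β v l j x m (fun x => c (x j) * f x) y = c y * layer α β v l j x m f y := by
  have := actProd_const_mul (admissible_of_mem_siteFactors α hβ hv l) (layerFun j m f y) (c y)
  unfold layer
  rw [← congrFun (congrFun this x) (x j)]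
  congr 1
  funext x' t'
  unfold layerFun
  simp only [Function.update_self]
  rw [mul_left_comm]

/-- The parameter `y` enters through `f` and through `e^{-e^{-y-t}}`. The latter contributes `e^{-y}
e^{-t}`, and `e^{-t}` raises `m` from `0` to `1`. -/
theorem hasDerivAt_layer {α β : ℝ} (hβ : 0 < β) {v : ℂ} (hv : -g α β < v.im)
    (l : List (Fin n)) (j : Fin n) (x : Fin n → ℝ) {φ : Smooth n}
    (hφ : ExpGrowth (φ : (Fin n → ℝ) → ℂ)) (hφ' : ExpGrowth (pd j φ : (Fin n → ℝ) → ℂ)) (y : ℝ) :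
    HasDerivAt (layer α β v l j x 0 φ) (layer α β v l j x 0 (pd j φ) y +
      Real.exp (-y) * layer α β v l j x 1 φ y) y := by
  have hl := admissible_of_mem_siteFactors α hβ hv l
  obtain ⟨b₀, hb₀, h₀⟩ := hφ.expFamily_layerFun j 0
  obtain ⟨b₁, hb₁, h₁⟩ := hφ.expFamily_layerFun j 1
  obtain ⟨b₂, hb₂, h₂⟩ := hφ'.expFamily_layerFun j 0
  -- A common weight for the family and its derivative; the `1` pays for the factor `e^{-y}`.
  have hM : ∀ b, b ≤ b₀ + b₁ + b₂ + 1 → ∀ y : ℝ, Real.exp (b * |y| + 0 * y) ≤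
      Real.exp ((b₀ + b₁ + b₂ + 1) * |y|) := by
    intro b hb y
    rw [zero_mul, add_zero, Real.exp_le_exp]
    gcongr
  have e : ExpFamily (fun y => Real.exp ((b₀ + b₁ + b₂ + 1) * |y|))
      fun y x t => (Real.exp (-y) : ℂ) * layerFun j 1 φ y x t := by
    refine ((h₁ 0 le_rfl).param_mul (k := fun y : ℝ => (Real.exp (-y) : ℂ))
      (by fun_prop)).mono fun y => ?_
    rw [Complex.norm_real, Real.norm_eq_abs, Real.abs_exp, ← Real.exp_add, Real.exp_le_exp]
    nlinarith [neg_le_abs y, abs_nonneg y]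
  have h := hasDerivAt_actProd hl
    (M := fun y => Real.exp ((b₀ + b₁ + b₂ + 1) * |y|)) (F := layerFun j 0 φ)
    (F' := fun y x t => layerFun j 0 (pd j φ) y x t + Real.exp (-y) * layerFun j 1 φ y x t)
    (by fun_prop) ((h₀ 0 le_rfl).mono (hM _ (by linarith)))
    (((h₂ 0 le_rfl).mono (hM _ (by linarith))).add e) ?_ x (x j) y
  · rw [actProd_add hl ((h₂ 0 le_rfl).expBounded y) (e.expBounded y),
      actProd_const_mul hl] at h
    exact h
  · intro x t y
    have d1 : HasDerivAt (fun y => ((Real.exp (-Real.exp (-y - t)) : ℝ) : ℂ))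
        ((Real.exp (-Real.exp (-y - t)) * -(Real.exp (-y - t) * -1) : ℝ) : ℂ) y :=
      ((((hasDerivAt_neg y).sub_const t).exp).neg.exp).ofReal_comp
    have d2 : HasDerivAt (fun y => (φ : (Fin n → ℝ) → ℂ) (Function.update x j y))
        ((pd j φ : (Fin n → ℝ) → ℂ) (Function.update x j y)) y :=
      (Smooth.differentiable φ _).hasFDerivAt.comp_hasDerivAt y (hasDerivAt_update x j y)
    refine ((d1.mul_const _).mul d2).congr_deriv ?_
    unfold layerFun
    rw [sub_eq_add_neg (-y), Real.exp_add (-y), neg_one_mul]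
    push_cast
    simp only [neg_zero, zero_mul, Complex.exp_zero]
    ring

/-- The coefficient `b + |Im v| + 1` leaves exactly `e^{-|y|}` for `y < 0`; for `y ≥ 0` the double
exponential in the phase dominates. -/
theorem integrable_norm_phase_mul_exp (v : ℂ) {b : ℝ} (hb : 0 ≤ b) (w : ℝ) :
    Integrable fun y => ‖phase v (y - w)‖ * Real.exp (b * |y| + (b + |v.im| + 1) * y) := by
  obtain ⟨C, hC, h⟩ := exists_norm_phase_le v (c := 2 * b + 2 * |v.im| + 2) (by positivity)
  refine ((integrable_exp_neg_mul_abs one_pos).const_mul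
    (C * Real.exp ((3 * |v.im| + 2 * b + 2) * |w|))).mono' ?_ (Eventually.of_forall fun y => ?_)
  · have := continuous_phase v
    exact Continuous.aestronglyMeasurable (by fun_prop)
  have hyw : |v.im| * |y - w| ≤ |v.im| * (|y| + |w|) := by gcongr; exact abs_sub _ _
  have hv := abs_nonneg v.im
  rw [norm_mul, norm_norm, Real.norm_eq_abs, Real.abs_exp, mul_assoc C, ← Real.exp_add]
  rcases le_or_gt 0 y with hy | hy
  · calc _ ≤ C * Real.exp (|v.im| * |y - w|) * Real.exp (-((2 * b + 2 * |v.im| + 2) * (y - w))) *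
          Real.exp (b * |y| + (b + |v.im| + 1) * y) := by gcongr; exact (h _).2
      _ = C * Real.exp (|v.im| * |y - w| + -((2 * b + 2 * |v.im| + 2) * (y - w)) +
          (b * |y| + (b + |v.im| + 1) * y)) := by simp only [Real.exp_add]; ring
      _ ≤ _ := by
        refine mul_le_mul_of_nonneg_left (Real.exp_le_exp.2 ?_) hC
        rw [abs_of_nonneg hy] at *
        have : (2 * b + 2 * |v.im| + 2) * w ≤ (2 * b + 2 * |v.im| + 2) * |w| := by
          gcongr
          exact le_abs_self w
        linarith
  · calc _ ≤ C * Real.exp (|v.im| * |y - w|) *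
          Real.exp (b * |y| + (b + |v.im| + 1) * y) := by gcongr; exact (h _).1
      _ = C * Real.exp (|v.im| * |y - w| + (b * |y| + (b + |v.im| + 1) * y)) := by
        simp only [Real.exp_add]; ring
      _ ≤ _ := by
        refine mul_le_mul_of_nonneg_left (Real.exp_le_exp.2 ?_) hC
        rw [abs_of_neg hy] at *
        have : 0 ≤ (2 * b + 2 * |v.im| + 2) * |w| := by positivity
        linarith

/-- The reflected operator evaluates its argument at `t = -w`, so `e^{-S e^{-t} - mt}` leaves the
integral as a function of `w`, while its own cutoff `e^{-e^{-y-t}}` stays for the inner sites. -/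
theorem opRstar_act_update (v : ℂ) (j : Fin n) (S m : ℝ) (f : (Fin n → ℝ) → ℂ) (x : Fin n → ℝ)
    (w t : ℝ) :
    (opRstar v j).act (fun x t => (Real.exp (-(S * Real.exp (-t))) : ℂ) * Real.exp (-m * t) * f x)
      (Function.update x j w) t = (Real.exp (-(S * Real.exp w)) : ℂ) * Real.exp (m * w) *
        ∫ y, phase v (y - w) * layerFun j 0 f y x t := by
  unfold IntOp.act
  rw [← integral_const_mul]
  congr 1
  funext y
  simp only [opRstar, layerFun, phase, Function.update_self, Function.update_idem, neg_neg,
    neg_mul_neg, neg_zero, zero_mul, Real.exp_zero, Complex.ofReal_one, mul_one,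
    sub_eq_add_neg _ ((Real.exp (-y - t) : ℝ) : ℂ), Complex.exp_add, Complex.ofReal_exp (-_),
    Complex.ofReal_neg (Real.exp _), Complex.ofReal_sub y]
  ring

theorem opR_act_eq (v : ℂ) (j : Fin n) (ψ : (Fin n → ℝ) → ℝ → ℂ) (x : Fin n → ℝ) (t : ℝ) :
    (opR v j).act ψ x t = ∫ w, phase v (x j - w) * Real.exp (-(Real.exp (-t) * Real.exp w)) *
      ψ (Function.update x j w) (x j) := by
  unfold IntOp.act
  congr 1
  funext w
  rw [← Real.exp_add, neg_add_eq_sub t w]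
  simp only [opR, phase, sub_eq_add_neg _ ((Real.exp (w - t) : ℝ) : ℂ), Complex.exp_add,
    Complex.ofReal_exp (-_), Complex.ofReal_neg (Real.exp _), Complex.ofReal_sub (x j)]

/-- The inner sites applied to the image under the reflected operator. -/
theorem actProd_opRstar {α β : ℝ} (hβ : 0 < β) {v v' : ℂ} (hv : -g α β < v.im)
    {l : List (Fin n)} {j : Fin n} (hj : j ∉ l) {f : (Fin n → ℝ) → ℂ} (hf : ExpGrowth f)
    (x : Fin n → ℝ) (w S m : ℝ) :
    actProd (siteFactors α β v l) ((opRstar v' j).act fun x t =>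
      (Real.exp (-(S * Real.exp (-t))) : ℂ) * Real.exp (-m * t) * f x)
      (Function.update x j w) (x j) = (Real.exp (-(S * Real.exp w)) : ℂ) * Real.exp (m * w) *
        ∫ y, phase v' (y - w) * layer α β v l j x 0 f y := by
  have hl := admissible_of_mem_siteFactors α hβ hv l
  obtain ⟨b, hb, h⟩ := hf.expFamily_layerFun j 0
  rw [actProd_update (localAway_of_mem_siteFactors α β v hj)]
  simp only [opRstar_act_update]
  have hk : Measurable fun y => phase v' (y - w) :=
    (continuous_phase v').measurable.comp (by fun_prop)
  -- The inner sites are moved under the `y`-integral by Fubini; the exponent from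
  -- `integrable_norm_phase_mul_exp` makes the parameter weight integrable.
  rw [actProd_const_mul hl, actProd_integral hl (integrable_norm_phase_mul_exp v' hb w)
    ((h _ (by positivity)).param_mul hk)]
  simp only [actProd_const_mul hl]
  rfl

/-- The recursion for the monodromy operator in terms of the two-dimensional integrals of the
outermost site. -/
theorem actProd_siteFactors_cons {α β : ℝ} (hβ : 0 < β) {v : ℂ} (hv : -g α β < v.im)
    {l : List (Fin n)} {j : Fin n} (hj : j ∉ l) {f : (Fin n → ℝ) → ℂ} (hf : ExpGrowth f)
    (x : Fin n → ℝ) (t S m : ℝ) :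
    actProd (siteFactors α β v (j :: l)) (fun x t =>
      (Real.exp (-(S * Real.exp (-t))) : ℂ) * Real.exp (-m * t) * f x) x t =
      siteIntegral v (x j) (Real.exp (-t) + S) m (layer α β v l j x 0 f) := by
  have h0 : ∀ ψ : (Fin n → ℝ) → ℝ → ℂ, actProd [opRstar v j] ψ = (opRstar v j).act ψ :=
    fun _ => rfl
  rw [siteFactors_cons, actProd_cons, actProd_append, opR_act_eq, h0]
  unfold siteIntegral outerWeight
  congr 1
  funext w
  rw [actProd_opRstar hβ hv hj hf x w S m, add_mul, neg_add, Real.exp_add]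
  push_cast
  ring

end BCToda

namespace BCToda
open scoped Matrix ContDiff Topology
open MeasureTheory Filter

variable {n : ℕ}

/-! ### The monodromy matrix -/

/-- The matrix `σ₂ L_jᵗ(-u) σ₂`. -/
noncomputable def reflectedLax (u : ℂ) (j : Fin n) : OpMatrix n :=
  !![0, -mulExp (-1) j;
     mulExp 1 j, (-u) • (1 : Module.End ℂ (Smooth n)) + Complex.I • pd j]

/-- The monodromy matrix for the sites in the list `l` (the last site comes first). -/
noncomputable def siteMatrix (α β : ℝ) (u : ℂ) : List (Fin n) → OpMatrix n
  | [] => scalarMatrix (boundaryK α β u)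
  | j :: l => lax u j * siteMatrix α β u l * reflectedLax u j

theorem scalarMatrix_sigma2_mul_self :
    (scalarMatrix sigma2 * scalarMatrix sigma2 : OpMatrix n) = 1 := by
  ext i j : 2
  fin_cases i <;> fin_cases j <;>
    simp [scalarMatrix, sigma2, Matrix.mul_apply, Fin.sum_univ_two, ← map_mul]

theorem sigma2_mul_lax_transpose_mul_sigma2 (u : ℂ) (j : Fin n) :
    scalarMatrix sigma2 * (lax (-u) j)ᵀ * scalarMatrix sigma2 = reflectedLax u j := by
  have h : ∀ c d : ℂ, ∀ X : Module.End ℂ (Smooth n),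
      algebraMap ℂ (Module.End ℂ (Smooth n)) c * X * algebraMap ℂ (Module.End ℂ (Smooth n)) d =
        (c * d) • X := by
    intro c d X
    rw [Algebra.algebraMap_eq_smul_one, Algebra.algebraMap_eq_smul_one, smul_one_mul,
      mul_smul_one, smul_smul, mul_comm]
  ext i k : 2
  fin_cases i <;> fin_cases k <;>
    simp [scalarMatrix, sigma2, lax, reflectedLax, Matrix.mul_apply, Fin.sum_univ_two, h, -map_neg]

/-- Inserting `σ₂² = 1` between the transposed factors conjugates each of them, and the product
becomes nested around `K(u)`. -/
theorem prod_eq_siteMatrix (α β : ℝ) (u : ℂ) (l : List (Fin n)) :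
    (l.map fun j => lax u j).prod * scalarMatrix (boundaryK α β u) * scalarMatrix sigma2 *
      (l.reverse.map fun j => (lax (-u) j)ᵀ).prod * scalarMatrix sigma2 = siteMatrix α β u l := by
  induction l with
  | nil => simp [siteMatrix, mul_assoc, scalarMatrix_sigma2_mul_self]
  | cons j l ih =>
    rw [siteMatrix, ← ih, ← sigma2_mul_lax_transpose_mul_sigma2]
    simp only [List.map_cons, List.prod_cons, List.reverse_cons, List.map_append, List.map_nil,
      List.prod_append, List.prod_nil, mul_one]
    simp only [mul_assoc]
    rw [← mul_assoc (scalarMatrix sigma2) (scalarMatrix sigma2), scalarMatrix_sigma2_mul_self,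
      one_mul]

theorem opB_eq (α β : ℝ) (u : ℂ) :
    opB α β n u = siteMatrix α β u (List.finRange n).reverse 0 1 := by
  rw [← prod_eq_siteMatrix, List.reverse_reverse]
  rfl

/-! ### Spaces of smooth functions closed under differentiation -/

theorem pd_mulExp (c : ℝ) (i j : Fin n) (φ : Smooth n) :
    pd i (mulExp c j φ) = mulExp c j (pd i φ + (if i = j then (c : ℂ) else 0) • φ) := by
  apply Subtype.ext
  funext x
  have d1 : HasFDerivAt (fun x : Fin n → ℝ => ((Real.exp (c * x j) : ℝ) : ℂ))
      (Complex.ofRealCLM.comp (Real.exp (c * x j) • (c •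
        (ContinuousLinearMap.proj j : (Fin n → ℝ) →L[ℝ] ℝ)))) x :=
    Complex.ofRealCLM.hasFDerivAt.comp x
      ((((ContinuousLinearMap.proj j : (Fin n → ℝ) →L[ℝ] ℝ).hasFDerivAt (x := x)).const_mul
        c).exp)
  have d2 := d1.mul (Smooth.differentiable φ x).hasFDerivAt
  have e := congrArg (fun L => L (Pi.single i (1 : ℝ))) d2.fderiv
  refine e.trans ?_
  change _ = (Real.exp (c * x j) : ℂ) * (fderiv ℝ (φ : (Fin n → ℝ) → ℂ) x (Pi.single i 1) +
    (if i = j then (c : ℂ) else 0) * (φ : (Fin n → ℝ) → ℂ) x)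
  by_cases h : i = j
  · subst h
    simp
    ring
  · simp [h]

theorem pd_comm (i j : Fin n) (φ : Smooth n) : pd i (pd j φ) = pd j (pd i φ) := by
  have key : ∀ (a b : Fin n) (x : Fin n → ℝ), (pd a (pd b φ) : (Fin n → ℝ) → ℂ) x =
      fderiv ℝ (fderiv ℝ (φ : (Fin n → ℝ) → ℂ)) x (Pi.single a 1) (Pi.single b 1) := by
    intro a b x
    have hd : DifferentiableAt ℝ (fderiv ℝ (φ : (Fin n → ℝ) → ℂ)) x :=
      ((Smooth.contDiff φ).fderiv_right (m := ∞) (by simp)).differentiable (by simp) x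
    change fderiv ℝ (fun x => fderiv ℝ (φ : (Fin n → ℝ) → ℂ) x (Pi.single b 1)) x
      (Pi.single a 1) = _
    rw [fderiv_clm_apply hd (differentiableAt_const _)]
    simp
  apply Subtype.ext
  funext x
  rw [key, key]
  exact ((Smooth.contDiff φ).contDiffAt.isSymmSndFDerivAt (by
    simpa using WithTop.coe_le_coe.2 (le_top : (2 : ℕ∞) ≤ ⊤))) _ _

/-- The smooth functions all of whose derivatives belong to a given space of functions. -/
def derivClosure (G : Submodule ℂ ((Fin n → ℝ) → ℂ)) : Submodule ℂ (Smooth n) where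
  carrier := {φ | ∀ l : List (Fin n), ((l.map pd).prod φ : (Fin n → ℝ) → ℂ) ∈ G}
  add_mem' hφ hψ l := by
    rw [map_add]
    exact G.add_mem (hφ l) (hψ l)
  zero_mem' l := by
    rw [map_zero]
    exact G.zero_mem
  smul_mem' c φ hφ l := by
    rw [map_smul]
    exact G.smul_mem c (hφ l)

section derivClosure

variable {G : Submodule ℂ ((Fin n → ℝ) → ℂ)} {φ : Smooth n}

theorem coe_mem_of_mem_derivClosure (hφ : φ ∈ derivClosure G) : (φ : (Fin n → ℝ) → ℂ) ∈ G :=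
  hφ []

theorem pd_mem_derivClosure (hφ : φ ∈ derivClosure G) (j : Fin n) : pd j φ ∈ derivClosure G := by
  intro l
  have := hφ (l ++ [j])
  simpa using this

/-- The derivative acting first is commuted past the exponential: it replaces `φ` by `∂φ + cφ` or
`∂φ`, which lies in the same space, and the list of derivatives gets shorter. -/
theorem mulExp_mem_derivClosure {c : ℝ} {j : Fin n}
    (h : ∀ f ∈ G, (fun x => (Real.exp (c * x j) : ℂ) * f x) ∈ G) (hφ : φ ∈ derivClosure G) :
    mulExp c j φ ∈ derivClosure G := by
  intro l
  induction l using List.reverseRecOn generalizing φ with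
  | nil => exact h _ (hφ [])
  | append_singleton l i ih =>
    have e : (((l ++ [i]).map pd).prod (mulExp c j φ)) =
        (l.map pd).prod (mulExp c j (pd i φ + (if i = j then (c : ℂ) else 0) • φ)) := by
      rw [← pd_mulExp]
      simp
    rw [e]
    exact ih (add_mem (pd_mem_derivClosure hφ i) (Submodule.smul_mem _ _ hφ))

end derivClosure

theorem prod_map_pd_flatMap (k : Fin n → ℕ) (L : List (Fin n)) :
    ((L.flatMap fun j => List.replicate (k j) j).map pd).prod =
      (L.map fun j => pd j ^ k j).prod := by
  induction L with
  | nil => rfl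
  | cons a L ih => simp [ih]

theorem prod_map_pd_eq_multiPd (l : List (Fin n)) :
    (l.map pd).prod = multiPd fun j => l.count j := by
  rw [multiPd, ← prod_map_pd_flatMap]
  refine List.Perm.prod_eq' (List.Perm.map _ ?_) ?_
  · rw [List.perm_iff_count]
    intro a
    rw [List.count_flatMap, ← Fin.sum_univ_def]
    simp [List.count_replicate]
  · rw [List.pairwise_map]
    refine List.pairwise_of_forall fun i j => ?_
    exact LinearMap.ext fun φ => pd_comm i j φ

/-- Partial derivatives commute, so ordered multi-indices give the same condition as arbitrary
words, which are easier for induction. -/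
theorem mem_derivClosure_iff {G : Submodule ℂ ((Fin n → ℝ) → ℂ)} {φ : Smooth n} :
    φ ∈ derivClosure G ↔ ∀ k : Fin n → ℕ, (multiPd k φ : (Fin n → ℝ) → ℂ) ∈ G := by
  constructor
  · intro h k
    have := h ((List.finRange n).flatMap fun j => List.replicate (k j) j)
    rwa [prod_map_pd_flatMap] at this
  · intro h l
    rw [prod_map_pd_eq_multiPd]
    exact h _

/-- All the entries of a matrix of operators preserve the space `W`. -/
def Preserves (W : Submodule ℂ (Smooth n)) (A : OpMatrix n) : Prop :=
  ∀ a b, ∀ φ ∈ W, A a b φ ∈ W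

theorem Preserves.mul {W : Submodule ℂ (Smooth n)} {A B : OpMatrix n} (hA : Preserves W A)
    (hB : Preserves W B) : Preserves W (A * B) := by
  intro a b φ hφ
  rw [Matrix.mul_apply, LinearMap.sum_apply]
  exact Submodule.sum_mem _ fun c _ => hA a c _ (hB c b _ hφ)

theorem preserves_lax {W : Submodule ℂ (Smooth n)} {j : Fin n} (hd : ∀ φ ∈ W, pd j φ ∈ W)
    (h1 : ∀ φ ∈ W, mulExp 1 j φ ∈ W) (h2 : ∀ φ ∈ W, mulExp (-1) j φ ∈ W) (u : ℂ) :
    Preserves W (lax u j) := by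
  intro a b φ hφ
  fin_cases a <;> fin_cases b
  · exact W.add_mem (W.smul_mem _ hφ) (W.smul_mem _ (hd φ hφ))
  · exact h2 φ hφ
  · exact W.neg_mem (h1 φ hφ)
  · exact W.zero_mem

theorem preserves_reflectedLax {W : Submodule ℂ (Smooth n)} {j : Fin n}
    (hd : ∀ φ ∈ W, pd j φ ∈ W) (h1 : ∀ φ ∈ W, mulExp 1 j φ ∈ W)
    (h2 : ∀ φ ∈ W, mulExp (-1) j φ ∈ W) (u : ℂ) : Preserves W (reflectedLax u j) := by
  intro a b φ hφ
  fin_cases a <;> fin_cases b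
  · exact W.zero_mem
  · exact W.neg_mem (h2 φ hφ)
  · exact h1 φ hφ
  · exact W.add_mem (W.smul_mem _ hφ) (W.smul_mem _ (hd φ hφ))

theorem preserves_siteMatrix {W : Submodule ℂ (Smooth n)} {l : List (Fin n)}
    (hd : ∀ j ∈ l, ∀ φ ∈ W, pd j φ ∈ W) (h1 : ∀ j ∈ l, ∀ φ ∈ W, mulExp 1 j φ ∈ W)
    (h2 : ∀ j ∈ l, ∀ φ ∈ W, mulExp (-1) j φ ∈ W) (α β : ℝ) (u : ℂ) :
    Preserves W (siteMatrix α β u l) := by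
  induction l with
  | nil =>
    intro a b φ hφ
    exact W.smul_mem _ hφ
  | cons j l ih =>
    rw [List.forall_mem_cons] at hd h1 h2
    exact ((preserves_lax hd.1 h1.1 h2.1 u).mul (ih hd.2 h1.2 h2.2)).mul
      (preserves_reflectedLax hd.1 h1.1 h2.1 u)

/-! ### Growth conditions -/

/-- Functions of at most exponential growth. -/
def expGrowthSpace (n : ℕ) : Submodule ℂ ((Fin n → ℝ) → ℂ) where
  carrier := {f | ∃ C b : ℝ, 0 ≤ C ∧ 0 ≤ b ∧ ∀ x, ‖f x‖ ≤ C * Real.exp (b * ∑ i, |x i|)}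
  add_mem' := by
    rintro f h ⟨C, b, hC, hb, hf⟩ ⟨C', b', hC', hb', hh⟩
    refine ⟨C + C', b + b', by positivity, by positivity, fun x => ?_⟩
    have hs : 0 ≤ ∑ i, |x i| := by positivity
    calc _ ≤ C * Real.exp (b * ∑ i, |x i|) + C' * Real.exp (b' * ∑ i, |x i|) :=
          (norm_add_le _ _).trans (add_le_add (hf x) (hh x))
      _ ≤ C * Real.exp ((b + b') * ∑ i, |x i|) + C' * Real.exp ((b + b') * ∑ i, |x i|) := by
        gcongr <;> linarith
      _ = _ := by ring
  zero_mem' := ⟨0, 0, le_rfl, le_rfl, fun x => by simp⟩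
  smul_mem' := by
    rintro c f ⟨C, b, hC, hb, hf⟩
    refine ⟨‖c‖ * C, b, by positivity, hb, fun x => ?_⟩
    rw [Pi.smul_apply, norm_smul, mul_assoc]
    gcongr
    exact hf x

theorem exp_mul_mem_expGrowthSpace (c : ℝ) (j : Fin n) {f : (Fin n → ℝ) → ℂ}
    (hf : f ∈ expGrowthSpace n) :
    (fun x => (Real.exp (c * x j) : ℂ) * f x) ∈ expGrowthSpace n := by
  obtain ⟨C, b, hC, hb, hf⟩ := hf
  refine ⟨C, b + |c|, hC, by positivity, fun x => ?_⟩
  rw [norm_mul, Complex.norm_real, Real.norm_eq_abs, Real.abs_exp]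
  calc _ ≤ Real.exp (|c| * ∑ i, |x i|) * (C * Real.exp (b * ∑ i, |x i|)) := by
        gcongr ?_ * ?_
        · rw [Real.exp_le_exp]
          calc c * x j ≤ |c * x j| := le_abs_self _
            _ = |c| * |x j| := abs_mul _ _
            _ ≤ _ := by
              gcongr
              exact Finset.single_le_sum (f := fun i => |x i|) (fun i _ => abs_nonneg _)
                (Finset.mem_univ j)
        · exact hf x
    _ = _ := by rw [add_mul, Real.exp_add]; ring

theorem expGrowth_of_mem {φ : Smooth n} (hφ : φ ∈ derivClosure (expGrowthSpace n)) :
    ExpGrowth (φ : (Fin n → ℝ) → ℂ) :=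
  ⟨(Smooth.contDiff φ).continuous.measurable, coe_mem_of_mem_derivClosure hφ⟩

theorem preserves_siteMatrix_expGrowth (α β : ℝ) (u : ℂ) (l : List (Fin n)) :
    Preserves (derivClosure (expGrowthSpace n)) (siteMatrix α β u l) :=
  preserves_siteMatrix (fun j _ _ hφ => pd_mem_derivClosure hφ j)
    (fun j _ _ hφ => mulExp_mem_derivClosure (fun _ => exp_mul_mem_expGrowthSpace 1 j) hφ)
    (fun j _ _ hφ => mulExp_mem_derivClosure (fun _ => exp_mul_mem_expGrowthSpace (-1) j) hφ)
    α β u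

theorem preserves_reflectedLax_expGrowth (u : ℂ) (j : Fin n) :
    Preserves (derivClosure (expGrowthSpace n)) (reflectedLax u j) :=
  preserves_reflectedLax (fun _ hφ => pd_mem_derivClosure hφ j)
    (fun _ hφ => mulExp_mem_derivClosure (fun _ => exp_mul_mem_expGrowthSpace 1 j) hφ)
    (fun _ hφ => mulExp_mem_derivClosure (fun _ => exp_mul_mem_expGrowthSpace (-1) j) hφ) u

end BCToda

namespace BCToda
open scoped Matrix ContDiff Topology
open MeasureTheory Filter

variable {n : ℕ}

/-! ### The intertwining relation for the monodromy operator -/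

/-- The monodromy operator for the sites in `l`, applied to `e^{-S e^{-t} - m t} f(x)`. -/
noncomputable def siteU (α β : ℝ) (v : ℂ) (l : List (Fin n)) (S m : ℝ) (f : (Fin n → ℝ) → ℂ) :
    (Fin n → ℝ) → ℝ → ℂ :=
  actProd (siteFactors α β v l) fun x t =>
    (Real.exp (-(S * Real.exp (-t))) : ℂ) * Real.exp (-m * t) * f x

theorem siteU_nil (α β : ℝ) (v : ℂ) (S m : ℝ) (f : (Fin n → ℝ) → ℂ) (x : Fin n → ℝ) (t : ℝ) :
    siteU α β v [] S m f x t =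
      f x * (reflConst α β v * reflMoment α β v (Real.exp (-t) + S) m) := by
  rw [← opK_act_eq_reflMoment α β v x S t m]
  change (opK α β v).act (fun x t => (Real.exp (-(S * Real.exp (-t))) : ℂ) *
    Real.exp (-m * t) * f x) x t = _
  unfold IntOp.act
  rw [← integral_const_mul]
  congr 1
  funext y
  simp only [opK_apply]
  ring

theorem siteU_cons {α β : ℝ} (hβ : 0 < β) {v : ℂ} (hv : -g α β < v.im)
    {l : List (Fin n)} {j : Fin n} (hj : j ∉ l) {f : (Fin n → ℝ) → ℂ} (hf : ExpGrowth f)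
    (x : Fin n → ℝ) (t S m : ℝ) : siteU α β v (j :: l) S m f x t =
      siteIntegral v (x j) (Real.exp (-t) + S) m (layer α β v l j x 0 f) :=
  actProd_siteFactors_cons hβ hv hj hf x t S m

/-- The layer belongs to the same family as the full operator, with `S = e^{-y}` and `t = x_j`, so
that `σ` becomes `e^{-x_j} + e^{-y}`. This closes the induction. -/
theorem layer_eq_siteU (α β : ℝ) (v : ℂ) {l : List (Fin n)} {j : Fin n} (hj : j ∉ l)
    (f : (Fin n → ℝ) → ℂ) (x : Fin n → ℝ) (m y : ℝ) : layer α β v l j x m f y =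
      siteU α β v l (Real.exp (-y)) m f (Function.update x j y) (x j) := by
  unfold siteU layer
  rw [actProd_update (localAway_of_mem_siteFactors α β v hj)]
  congr 1
  funext x' t'
  unfold layerFun
  rw [sub_eq_add_neg (-y), Real.exp_add (-y)]

theorem siteMatrix_cons_zero (α β : ℝ) (u : ℂ) (j : Fin n) (l : List (Fin n)) (b : Fin 2)
    (φ : Smooth n) : (siteMatrix α β u (j :: l) 0 b φ : (Fin n → ℝ) → ℂ) = fun x =>
      (u * ((siteMatrix α β u l * reflectedLax u j) 0 b φ : (Fin n → ℝ) → ℂ) x +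
        Complex.I * (pd j ((siteMatrix α β u l * reflectedLax u j) 0 b φ) : (Fin n → ℝ) → ℂ) x) +
        (Real.exp (-1 * x j) : ℂ) *
          ((siteMatrix α β u l * reflectedLax u j) 1 b φ : (Fin n → ℝ) → ℂ) x := by
  rw [siteMatrix, mul_assoc, Matrix.mul_apply, Fin.sum_univ_two]
  rfl

theorem siteMatrix_cons_one (α β : ℝ) (u : ℂ) (j : Fin n) (l : List (Fin n)) (b : Fin 2)
    (φ : Smooth n) : (siteMatrix α β u (j :: l) 1 b φ : (Fin n → ℝ) → ℂ) = fun x =>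
      -(Real.exp (1 * x j) : ℂ) *
        ((siteMatrix α β u l * reflectedLax u j) 0 b φ : (Fin n → ℝ) → ℂ) x := by
  rw [siteMatrix, mul_assoc, Matrix.mul_apply, Fin.sum_univ_two]
  funext x
  change -((Real.exp (1 * x j) : ℂ) * _) + 0 = -(Real.exp (1 * x j) : ℂ) * _
  rw [add_zero, neg_mul]

theorem intertwining_nil {α β : ℝ} (hβ : 0 < β) {u : ℂ} (hu : 1 - g α β < u.im)
    (φ : Smooth n) {S : ℝ} (hS : 0 ≤ S) (x : Fin n → ℝ) (t : ℝ) (b : Fin 2) :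
    Complex.I * (Real.exp (-t) + S : ℝ) *
        siteU α β u [] S 1 (siteMatrix α β u [] 0 b φ : Smooth n) x t -
      2 * u * siteU α β u [] S 0 (siteMatrix α β u [] 0 b φ : Smooth n) x t -
      (Real.exp (-t) + S : ℝ) * siteU α β u [] S 0 (siteMatrix α β u [] 1 b φ : Smooth n) x t =
    -(β * (g α β + Complex.I * u)) *
      ![Complex.I * siteU α β (u - Complex.I) [] S 1 φ x t,
        -siteU α β (u - Complex.I) [] S 0 φ x t] b := by
  have hσ : 0 < Real.exp (-t) + S := by positivity
  have r0 := reflMoment_relation_zero hβ hu hσ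
  have r1 := reflMoment_relation_neg_one hβ hu hσ
  have hg := beta_mul_g α hβ
  have hK : ∀ a b : Fin 2, ((siteMatrix α β u [] a b φ : Smooth n) : (Fin n → ℝ) → ℂ) x =
      boundaryK α β u a b * (φ : (Fin n → ℝ) → ℂ) x := fun a b => rfl
  simp only [siteU_nil, hK, reflConst_sub_I hβ hu]
  generalize reflMoment α β u (Real.exp (-t) + S) 0 = I₀ at *
  generalize reflMoment α β u (Real.exp (-t) + S) 1 = I₁ at *
  generalize reflMoment α β (u - Complex.I) (Real.exp (-t) + S) 0 = J₀ at *
  generalize reflMoment α β (u - Complex.I) (Real.exp (-t) + S) 1 = J₁ at *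
  generalize ((Real.exp (-t) + S : ℝ) : ℂ) = σ at *
  generalize (φ : (Fin n → ℝ) → ℂ) x = F at *
  generalize reflConst α β u = c at *
  have hI := Complex.I_mul_I
  -- The right side is `det K(u)`.
  have hdet : (β : ℂ) ^ 2 * (g α β + Complex.I * u) * (g α β - 1 - Complex.I * u) =
      α ^ 2 + β ^ 2 * (u - Complex.I / 2) ^ 2 := by
    linear_combination (β * g α β + α - β / 2) * hg - β ^ 2 * (u ^ 2 + 1 / 4) * hI
  -- In both columns the two moment relations eliminate `σ I₁` and `σ I₀`. The terms in `I₀` cancel,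
  -- and so do those in one of `J₀`, `J₁`; the other one acquires the coefficient `det K(u)`.
  revert b
  rw [Fin.forall_fin_two]
  constructor
  · simp only [boundaryK, Matrix.of_apply, Matrix.cons_val', Matrix.cons_val_zero,
      Matrix.cons_val_one, Matrix.cons_val_fin_one]
    linear_combination (-α * Complex.I * c * F) * r0 + (β ^ 2 * (u - Complex.I / 2) * c * F) * r1 +
      2 * Complex.I * c * F * J₁ * hdet + c * F * (2 * α * u * I₀ + 2 * α * β ^ 2 * u * J₀ -
        β ^ 2 * (u - Complex.I / 2) * J₁) * hI
  · simp only [boundaryK, Matrix.of_apply, Matrix.cons_val', Matrix.cons_val_zero,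
      Matrix.cons_val_one, Matrix.cons_val_fin_one]
    linear_combination (Complex.I * (u - Complex.I / 2) * c * F) * r0 + (α * c * F) * r1 -
      2 * c * F * J₀ * hdet + c * F * (-2 * u * (u - Complex.I / 2) * I₀ - α * J₁ -
        2 * (u - Complex.I / 2) ^ 2 * β ^ 2 * J₀ -
        Complex.I * (u - Complex.I / 2) * β ^ 2 * J₀) * hI

theorem intertwining_cons {α β : ℝ} (hβ : 0 < β) {u : ℂ} (hu : 1 - g α β < u.im)
    {j : Fin n} {l : List (Fin n)} (hj : j ∉ l)
    (ih : ∀ φ ∈ derivClosure (expGrowthSpace n), ∀ S : ℝ, 0 ≤ S → ∀ x t, ∀ b : Fin 2,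
      Complex.I * (Real.exp (-t) + S : ℝ) *
          siteU α β u l S 1 (siteMatrix α β u l 0 b φ : Smooth n) x t -
        2 * u * siteU α β u l S 0 (siteMatrix α β u l 0 b φ : Smooth n) x t -
        (Real.exp (-t) + S : ℝ) * siteU α β u l S 0 (siteMatrix α β u l 1 b φ : Smooth n) x t =
      -(β * (g α β + Complex.I * u)) *
        ![Complex.I * siteU α β (u - Complex.I) l S 1 φ x t,
          -siteU α β (u - Complex.I) l S 0 φ x t] b)
    {φ : Smooth n} (hφ : φ ∈ derivClosure (expGrowthSpace n)) {S : ℝ} (hS : 0 ≤ S)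
    (x : Fin n → ℝ) (t : ℝ) (b : Fin 2) :
    Complex.I * (Real.exp (-t) + S : ℝ) *
        siteU α β u (j :: l) S 1 (siteMatrix α β u (j :: l) 0 b φ : Smooth n) x t -
      2 * u * siteU α β u (j :: l) S 0 (siteMatrix α β u (j :: l) 0 b φ : Smooth n) x t -
      (Real.exp (-t) + S : ℝ) *
        siteU α β u (j :: l) S 0 (siteMatrix α β u (j :: l) 1 b φ : Smooth n) x t =
    -(β * (g α β + Complex.I * u)) *
      ![Complex.I * siteU α β (u - Complex.I) (j :: l) S 1 φ x t,
        -siteU α β (u - Complex.I) (j :: l) S 0 φ x t] b := by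
  have hσ : 0 < Real.exp (-t) + S := by positivity
  have hv : -g α β < u.im := by linarith
  have hv' : -g α β < (u - Complex.I).im := by simp; linarith
  have hW := preserves_siteMatrix_expGrowth (n := n) α β u
  have hR := preserves_reflectedLax_expGrowth (n := n) u j
  set G : Fin 2 → Smooth n := fun a => (siteMatrix α β u l * reflectedLax u j) a b φ with hG
  have hGm : ∀ a, G a ∈ derivClosure (expGrowthSpace n) := fun a => (hW l).mul hR a b φ hφ
  have e0 := expGrowth_of_mem (hGm 0)
  have e1 := expGrowth_of_mem (hGm 1)
  have e0' := expGrowth_of_mem (pd_mem_derivClosure (hGm 0) j)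
  have rl := fun m {f : (Fin n → ℝ) → ℂ} (hf : ExpGrowth f) =>
    hf.rapidlyDecaying_layer hβ hv l j x m
  have egU : ∀ a, ExpGrowth
      ((siteMatrix α β u (j :: l) a b φ : Smooth n) : (Fin n → ℝ) → ℂ) := fun a =>
    expGrowth_of_mem (hW (j :: l) a b φ hφ)
  rw [siteU_cons hβ hv hj (egU 0), siteU_cons hβ hv hj (egU 0), siteU_cons hβ hv hj (egU 1)]
  -- First row of `L_j`. The layer of `∂_j` is written as the derivative of the layer minus its
  -- cutoff term, the form that the local relation expects.
  have L0 : layer α β u l j x 0 (siteMatrix α β u (j :: l) 0 b φ : Smooth n) = fun y =>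
      u * layer α β u l j x 0 (G 0) y + Complex.I *
        ((layer α β u l j x 0 (pd j (G 0)) y + Real.exp (-y) * layer α β u l j x 1 (G 0) y) -
          Real.exp (-y) * layer α β u l j x 1 (G 0) y) +
        Real.exp (-y) * layer α β u l j x 0 (G 1) y := by
    rw [siteMatrix_cons_zero]
    funext y
    have c0 := expGrowth_of_mem ((derivClosure (expGrowthSpace n)).smul_mem u (hGm 0))
    have c1 := expGrowth_of_mem ((derivClosure (expGrowthSpace n)).smul_mem Complex.I
      (pd_mem_derivClosure (hGm 0) j))
    have c2 : ExpGrowth fun x => (Real.exp (-1 * x j) : ℂ) * (G 1 : (Fin n → ℝ) → ℂ) x :=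
      expGrowth_of_mem (mulExp_mem_derivClosure
        (fun _ hf => exp_mul_mem_expGrowthSpace (-1) j hf) (hGm 1))
    have c3 := expGrowth_of_mem ((derivClosure (expGrowthSpace n)).add_mem
      ((derivClosure (expGrowthSpace n)).smul_mem u (hGm 0))
      ((derivClosure (expGrowthSpace n)).smul_mem Complex.I (pd_mem_derivClosure (hGm 0) j)))
    refine (layer_add hβ hv l j x 0 c3 c2 y).trans ?_
    rw [layer_mul hβ hv l j x 0 (G 1) (fun y => (Real.exp (-1 * y) : ℂ)) y, neg_one_mul]
    refine (congrArg (· + _) (layer_add hβ hv l j x 0 c0 c1 y)).trans ?_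
    have d0 := layer_mul hβ hv l j x 0 (G 0) (fun _ => u) y
    have d1 := layer_mul hβ hv l j x 0 (pd j (G 0)) (fun _ => Complex.I) y
    rw [show layer α β u l j x 0 (u • G 0 : Smooth n) y = _ from d0,
      show layer α β u l j x 0 (Complex.I • pd j (G 0) : Smooth n) y = _ from d1]
    ring
  have L1 : layer α β u l j x 0 (siteMatrix α β u (j :: l) 1 b φ : Smooth n) = fun y =>
      -(Real.exp y * layer α β u l j x 0 (G 0) y) := by
    rw [siteMatrix_cons_one]
    funext y
    have := layer_mul hβ hv l j x 0 (G 0) (fun y => -(Real.exp (1 * y) : ℂ)) y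
    rw [one_mul, neg_mul] at this
    exact this
  have hd := fun y => hasDerivAt_layer hβ hv l j x e0 e0' y
  have R0' : RapidlyDecaying fun y => layer α β u l j x 0 (pd j (G 0)) y +
      Real.exp (-y) * layer α β u l j x 1 (G 0) y := by
    have := (rl 1 e0).exp_mul (-1)
    simp only [neg_one_mul] at this
    exact (rl 0 e0').add this
  rw [L0, L1, siteIntegral_intertwining u (x j) hσ (rl 0 e0) R0' (rl 0 e1) (rl 1 e0) hd]
  -- The integrand is the left side of the induction hypothesis at `S = e^{-y}`, `t = x_j`, summed
  -- over its two columns against column `b` of `reflectedLax u j`.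
  have hB : (fun y => Complex.I * (Real.exp (-x j) + Real.exp (-y) : ℝ) *
        layer α β u l j x 1 (G 0) y - 2 * u * layer α β u l j x 0 (G 0) y -
        (Real.exp (-x j) + Real.exp (-y) : ℝ) * layer α β u l j x 0 (G 1) y) = fun y =>
      -(β * (g α β + Complex.I * u)) * (Complex.I * layer α β (u - Complex.I) l j x 1
        (reflectedLax u j 0 b φ : Smooth n) y - layer α β (u - Complex.I) l j x 0
        (reflectedLax u j 1 b φ : Smooth n) y) := by
    funext y
    have hG' : ∀ a m, layer α β u l j x m (G a) y =
        layer α β u l j x m (siteMatrix α β u l a 0 (reflectedLax u j 0 b φ) : Smooth n) y +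
        layer α β u l j x m (siteMatrix α β u l a 1 (reflectedLax u j 1 b φ) : Smooth n) y := by
      intro a m
      have : G a = siteMatrix α β u l a 0 (reflectedLax u j 0 b φ) +
          siteMatrix α β u l a 1 (reflectedLax u j 1 b φ) := by
        simp only [hG, Matrix.mul_apply, Fin.sum_univ_two]
        rfl
      rw [this]
      exact layer_add hβ hv l j x m (expGrowth_of_mem (hW l a 0 _ (hR 0 b φ hφ)))
        (expGrowth_of_mem (hW l a 1 _ (hR 1 b φ hφ))) y
    have i0 := ih _ (hR 0 b φ hφ) _ (Real.exp_pos (-y)).le (Function.update x j y) (x j) 0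
    have i1 := ih _ (hR 1 b φ hφ) _ (Real.exp_pos (-y)).le (Function.update x j y) (x j) 1
    simp only [hG', layer_eq_siteU _ _ _ hj]
    simp only [Matrix.cons_val_zero, Matrix.cons_val_one] at i0 i1
    linear_combination i0 + i1
  rw [hB, siteIntegral_const_mul]
  have eφ := expGrowth_of_mem hφ
  have eφ' := expGrowth_of_mem (pd_mem_derivClosure hφ j)
  rw [siteU_cons hβ hv' hj eφ, siteU_cons hβ hv' hj eφ]
  simp only [siteIntegral_sub_I]
  have rl' := fun m {f : (Fin n → ℝ) → ℂ} (hf : ExpGrowth f) =>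
    hf.rapidlyDecaying_layer hβ hv' l j x m
  have hz : b = 0 ∨ b = 1 := by fin_cases b <;> simp
  clear hB L1 L0 egU rl hd R0' e0' e1 e0 hGm
  clear_value G
  -- The first column of the reflected matrix is `(0, e^{x_j})`: only `e^y` remains, and
  -- `siteIntegral_sub_I` reads it as the shifted integral with `m = 1`. The second column contains
  -- `∂_j`; one more inner integration by parts lowers `m` to `-2`, which is the shifted integral
  -- with `m = 0`.
  rcases hz with rfl | rfl
  · have h0 : ∀ y, layer α β (u - Complex.I) l j x 1 (reflectedLax u j 0 0 φ : Smooth n) y = 0 :=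
      fun y => by
        have := layer_mul hβ hv' l j x 1 0 (fun _ => 0) y
        simp only [zero_mul] at this
        exact this
    have h1 : ∀ y, layer α β (u - Complex.I) l j x 0 (reflectedLax u j 1 0 φ : Smooth n) y =
        Real.exp y * layer α β (u - Complex.I) l j x 0 φ y := fun y => by
      have := layer_mul hβ hv' l j x 0 φ (fun y => (Real.exp (1 * y) : ℂ)) y
      rw [one_mul] at this
      exact this
    have h2 : (fun y => Complex.I * layer α β (u - Complex.I) l j x 1
        (reflectedLax u j 0 0 φ : Smooth n) y - layer α β (u - Complex.I) l j x 0
        (reflectedLax u j 1 0 φ : Smooth n) y) = fun y =>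
        -1 * (Real.exp y * layer α β (u - Complex.I) l j x 0 φ y) := by
      funext y
      rw [h0, h1]
      ring
    rw [h2, siteIntegral_const_mul, show (1 : ℝ) - 2 = -1 by norm_num]
    simp only [Matrix.cons_val_zero]
    ring
  · have h0 : ∀ y, layer α β (u - Complex.I) l j x 1 (reflectedLax u j 0 1 φ : Smooth n) y =
        -(Real.exp (-y) * layer α β (u - Complex.I) l j x 1 φ y) := fun y => by
      have := layer_mul hβ hv' l j x 1 φ (fun y => -(Real.exp (-1 * y) : ℂ)) y
      simp only [neg_mul, one_mul] at this
      rw [← this]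
      congr 1
      funext x
      change -((Real.exp (-1 * x j) : ℂ) * _) = _
      rw [neg_one_mul]
    have h1 : ∀ y, layer α β (u - Complex.I) l j x 0 (reflectedLax u j 1 1 φ : Smooth n) y =
        -u * layer α β (u - Complex.I) l j x 0 φ y +
          Complex.I * layer α β (u - Complex.I) l j x 0 (pd j φ) y := fun y => by
      have c0 := expGrowth_of_mem ((derivClosure (expGrowthSpace n)).smul_mem (-u) hφ)
      have c1 := expGrowth_of_mem ((derivClosure (expGrowthSpace n)).smul_mem Complex.I
        (pd_mem_derivClosure hφ j))
      refine (layer_add hβ hv' l j x 0 c0 c1 y).trans ?_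
      have d0 := layer_mul hβ hv' l j x 0 φ (fun _ => -u) y
      have d1 := layer_mul hβ hv' l j x 0 (pd j φ) (fun _ => Complex.I) y
      rw [show layer α β (u - Complex.I) l j x 0 (-u • φ : Smooth n) y = _ from d0,
        show layer α β (u - Complex.I) l j x 0 (Complex.I • pd j φ : Smooth n) y = _ from d1]
    have h2 : (fun y => Complex.I * layer α β (u - Complex.I) l j x 1
        (reflectedLax u j 0 1 φ : Smooth n) y - layer α β (u - Complex.I) l j x 0
        (reflectedLax u j 1 1 φ : Smooth n) y) = fun y => -Complex.I *
        (Complex.I * u * layer α β (u - Complex.I) l j x 0 φ y +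
          (layer α β (u - Complex.I) l j x 0 (pd j φ) y +
            Real.exp (-y) * layer α β (u - Complex.I) l j x 1 φ y)) := by
      funext y
      rw [h0, h1]
      linear_combination (-u * layer α β (u - Complex.I) l j x 0 φ y) * -Complex.I_mul_I
    have R' : RapidlyDecaying fun y => layer α β (u - Complex.I) l j x 0 (pd j φ) y +
        Real.exp (-y) * layer α β (u - Complex.I) l j x 1 φ y := by
      have := (rl' 1 eφ).exp_mul (-1)
      simp only [neg_one_mul] at this
      exact (rl' 0 eφ').add this
    rw [h2, siteIntegral_const_mul, siteIntegral_deriv u (x j) (rl' 0 eφ) R'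
      (fun y => hasDerivAt_layer hβ hv' l j x eφ eφ' y),
      show (0 : ℝ) - 2 = -1 - 1 by norm_num]
    simp only [Matrix.cons_val_one, Matrix.cons_val_fin_one]
    linear_combination (-(β * (g α β + Complex.I * u)) * Real.exp (x j) *
      siteIntegral u (x j) (Real.exp (-t) + S) (-1 - 1)
        fun y => Real.exp y * layer α β (u - Complex.I) l j x 0 φ y) * Complex.I_mul_I

/-- The intertwining relation between the monodromy matrix and the monodromy operators. -/
theorem intertwining {α β : ℝ} (hβ : 0 < β) {u : ℂ} (hu : 1 - g α β < u.im)
    {l : List (Fin n)} (hl : l.Nodup) {φ : Smooth n} (hφ : φ ∈ derivClosure (expGrowthSpace n))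
    {S : ℝ} (hS : 0 ≤ S) (x : Fin n → ℝ) (t : ℝ) (b : Fin 2) :
    Complex.I * (Real.exp (-t) + S : ℝ) *
        siteU α β u l S 1 (siteMatrix α β u l 0 b φ : Smooth n) x t -
      2 * u * siteU α β u l S 0 (siteMatrix α β u l 0 b φ : Smooth n) x t -
      (Real.exp (-t) + S : ℝ) * siteU α β u l S 0 (siteMatrix α β u l 1 b φ : Smooth n) x t =
    -(β * (g α β + Complex.I * u)) *
      ![Complex.I * siteU α β (u - Complex.I) l S 1 φ x t,
        -siteU α β (u - Complex.I) l S 0 φ x t] b := by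
  induction l generalizing φ S x t b with
  | nil => exact intertwining_nil hβ hu φ hS x t b
  | cons j l ih =>
    rw [List.nodup_cons] at hl
    exact intertwining_cons hβ hu hl.1 (fun φ hφ S hS x t b => ih hl.2 hφ hS x t b) hφ hS x t b

end BCToda

namespace BCToda
open scoped Matrix ContDiff Topology
open MeasureTheory Filter

variable {n : ℕ}

/-! ### The spaces of tempered functions -/

/-- Polynomial growth at `+∞` and exponential growth at `-∞`. -/
noncomputable def halfGrowth (b : ℝ) (N : ℕ) (s : ℝ) : ℝ :=
  if 0 ≤ s then (1 + s) ^ N else Real.exp (b * |s|)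

theorem halfGrowth_nonneg (b : ℝ) (N : ℕ) (s : ℝ) : 0 ≤ halfGrowth b N s := by
  unfold halfGrowth
  split_ifs <;> positivity

theorem halfGrowth_mono {b b' : ℝ} {N N' : ℕ} (hb : b ≤ b') (hN : N ≤ N') (s : ℝ) :
    halfGrowth b N s ≤ halfGrowth b' N' s := by
  unfold halfGrowth
  split_ifs with h
  · exact pow_le_pow_right₀ (by linarith) hN
  · gcongr

theorem halfGrowth_le_exp {b : ℝ} (hb : 0 ≤ b) (N : ℕ) (s : ℝ) :
    halfGrowth b N s ≤ Real.exp ((b + N) * |s|) := by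
  unfold halfGrowth
  split_ifs with h
  · calc (1 + s) ^ N ≤ Real.exp s ^ N := by
          gcongr
          linarith [Real.add_one_le_exp s]
      _ = Real.exp (N * s) := (Real.exp_nat_mul s N).symm
      _ ≤ _ := by
        rw [abs_of_nonneg h]
        gcongr
        linarith
  · gcongr
    linarith [Nat.cast_nonneg (α := ℝ) N]

theorem exp_neg_mul_halfGrowth_le (b : ℝ) (N : ℕ) (s : ℝ) :
    Real.exp (-1 * s) * halfGrowth b N s ≤ halfGrowth (b + 1) N s := by
  unfold halfGrowth
  split_ifs with h
  · exact mul_le_of_le_one_left (by positivity) (Real.exp_le_one_iff.2 (by linarith))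
  · rw [← Real.exp_add, abs_of_neg (not_le.1 h)]
    gcongr
    linarith

theorem exists_pow_le_exp {ε : ℝ} (hε : 0 < ε) (N : ℕ) :
    ∃ C : ℝ, 0 ≤ C ∧ ∀ s, 0 ≤ s → (1 + s) ^ N ≤ C * Real.exp (ε * s) := by
  obtain ⟨a, ha, haN⟩ : ∃ a : ℝ, 0 < a ∧ N * a ≤ ε := by
    -- Dividing by `N + 1` keeps the rate meaningful for `N = 0`.
    refine ⟨ε / (N + 1), by positivity, ?_⟩
    rw [mul_div_assoc', div_le_iff₀ (by positivity)]
    nlinarith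
  refine ⟨(1 + 1 / a) ^ N, by positivity, fun s hs => ?_⟩
  calc (1 + s) ^ N ≤ ((1 + 1 / a) * Real.exp (a * s)) ^ N := by
        gcongr
        calc 1 + s ≤ (1 + 1 / a) * (a * s + 1) := by
              have : (1 + 1 / a) * (a * s + 1) = 1 + s + (a * s + 1 / a) := by field_simp; ring
              rw [this]
              have : 0 ≤ a * s + 1 / a := by positivity
              linarith
          _ ≤ _ := by gcongr; exact Real.add_one_le_exp _
    _ = (1 + 1 / a) ^ N * Real.exp (N * a * s) := by
      rw [mul_pow, ← Real.exp_nat_mul, mul_assoc (N : ℝ)]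
    _ ≤ _ := by gcongr

/-- Functions of at most exponential growth, and of at most polynomial growth as `x_j → +∞`. -/
noncomputable def temperedGrowth (j : Fin n) : Submodule ℂ ((Fin n → ℝ) → ℂ) where
  carrier := {f | ∃ C b : ℝ, ∃ N : ℕ, 0 ≤ C ∧ 0 ≤ b ∧ ∀ x, ‖f x‖ ≤
    C * Real.exp (b * ∑ i ∈ Finset.univ.erase j, |x i|) * halfGrowth b N (x j)}
  add_mem' := by
    rintro f f' ⟨C, b, N, hC, hb, h⟩ ⟨C', b', N', hC', hb', h'⟩
    refine ⟨C + C', max b b', max N N', by positivity, le_max_of_le_left hb, fun x => ?_⟩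
    rw [Pi.add_apply, add_mul, add_mul]
    refine (norm_add_le _ _).trans (add_le_add ((h x).trans ?_) ((h' x).trans ?_))
    · gcongr
      · exact halfGrowth_nonneg _ _ _
      · exact le_max_left _ _
      · exact halfGrowth_mono (le_max_left _ _) (le_max_left _ _) _
    · gcongr
      · exact halfGrowth_nonneg _ _ _
      · exact le_max_right _ _
      · exact halfGrowth_mono (le_max_right _ _) (le_max_right _ _) _
  zero_mem' := ⟨0, 0, 0, le_rfl, le_rfl, fun x => by simp⟩
  smul_mem' := by
    rintro c f ⟨C, b, N, hC, hb, h⟩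
    refine ⟨‖c‖ * C, b, N, by positivity, hb, fun x => ?_⟩
    rw [Pi.smul_apply, norm_smul, mul_assoc, mul_assoc, ← mul_assoc C]
    gcongr
    exact h x

theorem exp_mul_mem_temperedGrowth (c : ℝ) {i j : Fin n} (hij : i ≠ j) {f : (Fin n → ℝ) → ℂ}
    (hf : f ∈ temperedGrowth j) :
    (fun x => (Real.exp (c * x i) : ℂ) * f x) ∈ temperedGrowth j := by
  obtain ⟨C, b, N, hC, hb, hf⟩ := hf
  refine ⟨C, b + |c|, N, hC, by positivity, fun x => ?_⟩
  rw [norm_mul, Complex.norm_real, Real.norm_eq_abs, Real.abs_exp]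
  calc _ ≤ Real.exp (|c| * ∑ i ∈ Finset.univ.erase j, |x i|) *
        (C * Real.exp (b * ∑ i ∈ Finset.univ.erase j, |x i|) * halfGrowth (b + |c|) N (x j)) := by
        gcongr ?_ * ?_
        · rw [Real.exp_le_exp]
          calc c * x i ≤ |c * x i| := le_abs_self _
            _ = |c| * |x i| := abs_mul _ _
            _ ≤ _ := by
              gcongr
              exact Finset.single_le_sum (f := fun i => |x i|) (fun i _ => abs_nonneg _)
                (Finset.mem_erase.2 ⟨hij, Finset.mem_univ i⟩)
        · refine (hf x).trans ?_
          gcongr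
          exact halfGrowth_mono (by linarith [abs_nonneg c]) le_rfl _
    _ = _ := by rw [add_mul, Real.exp_add]; ring

/-- The condition is asymmetric in `x_j`: `e^{-x_j}` is bounded at `+∞` and merely exponential at
`-∞`. The factor `e^{x_j}` would destroy the polynomial growth. -/
theorem exp_neg_mul_mem_temperedGrowth {j : Fin n} {f : (Fin n → ℝ) → ℂ}
    (hf : f ∈ temperedGrowth j) :
    (fun x => (Real.exp (-1 * x j) : ℂ) * f x) ∈ temperedGrowth j := by
  obtain ⟨C, b, N, hC, hb, hf⟩ := hf
  refine ⟨C, b + 1, N, hC, by positivity, fun x => ?_⟩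
  rw [norm_mul, Complex.norm_real, Real.norm_eq_abs, Real.abs_exp]
  calc _ ≤ Real.exp (-1 * x j) *
        (C * Real.exp (b * ∑ i ∈ Finset.univ.erase j, |x i|) * halfGrowth b N (x j)) := by
        gcongr
        exact hf x
    _ = C * Real.exp (b * ∑ i ∈ Finset.univ.erase j, |x i|) *
        (Real.exp (-1 * x j) * halfGrowth b N (x j)) := by ring
    _ ≤ _ := by
      have h := halfGrowth_nonneg b N (x j)
      gcongr
      · linarith
      · exact exp_neg_mul_halfGrowth_le _ _ _

theorem temperedGrowth_le_expGrowthSpace (j : Fin n) : temperedGrowth j ≤ expGrowthSpace n := by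
  rintro f ⟨C, b, N, hC, hb, hf⟩
  refine ⟨C, b + N, hC, by positivity, fun x => (hf x).trans ?_⟩
  rw [mul_assoc, ← Finset.add_sum_erase _ (fun i => |x i|) (Finset.mem_univ j), add_comm (|x j|),
    mul_add, Real.exp_add]
  have h := halfGrowth_nonneg b N (x j)
  gcongr
  · linarith [Nat.cast_nonneg (α := ℝ) N]
  · exact halfGrowth_le_exp hb N _

theorem derivClosure_mono {G G' : Submodule ℂ ((Fin n → ℝ) → ℂ)} (h : G ≤ G') :
    derivClosure G ≤ derivClosure G' :=
  fun _ hφ l => h (hφ l)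

theorem exists_eval_le (P : Polynomial ℝ) : ∃ C : ℝ, 1 ≤ C ∧ ∀ s, 0 ≤ s →
    P.eval s ≤ C * (1 + s) ^ P.natDegree := by
  -- The summand `1` gives `1 ≤ C`, needed on the half line `x_j < 0`, where the polynomial plays no
  -- role.
  refine ⟨1 + ∑ i ∈ Finset.range (P.natDegree + 1), |P.coeff i|, ?_, fun s hs => ?_⟩
  · have : 0 ≤ ∑ i ∈ Finset.range (P.natDegree + 1), |P.coeff i| := by positivity
    linarith
  calc P.eval s = ∑ i ∈ Finset.range (P.natDegree + 1), P.coeff i * s ^ i :=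
        Polynomial.eval_eq_sum_range s
    _ ≤ ∑ i ∈ Finset.range (P.natDegree + 1), |P.coeff i| * (1 + s) ^ P.natDegree := by
      refine Finset.sum_le_sum fun i hi => ?_
      have : s ^ i ≤ (1 + s) ^ P.natDegree :=
        (pow_le_pow_left₀ hs (by linarith) i).trans
          (pow_le_pow_right₀ (by linarith) (Nat.lt_succ_iff.1 (Finset.mem_range.1 hi)))
      gcongr
      exact le_abs_self _
    _ = (∑ i ∈ Finset.range (P.natDegree + 1), |P.coeff i|) * (1 + s) ^ P.natDegree :=
      (Finset.sum_mul ..).symm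
    _ ≤ _ := by
      gcongr
      linarith

theorem mem_temperedSpace_iff {j : Fin n} {φ : Smooth n} :
    φ ∈ temperedSpace j ↔ φ ∈ derivClosure (temperedGrowth j) := by
  rw [mem_derivClosure_iff]
  refine forall_congr' fun k => ⟨?_, ?_⟩
  · rintro ⟨a, b, ha, hb, P, h⟩
    obtain ⟨C, hC, hP⟩ := exists_eval_le P
    refine ⟨a * C, b, P.natDegree, by positivity, hb, fun x => (h x).trans ?_⟩
    rw [mul_right_comm a C, mul_assoc _ C]
    gcongr
    unfold halfGrowth
    split_ifs with hx
    · exact hP _ hx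
    · exact le_mul_of_one_le_left (Real.exp_pos _).le hC
  · rintro ⟨C, b, N, hC, hb, h⟩
    refine ⟨C, b, hC, hb, (1 + Polynomial.X) ^ N, fun x => (h x).trans_eq ?_⟩
    simp [halfGrowth]

theorem preserves_siteMatrix_tempered {j : Fin n} {l : List (Fin n)} (hj : j ∉ l) (α β : ℝ)
    (u : ℂ) : Preserves (derivClosure (temperedGrowth j)) (siteMatrix α β u l) :=
  have h : ∀ c : ℝ, ∀ i ∈ l, ∀ φ ∈ derivClosure (temperedGrowth j),
      mulExp c i φ ∈ derivClosure (temperedGrowth j) := fun c _ hi _ hφ =>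
    mulExp_mem_derivClosure
      (fun _ => exp_mul_mem_temperedGrowth c (ne_of_mem_of_not_mem hi hj)) hφ
  preserves_siteMatrix (fun i _ _ hφ => pd_mem_derivClosure hφ i) (h 1) (h (-1)) α β u

/-- Only the second column is used: it contains `e^{-x_j}` and `∂_j` but not `e^{x_j}`. The inner
sites multiply only by exponentials of other coordinates. -/
theorem siteMatrix_mul_reflectedLax_mem {j : Fin n} {l : List (Fin n)} (hj : j ∉ l) (α β : ℝ)
    (u : ℂ) {φ : Smooth n} (hφ : φ ∈ derivClosure (temperedGrowth j)) (a : Fin 2) :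
    (siteMatrix α β u l * reflectedLax u j) a 1 φ ∈ derivClosure (temperedGrowth j) := by
  rw [Matrix.mul_apply, Fin.sum_univ_two]
  refine Submodule.add_mem _ (preserves_siteMatrix_tempered hj α β u a 0 _ ?_)
    (preserves_siteMatrix_tempered hj α β u a 1 _ ?_)
  · exact Submodule.neg_mem _
      (mulExp_mem_derivClosure (fun _ => exp_neg_mul_mem_temperedGrowth) hφ)
  · exact Submodule.add_mem _ (Submodule.smul_mem _ (-u) hφ)
      (Submodule.smul_mem _ Complex.I (pd_mem_derivClosure hφ j))

theorem siteMatrix_cons_mem {j : Fin n} {l : List (Fin n)} (hj : j ∉ l) (α β : ℝ)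
    (u : ℂ) {φ : Smooth n} (hφ : φ ∈ derivClosure (temperedGrowth j)) :
    siteMatrix α β u (j :: l) 0 1 φ ∈ derivClosure (temperedGrowth j) := by
  have h := siteMatrix_mul_reflectedLax_mem hj α β u hφ
  rw [siteMatrix, mul_assoc, Matrix.mul_apply, Fin.sum_univ_two]
  exact Submodule.add_mem _ (Submodule.add_mem _ (Submodule.smul_mem _ u (h 0))
      (Submodule.smul_mem _ Complex.I (pd_mem_derivClosure (h 0) j)))
    (mulExp_mem_derivClosure (fun _ => exp_neg_mul_mem_temperedGrowth) (h 1))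

end BCToda

namespace BCToda
open scoped Matrix ContDiff Topology
open MeasureTheory Filter

variable {n : ℕ}

/-! ### The limit of the auxiliary coordinate -/

/-- As `s → -∞` the phase decays at rate `-Im v ≥ c + ε`, and as `s → +∞` doubly exponentially. -/
theorem exists_norm_phase_mul_exp_le (v : ℂ) {ε c : ℝ} (hε : 0 ≤ ε) (hc : 0 ≤ c)
    (h : c + ε ≤ -v.im) : ∃ C : ℝ, 0 ≤ C ∧ ∀ s,
      ‖phase v s‖ * Real.exp (ε * |s|) ≤ C * Real.exp (-(c * |s|)) := by
  obtain ⟨C, hC, hC'⟩ := exists_exp_neg_exp_le (-v.im + ε + c)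
  refine ⟨C, by linarith, fun s => ?_⟩
  rw [norm_phase, sub_eq_add_neg, Real.exp_add]
  rcases le_or_gt 0 s with hs | hs
  · rw [abs_of_nonneg hs]
    calc _ ≤ Real.exp (-v.im * s) * (C * Real.exp (-((-v.im + ε + c) * s))) *
          Real.exp (ε * s) := by
          gcongr
          exact hC' _ (by linarith) le_rfl s
      _ = C * Real.exp (-v.im * s + -((-v.im + ε + c) * s) + ε * s) := by
        simp only [Real.exp_add]; ring
      _ = _ := by ring_nf
  · rw [abs_of_neg hs]
    calc _ ≤ Real.exp (-v.im * s) * 1 * Real.exp (ε * -s) := by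
          gcongr
          exact Real.exp_le_one_iff.2 (neg_nonpos.2 (Real.exp_pos _).le)
      _ = 1 * Real.exp (-v.im * s + ε * -s) := by rw [Real.exp_add]; ring
      _ ≤ C * Real.exp (-(c * -s)) := by
        gcongr
        nlinarith

theorem integrable_exp_neg_mul_abs_sub {c : ℝ} (hc : 0 < c) (x : ℝ) :
    Integrable fun w : ℝ => Real.exp (-(c * |x - w|)) :=
  (integrable_exp_neg_mul_abs hc).comp_sub_left x

theorem exp_mul_abs_le {ε : ℝ} (hε : 0 ≤ ε) (x y : ℝ) :
    Real.exp (ε * |y|) ≤ Real.exp (ε * |x|) * Real.exp (ε * |y - x|) := by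
  rw [← Real.exp_add, Real.exp_le_exp, ← mul_add]
  gcongr
  calc |y| = |x + (y - x)| := by rw [add_sub_cancel]
    _ ≤ _ := abs_add_le _ _

/-- The integral over the outermost variables converges even without the cutoff. -/
theorem integrable_phase_mul_integral {v v' : ℂ} (hv : v.im < 0) (hv' : v'.im ≤ v.im)
    {h : ℝ → ℂ} (hm : Measurable h) {C : ℝ} (hC : 0 ≤ C)
    (hh : ∀ y, ‖h y‖ ≤ C * Real.exp (-v.im / 2 * |y|)) (x : ℝ) :
    Integrable fun w => phase v (x - w) * ∫ y, phase v' (y - w) * h y := by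
  -- Half of the decay rate `-Im v` pays for the growth of `h`; the other half gives integrability.
  have hε : 0 < -v.im / 2 := by linarith
  obtain ⟨A, hA, hA'⟩ := exists_norm_phase_mul_exp_le v hε.le hε.le (by linarith)
  obtain ⟨B, hB, hB'⟩ := exists_norm_phase_mul_exp_le v' hε.le hε.le (by linarith)
  generalize -v.im / 2 = ε at *
  set J := ∫ y : ℝ, Real.exp (-(ε * |y|)) with hJ
  have hJ0 : 0 ≤ J := integral_nonneg fun y => (Real.exp_pos _).le
  have key : ∀ w, ‖∫ y, phase v' (y - w) * h y‖ ≤ C * B * J * Real.exp (ε * |w|) := by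
    intro w
    have hi : Integrable fun y => C * B * Real.exp (ε * |w|) * Real.exp (-(ε * |y - w|)) :=
      ((integrable_exp_neg_mul_abs hε).comp_sub_right w).const_mul _
    refine (norm_integral_le_of_norm_le hi (Eventually.of_forall fun y => ?_)).trans_eq ?_
    · calc ‖phase v' (y - w) * h y‖ ≤ ‖phase v' (y - w)‖ *
            (C * (Real.exp (ε * |w|) * Real.exp (ε * |y - w|))) := by
            rw [norm_mul]
            gcongr
            refine (hh y).trans ?_
            gcongr
            exact exp_mul_abs_le hε.le w y
        _ = C * Real.exp (ε * |w|) * (‖phase v' (y - w)‖ * Real.exp (ε * |y - w|)) := by ring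
        _ ≤ C * Real.exp (ε * |w|) * (B * Real.exp (-(ε * |y - w|))) :=
          mul_le_mul_of_nonneg_left (hB' _) (by positivity)
        _ = _ := by ring
    · rw [integral_const_mul, integral_sub_right_eq_self (fun y => Real.exp (-(ε * |y|))) w]
      ring
  refine ((integrable_exp_neg_mul_abs_sub hε x).const_mul
    (C * B * J * Real.exp (ε * |x|) * A)).mono' ?_ (Eventually.of_forall fun w => ?_)
  · have h1 : Measurable fun q : ℝ × ℝ => phase v' (q.2 - q.1) * h q.2 :=
      ((continuous_phase v').measurable.comp (by fun_prop)).mul (hm.comp measurable_snd)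
    exact ((continuous_phase v).comp (by fun_prop)).aestronglyMeasurable.mul
      (h1.stronglyMeasurable.integral_prod_right (ν := volume)).aestronglyMeasurable
  · calc _ ≤ ‖phase v (x - w)‖ *
          (C * B * J * (Real.exp (ε * |x|) * Real.exp (ε * |w - x|))) := by
          rw [norm_mul]
          gcongr
          refine (key w).trans ?_
          gcongr
          exact exp_mul_abs_le hε.le x w
      _ = C * B * J * Real.exp (ε * |x|) * (‖phase v (x - w)‖ * Real.exp (ε * |x - w|)) := by
        rw [abs_sub_comm w x]; ring
      _ ≤ C * B * J * Real.exp (ε * |x|) * (A * Real.exp (-(ε * |x - w|))) :=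
        mul_le_mul_of_nonneg_left (hA' _) (by positivity)
      _ = _ := by ring

theorem tendsto_integral_cutoff {G : ℝ → ℂ} (hG : Integrable G) :
    Tendsto (fun t : ℝ => ∫ w, (Real.exp (-(Real.exp (-t) * Real.exp w)) : ℂ) * G w) atTop
      (𝓝 (∫ w, G w)) := by
  refine tendsto_integral_filter_of_dominated_convergence (fun w => ‖G w‖)
    (Eventually.of_forall fun t => ?_)
    (Eventually.of_forall fun t => Eventually.of_forall fun w => ?_)
    hG.norm (Eventually.of_forall fun w => ?_)
  · exact Continuous.aestronglyMeasurable (by fun_prop) |>.mul hG.1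
  · rw [norm_mul, Complex.norm_real, Real.norm_eq_abs, Real.abs_exp]
    exact mul_le_of_le_one_left (norm_nonneg _) (Real.exp_le_one_iff.2 (by
      rw [neg_nonpos]; positivity))
  · have h1 : Tendsto (fun t : ℝ => Real.exp (-(Real.exp (-t) * Real.exp w))) atTop (𝓝 1) := by
      have := (((Real.tendsto_exp_neg_atTop_nhds_zero.mul_const (Real.exp w)).neg).rexp)
      simpa using this
    have h2 := ((Complex.continuous_ofReal.tendsto 1).comp h1).mul_const (G w)
    simpa using h2

/-- The full factor is `r e^{-r}` with `r = e^{w-t}`, bounded by `1` and tending to `0` pointwise.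
-/
theorem tendsto_exp_neg_mul_integral_cutoff {G : ℝ → ℂ} (hG : Integrable G) :
    Tendsto (fun t : ℝ => (Real.exp (-t) : ℂ) *
      ∫ w, (Real.exp (-(Real.exp (-t) * Real.exp w)) : ℂ) * (Real.exp w * G w)) atTop (𝓝 0) := by
  simp_rw [← integral_const_mul]
  rw [show (0 : ℂ) = ∫ _ : ℝ, (0 : ℂ) by simp]
  refine tendsto_integral_filter_of_dominated_convergence (fun w => ‖G w‖)
    (Eventually.of_forall fun t => ?_)
    (Eventually.of_forall fun t => Eventually.of_forall fun w => ?_)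
    hG.norm (Eventually.of_forall fun w => ?_)
  · refine AEStronglyMeasurable.const_mul ?_ _
    refine AEStronglyMeasurable.mul (Continuous.aestronglyMeasurable (by fun_prop)) ?_
    exact AEStronglyMeasurable.mul (Continuous.aestronglyMeasurable (by fun_prop)) hG.1
  · rw [norm_mul, norm_mul, norm_mul, Complex.norm_real, Complex.norm_real, Complex.norm_real,
      Real.norm_eq_abs, Real.norm_eq_abs, Real.norm_eq_abs, Real.abs_exp, Real.abs_exp,
      Real.abs_exp]
    have h : Real.exp (-t) * Real.exp w * Real.exp (-(Real.exp (-t) * Real.exp w)) ≤ 1 := by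
      rw [Real.exp_neg (Real.exp (-t) * Real.exp w), ← div_eq_mul_inv,
        div_le_one (Real.exp_pos _)]
      linarith [Real.add_one_le_exp (Real.exp (-t) * Real.exp w)]
    calc _ = Real.exp (-t) * Real.exp w * Real.exp (-(Real.exp (-t) * Real.exp w)) * ‖G w‖ := by
          ring
      _ ≤ _ := mul_le_of_le_one_left (norm_nonneg _) h
  · have h1 : Tendsto (fun t : ℝ => Real.exp (-t) * Real.exp (-(Real.exp (-t) * Real.exp w))) atTop
        (𝓝 0) := by
      have := Real.tendsto_exp_neg_atTop_nhds_zero.mul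
        (((Real.tendsto_exp_neg_atTop_nhds_zero.mul_const (Real.exp w)).neg).rexp)
      simpa using this
    have h2 := ((Complex.continuous_ofReal.tendsto 0).comp h1).mul_const (Real.exp w * G w)
    simpa [mul_assoc] using h2

/-- For `y ≥ 0` a polynomial is below any `e^{εy}`; for `y < 0` the cutoff cancels `e^{b|y|}` at the
cost of `e^{bt}`. The arbitrarily small rate `ε` is what makes every `Im v < 0` admissible in the
limit. -/
theorem expFamily_layerFun_of_tempered {f : (Fin n → ℝ) → ℂ} (hm : Measurable f) {j : Fin n}
    (hf : f ∈ temperedGrowth j) {ε : ℝ} (hε : 0 < ε) :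
    ExpFamily (fun y => Real.exp (ε * |y|)) (layerFun j 0 f) := by
  obtain ⟨C, b, N, hC, hb, h⟩ := hf
  obtain ⟨A, hA, hA'⟩ := exists_pow_le_exp hε N
  obtain ⟨B, hB, hB'⟩ := exists_exp_neg_exp_le b
  refine ⟨?_, fun _ => (Real.exp_pos _).le, C * (A + B), b + b, by positivity, by positivity,
    fun y x t => ?_⟩
  · have h1 : Measurable fun q : ℝ × (Fin n → ℝ) × ℝ => f (Function.update q.2.1 j q.1) :=
      hm.comp (measurable_update'.comp (f := fun q : ℝ × (Fin n → ℝ) × ℝ => (q.2.1, q.1))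
        (by fun_prop))
    exact Measurable.mul (by fun_prop) h1
  · have e : layerFun j 0 f y x t =
        (Real.exp (-Real.exp (-y - t)) : ℂ) * f (Function.update x j y) := by
      simp [layerFun]
    have hs : ∑ i ∈ Finset.univ.erase j, |Function.update x j y i| ≤ weight x t := by
      calc _ = ∑ i ∈ Finset.univ.erase j, |x i| := Finset.sum_congr rfl fun i hi => by
            rw [Function.update_of_ne (Finset.ne_of_mem_erase hi)]
        _ ≤ ∑ i, |x i| := Finset.sum_le_sum_of_subset_of_nonneg (Finset.erase_subset _ _)
          fun i _ _ => abs_nonneg _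
        _ ≤ weight x t := le_add_of_nonneg_right (abs_nonneg t)
    have hw := weight_nonneg x t
    have key : Real.exp (-Real.exp (-y - t)) * halfGrowth b N y ≤
        (A + B) * Real.exp (ε * |y|) * Real.exp (b * weight x t) := by
      unfold halfGrowth
      split_ifs with hy
      · calc _ ≤ 1 * (A * Real.exp (ε * y)) := by
              gcongr
              · exact Real.exp_le_one_iff.2 (neg_nonpos.2 (Real.exp_pos _).le)
              · exact hA' y hy
          _ ≤ (A + B) * Real.exp (ε * |y|) := by
            rw [one_mul, abs_of_nonneg hy]
            gcongr
            linarith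
          _ ≤ _ := le_mul_of_one_le_right (by positivity) (Real.one_le_exp (by positivity))
      · rw [abs_of_neg (not_le.1 hy)]
        calc _ ≤ B * Real.exp (-(b * (-y - t))) * Real.exp (b * -y) := by
              gcongr
              exact hB' b hb le_rfl _
          _ = B * Real.exp (b * t) := by
            rw [mul_assoc, ← Real.exp_add]
            ring_nf
          _ ≤ (A + B) * Real.exp (ε * -y) * Real.exp (b * weight x t) := by
            have h1 : 1 ≤ Real.exp (ε * -y) := Real.one_le_exp (by nlinarith [not_le.1 hy])
            gcongr
            · calc B ≤ A + B := by linarith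
                _ ≤ _ := le_mul_of_one_le_right (by linarith) h1
            · exact (le_abs_self t).trans (abs_le_weight x t)
    rw [e, norm_mul, Complex.norm_real, Real.norm_eq_abs, Real.abs_exp]
    calc _ ≤ Real.exp (-Real.exp (-y - t)) * (C * Real.exp (b * weight x t) *
          halfGrowth b N y) := by
          gcongr
          refine (h _).trans ?_
          rw [Function.update_self]
          have := halfGrowth_nonneg b N y
          gcongr
      _ = C * Real.exp (b * weight x t) * (Real.exp (-Real.exp (-y - t)) * halfGrowth b N y) := by
        ring
      _ ≤ C * Real.exp (b * weight x t) *
          ((A + B) * Real.exp (ε * |y|) * Real.exp (b * weight x t)) := by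
        gcongr
      _ = _ := by rw [add_mul b, Real.exp_add]; ring

theorem exists_norm_layer_le {α β : ℝ} (hβ : 0 < β) {v : ℂ} (hv : -g α β < v.im)
    (l : List (Fin n)) (j : Fin n) (x : Fin n → ℝ) {f : (Fin n → ℝ) → ℂ} (hm : Measurable f)
    (hf : f ∈ temperedGrowth j) {ε : ℝ} (hε : 0 < ε) :
    ∃ C : ℝ, 0 ≤ C ∧ ∀ y, ‖layer α β v l j x 0 f y‖ ≤ C * Real.exp (ε * |y|) := by
  obtain ⟨C, b, hC, hb, h⟩ := ((expFamily_layerFun_of_tempered hm hf hε).actProd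
    (admissible_of_mem_siteFactors α hβ hv l)).bdd
  refine ⟨C * Real.exp (b * weight x (x j)), by positivity, fun y => (h y x (x j)).trans_eq ?_⟩
  ring

theorem siteU_cons_eq {α β : ℝ} (hβ : 0 < β) {v : ℂ} (hv : -g α β < v.im)
    {j : Fin n} {l : List (Fin n)} (hj : j ∉ l) {f : (Fin n → ℝ) → ℂ} (hf : ExpGrowth f)
    (x : Fin n → ℝ) (t m : ℝ) : siteU α β v (j :: l) 0 m f x t =
    ∫ w, (Real.exp (-(Real.exp (-t) * Real.exp w)) : ℂ) * (Real.exp (m * w) *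
      (phase v (x j - w) * ∫ y, phase v (y - w) * layer α β v l j x 0 f y)) := by
  rw [siteU_cons hβ hv hj hf, siteIntegral, add_zero]
  congr 1
  funext w
  unfold outerWeight
  ring

theorem integrable_phase_mul_layer {α β : ℝ} (hβ : 0 < β) {v : ℂ} (hv : -g α β < v.im)
    (hv' : v.im < 0) {j : Fin n} {l : List (Fin n)} {f : (Fin n → ℝ) → ℂ}
    (hf : ExpGrowth f) (hf' : f ∈ temperedGrowth j) (x : Fin n → ℝ) {v' : ℂ} (h : v'.im ≤ v.im) :
    Integrable fun w => phase v (x j - w) * ∫ y, phase v' (y - w) * layer α β v l j x 0 f y := by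
  obtain ⟨C, hC, hC'⟩ := exists_norm_layer_le hβ hv l j x hf.1 hf' (ε := -v.im / 2) (by linarith)
  exact integrable_phase_mul_integral hv' h (hf.rapidlyDecaying_layer hβ hv l j x 0).meas hC hC' _

theorem exists_tendsto_siteU {α β : ℝ} (hβ : 0 < β) {v : ℂ} (hv : -g α β < v.im)
    (hv' : v.im < 0) {j : Fin n} {l : List (Fin n)} (hj : j ∉ l) {f : (Fin n → ℝ) → ℂ}
    (hf : ExpGrowth f) (hf' : f ∈ temperedGrowth j) (x : Fin n → ℝ) :
    ∃ q, Tendsto (siteU α β v (j :: l) 0 0 f x) atTop (𝓝 q) := by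
  refine ⟨_, (tendsto_integral_cutoff
    (integrable_phase_mul_layer (l := l) hβ hv hv' hf hf' x le_rfl)).congr fun t => ?_⟩
  rw [siteU_cons_eq hβ hv hj hf]
  simp

theorem tendsto_exp_neg_mul_siteU_one {α β : ℝ} (hβ : 0 < β) {v : ℂ} (hv : -g α β < v.im)
    (hv' : v.im < 0) {j : Fin n} {l : List (Fin n)} (hj : j ∉ l) {f : (Fin n → ℝ) → ℂ}
    (hf : ExpGrowth f) (hf' : f ∈ temperedGrowth j) (x : Fin n → ℝ) :
    Tendsto (fun t : ℝ => (Real.exp (-t) : ℂ) * siteU α β v (j :: l) 0 1 f x t) atTop (𝓝 0) := by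
  refine (tendsto_exp_neg_mul_integral_cutoff
    (integrable_phase_mul_layer (l := l) hβ hv hv' hf hf' x le_rfl)).congr fun t => ?_
  rw [siteU_cons_eq hβ hv hj hf]
  simp only [one_mul]

/-- The growing factor is traded for a shift, `e^y phase_v(y - w) = e^w phase_{v-i}(y - w)`. The
factor `e^w` is then beaten by `e^{-t}` and the cutoff. -/
theorem tendsto_exp_neg_mul_siteU_exp_mul {α β : ℝ} (hβ : 0 < β) {v : ℂ} (hv : -g α β < v.im)
    (hv' : v.im < 0) {j : Fin n} {l : List (Fin n)} (hj : j ∉ l) {f : (Fin n → ℝ) → ℂ}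
    (hf : ExpGrowth f) (hf' : f ∈ temperedGrowth j) (x : Fin n → ℝ)
    (hf₁ : ExpGrowth fun x => -(Real.exp (1 * x j) : ℂ) * f x) :
    Tendsto (fun t : ℝ => (Real.exp (-t) : ℂ) *
      siteU α β v (j :: l) 0 0 (fun x => -(Real.exp (1 * x j) : ℂ) * f x) x t) atTop (𝓝 0) := by
  have h := (tendsto_exp_neg_mul_integral_cutoff (integrable_phase_mul_layer (l := l) hβ hv hv' hf
    hf' x (v' := v - Complex.I) (by simp))).neg
  rw [neg_zero] at h
  refine h.congr fun t => ?_
  rw [siteU_cons_eq hβ hv hj hf₁, ← mul_neg, ← integral_neg]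
  congr 2
  funext w
  have e : ∀ y, phase v (y - w) *
      layer α β v l j x 0 (fun x => -(Real.exp (1 * x j) : ℂ) * f x) y =
      -Real.exp w * (phase (v - Complex.I) (y - w) * layer α β v l j x 0 f y) := fun y => by
    rw [layer_mul hβ hv l j x 0 f (fun y => -(Real.exp (1 * y) : ℂ)) y, phase_sub_I, one_mul]
    have : Real.exp y = Real.exp w * Real.exp (y - w) := by rw [← Real.exp_add]; ring_nf
    rw [this]
    push_cast
    ring
  simp only [e, integral_const_mul]
  simp only [zero_mul, Real.exp_zero, Complex.ofReal_one]
  ring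

theorem opU_eq_siteU (α β : ℝ) (v : ℂ) (f : (Fin n → ℝ) → ℂ) :
    opU α β n v f = siteU α β v (List.finRange n).reverse 0 0 f := by
  unfold opU siteU
  rw [monodromyFactors_eq]
  simp

theorem baxterDefined_of_tendsto {α β : ℝ} (hβ : 0 < β) {v : ℂ} (hv : -g α β < v.im)
    {f : (Fin n → ℝ) → ℂ} (hf : ExpGrowth f)
    (h : ∀ x, ∃ q, Tendsto (opU α β n v f x) atTop (𝓝 q)) : BaxterDefined α β n v f := by
  refine ⟨?_, h⟩
  rw [monodromyFactors_eq]
  exact convergesOn_of_admissible (admissible_of_mem_siteFactors α hβ hv _) hf.expBounded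

/-- The Baxter equation, with the sites in the list `j :: l`. -/
theorem baxter_siteU {α β : ℝ} (hβ : 0 < β) {u : ℂ} (hu : 1 - g α β < u.im) (hu' : u.im < 0)
    {j : Fin n} {l : List (Fin n)} (hl : (j :: l).Nodup) {φ : Smooth n}
    (hφ : φ ∈ derivClosure (temperedGrowth j)) (x : Fin n → ℝ) {p q : ℂ}
    (hp : Tendsto (siteU α β u (j :: l) 0 0 (siteMatrix α β u (j :: l) 0 1 φ : Smooth n) x)
      atTop (𝓝 p))
    (hq : Tendsto (siteU α β (u - Complex.I) (j :: l) 0 0 φ x) atTop (𝓝 q)) :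
    p = -((β : ℂ) * (g α β + Complex.I * u) / (2 * u)) * q := by
  have hj := (List.nodup_cons.1 hl).1
  have hv : -g α β < u.im := by linarith
  have hle := derivClosure_mono (temperedGrowth_le_expGrowthSpace j)
  have h0 := siteMatrix_cons_mem hj α β u hφ
  have hG := siteMatrix_mul_reflectedLax_mem hj α β u hφ 0
  have h1 := tendsto_exp_neg_mul_siteU_one hβ hv hu' hj (expGrowth_of_mem (hle h0))
    (coe_mem_of_mem_derivClosure h0) x
  have e1 := expGrowth_of_mem (preserves_siteMatrix_expGrowth α β u (j :: l) 1 1 φ (hle hφ))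
  rw [siteMatrix_cons_one] at e1
  have h2 := tendsto_exp_neg_mul_siteU_exp_mul hβ hv hu' hj (expGrowth_of_mem (hle hG))
    (coe_mem_of_mem_derivClosure hG) x e1
  -- Limit of the left side of the intertwining relation in the second column at `S = 0`, where `σ =
  -- e^{-t}`: only the middle term survives.
  have h3 := ((h1.const_mul Complex.I).sub (hp.const_mul (2 * u))).sub h2
  have h4 := hq.const_mul (β * (g α β + Complex.I * u))
  have e := tendsto_nhds_unique (h3.congr fun t => ?_) h4
  · have hu0 : u ≠ 0 := fun h => by simp [h] at hu'
    field_simp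
    linear_combination -e
  · have h := intertwining hβ hu hl (hle hφ) le_rfl x t 1
    rw [← siteMatrix_cons_one]
    simp only [add_zero, Matrix.cons_val_one, Matrix.cons_val_fin_one] at h
    linear_combination h

end BCToda

/-! ### The Baxter equation for the chain -/

theorem mainTheorem5 (n : ℕ) (hn : 1 ≤ n) (α β : ℝ) (hβ : 0 < β)
    (u : ℂ) (hu : 1 - BCToda.g α β < u.im) (hu' : u.im < 0)
    (φ : BCToda.Smooth n) (hφ : φ ∈ BCToda.temperedSpace (⟨n - 1, by omega⟩ : Fin n)) :
    BCToda.opB α β n u φ ∈ BCToda.temperedSpace (⟨n - 1, by omega⟩ : Fin n) ∧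
    BCToda.BaxterDefined α β n u (BCToda.opB α β n u φ) ∧
    BCToda.BaxterDefined α β n (u - Complex.I) φ ∧
    ∀ x : Fin n → ℝ,
      BCToda.baxterQ α β n u (BCToda.opB α β n u φ) x =
        -((β : ℂ) * (BCToda.g α β + Complex.I * u) / (2 * u)) *
          BCToda.baxterQ α β n (u - Complex.I) φ x := by
  obtain ⟨j, hj⟩ : ∃ j : Fin n, j = ⟨n - 1, by omega⟩ := ⟨_, rfl⟩
  -- The reversed list begins with the last site, the coordinate in which the growth is polynomial
  -- at `+∞`.
  obtain ⟨l, hl⟩ : ∃ l, (List.finRange n).reverse = j :: l := by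
    obtain ⟨m, rfl⟩ : ∃ m, n = m + 1 := ⟨n - 1, by omega⟩
    exact ⟨_, by rw [List.finRange_succ_last, List.reverse_append, hj]; rfl⟩
  have hnd : (j :: l).Nodup := hl ▸ List.nodup_reverse.2 (List.nodup_finRange n)
  have hjl := (List.nodup_cons.1 hnd).1
  rw [← hj, BCToda.mem_temperedSpace_iff] at hφ
  have hB := BCToda.siteMatrix_cons_mem hjl α β u hφ
  rw [← hj, BCToda.mem_temperedSpace_iff, BCToda.opB_eq, hl]
  have hle := BCToda.derivClosure_mono (BCToda.temperedGrowth_le_expGrowthSpace j)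
  have hv : -BCToda.g α β < u.im := by linarith
  have hv' : -BCToda.g α β < (u - Complex.I).im := by
    rw [Complex.sub_im, Complex.I_im]
    linarith
  have hw : (u - Complex.I).im < 0 := by
    rw [Complex.sub_im, Complex.I_im]
    linarith
  have q₁ := BCToda.exists_tendsto_siteU hβ hv hu' hjl (BCToda.expGrowth_of_mem (hle hB))
    (BCToda.coe_mem_of_mem_derivClosure hB)
  have q₂ := BCToda.exists_tendsto_siteU hβ hv' hw hjl (BCToda.expGrowth_of_mem (hle hφ))
    (BCToda.coe_mem_of_mem_derivClosure hφ)
  rw [← hl, ← BCToda.opU_eq_siteU, hl] at q₁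
  rw [← hl, ← BCToda.opU_eq_siteU] at q₂
  refine ⟨hB, BCToda.baxterDefined_of_tendsto hβ hv (BCToda.expGrowth_of_mem (hle hB)) q₁,
    BCToda.baxterDefined_of_tendsto hβ hv' (BCToda.expGrowth_of_mem (hle hφ)) q₂, fun x => ?_⟩
  obtain ⟨p, hp⟩ := q₁ x
  obtain ⟨q, hq⟩ := q₂ x
  rw [BCToda.baxterQ, BCToda.baxterQ, hp.limUnder_eq, hq.limUnder_eq]
  rw [BCToda.opU_eq_siteU, hl] at hp hq
  exact BCToda.baxter_siteU hβ hu hu' hnd hφ x hp hq
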